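/- Let $T>0$, let $(\Omega,\mathcal F,\mathbb P)$ be a complete probability space, $W$ an $n$-dimensional standard Wiener process and $x_0$ an $n$-dimensional random vector independent of $W$ with $\mathbb E|x_0|^2<\infty$; put $\mathcal F_t=\sigma(x_0,W_s,s\le t)$. Let $A,\bar A,Q,\bar Q,S$ ($n\times n$), $B$ ($n\times m$), $R$ ($m\times m$) be bounded measurable deterministic matrix-valued functions on $[0,T]$ and $\sigma\in L^2(0,T;\mathbb R^{n\times n})$, where $Q_t,\bar Q_t$ are symmetric nonnegative definite, $R_t$ is symmetric and $R_t\ge\delta I$ for some $\delta>0$ and all $t\in[0,T]$. An admissible control is an element of $L^2_{\mathcal F}(0,T;\mathbb R^m)$, the space of $\mathcal F_t$-adapted, square integrable $\mathbb R^m$-valued processes (identified when equal $dt\otimes\mathbb P$-a.e.). Mean field game. An admissible control $u$ is an equilibrium strategy if, with $y$ its trajectory, i.e. the square integrable solution of $$dy_t=(A_ty_t+B_tu_t+\bar A_t\mathbb E[y_t])\,dt+\sigma_t\,dW_t,\qquad y_0=x_0,$$ and $z_t=\mathbb E[y_t]$ kept fixed, $u$ minimizes over all admissible controls $v$ the cost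 $$J(v)=\mathbb E\Big[\tfrac12\int_0^T x_t^*Q_tx_t+v_t^*R_tv_t+(x_t-S_tz_t)^*\bar Q_t(x_t-S_tz_t)\,dt\Big]+\mathbb E\Big[\tfrac12x_T^*Q_Tx_T+\tfrac12(x_T-S_Tz_T)^*\bar Q_T(x_T-S_Tz_T)\Big],$$ where $dx_t=(A_tx_t+B_tv_t+\bar A_tz_t)\,dt+\sigma_t\,dW_t$, $x(0)=x_0$. Theorem. There is an equilibrium strategy if and only if the system of ordinary differential equations $$\frac{d}{dt}\begin{pmatrix}\xi_t\\-\eta_t\end{pmatrix}=\begin{pmatrix}A_t+\bar A_t&-B_tR_t^{-1}B_t^*\\Q_t+\bar Q_t(I-S_t)&A_t^*\end{pmatrix}\begin{pmatrix}\xi_t\\\eta_t\end{pmatrix},\qquad \xi_0=\mathbb E[x_0],\quad \eta_T=(Q_T+\bar Q_T(I-S_T))\xi_T$$ has a solution $(\xi,\eta)$ on $[0,T]$ (absolutely continuous, the equations holding for a.e. $t$); and there is exactly one equilibrium strategy if and only if this system has exactly one solution. Moreover, the condition depends on $\bar Q$ and $S$ only through $\mathcal S=\bar Q(I-S)$: if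 $(\bar Q,S)$ is replaced by another pair $(\bar Q',S')$ satisfying the same assumptions with $\bar Q'_t(I-S'_t)=\bar Q_t(I-S_t)$ for all $t\in[0,T]$, all other data being unchanged, then the system has the same solutions, and an equilibrium strategy exists (respectively, exists uniquely) for the one pair if and only if it does for the other. -/

import Mathlib

open MeasureTheory ProbabilityTheory Filter Topology Matrix
open scoped NNReal ENNReal

noncomputable section

namespace LQMFG

/-! ### Coefficients -/

/-- The time-dependent coefficient matrices: state dimension `n` (also the dimension of the Wiener
process), control dimension `m`. Terminal weights are the values at the horizon `T`. -/
structure Coeffs (n m : ℕ) where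
  A : ℝ → Matrix (Fin n) (Fin n) ℝ
  Abar : ℝ → Matrix (Fin n) (Fin n) ℝ
  B : ℝ → Matrix (Fin n) (Fin m) ℝ
  sig : ℝ → Matrix (Fin n) (Fin n) ℝ
  Q : ℝ → Matrix (Fin n) (Fin n) ℝ
  Qbar : ℝ → Matrix (Fin n) (Fin n) ℝ
  S : ℝ → Matrix (Fin n) (Fin n) ℝ
  R : ℝ → Matrix (Fin m) (Fin m) ℝ

/-- A (Lebesgue) measurable, bounded matrix-valued function on `[0, T]`. -/
def IsBoundedCoeff {a b : ℕ} (T : ℝ) (M : ℝ → Matrix (Fin a) (Fin b) ℝ) : Prop :=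
  (∀ i j, AEMeasurable (fun t => M t i j) (volume.restrict (Set.Icc 0 T))) ∧
    ∃ C : ℝ, ∀ t ∈ Set.Icc 0 T, ∀ i j, |M t i j| ≤ C

/-- The standing assumptions on the coefficients: everything is bounded except `σ`, which is in
`L²(0,T)`; `Q` and `Q̄` are symmetric nonnegative definite, and `R ≥ δ I` is symmetric. -/
structure Coeffs.Standing {n m : ℕ} (c : Coeffs n m) (T : ℝ) : Prop where
  bdd_A : IsBoundedCoeff T c.A
  bdd_Abar : IsBoundedCoeff T c.Abar
  bdd_B : IsBoundedCoeff T c.B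
  bdd_Q : IsBoundedCoeff T c.Q
  bdd_Qbar : IsBoundedCoeff T c.Qbar
  bdd_S : IsBoundedCoeff T c.S
  bdd_R : IsBoundedCoeff T c.R
  sq_int_sig : ∀ i j, MemLp (fun t => c.sig t i j) 2 (volume.restrict (Set.Icc 0 T))
  psd_Q : ∀ t ∈ Set.Icc 0 T, (c.Q t).PosSemidef
  psd_Qbar : ∀ t ∈ Set.Icc 0 T, (c.Qbar t).PosSemidef
  coercive_R : ∃ δ : ℝ, 0 < δ ∧
    ∀ t ∈ Set.Icc 0 T, (c.R t - δ • (1 : Matrix (Fin m) (Fin m) ℝ)).PosSemidef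

/-! ### Wiener process, filtration, Wiener integral -/

section Noise

variable {Ω : Type*} [MeasurableSpace Ω]

/-- An `n`-dimensional standard Wiener process: the coordinates are independent standard real
Brownian motions. -/
structure IsWiener {n : ℕ} (W : ℝ≥0 → Ω → Fin n → ℝ) (P : Measure Ω) : Prop where
  measurable : ∀ t, Measurable (W t)
  brownian : ∀ j, IsBrownianReal (fun t ω => W t ω j) P
  indep : iIndepFun (fun (j : Fin n) (ω : Ω) (t : ℝ≥0) => W t ω j) P

/-- `𝓕_t = σ(x₀, W_s, s ≤ t)`. -/
@[reducible] def filtr {n : ℕ} (x0 : Ω → Fin n → ℝ) (W : ℝ≥0 → Ω → Fin n → ℝ) (t : ℝ) :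
    MeasurableSpace Ω :=
  MeasurableSpace.comap x0 inferInstance ⊔
    ⨆ (s : ℝ≥0) (_ : (s : ℝ) ≤ t), MeasurableSpace.comap (W s) inferInstance

/-- A deterministic step function `∑ₖ aₖ 1_{(sₖ, tₖ]}` on `[0, ∞)`. -/
structure StepFun where
  card : ℕ
  left : Fin card → ℝ≥0
  right : Fin card → ℝ≥0
  le : ∀ k, left k ≤ right k
  coef : Fin card → ℝ

/-- The step function as a function on the line. -/
def StepFun.eval (φ : StepFun) (s : ℝ) : ℝ :=
  ∑ k, (Set.Ioc (φ.left k : ℝ) (φ.right k)).indicator (fun _ => φ.coef k) s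

/-- The elementary integral `∑ₖ aₖ (β_{tₖ} - β_{sₖ})`. -/
def StepFun.integral (φ : StepFun) (β : ℝ≥0 → Ω → ℝ) (ω : Ω) : ℝ :=
  ∑ k, φ.coef k * (β (φ.right k) ω - β (φ.left k) ω)

/-- `I` is (a version of) the stochastic integral `∫₀ᵗ f dβ` of the deterministic function `f`:
the `L²(P)`-limit of elementary integrals of step functions converging to `f 1_{(0,t]}` in `L²`.
By the Itô isometry this determines `I` almost surely. -/
def IsWienerIntegral (P : Measure Ω) (β : ℝ≥0 → Ω → ℝ) (f : ℝ → ℝ) (t : ℝ) (I : Ω → ℝ) : Prop :=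
  MemLp I 2 P ∧ ∃ φ : ℕ → StepFun,
    Tendsto (fun k => eLpNorm (fun s => (φ k).eval s - (Set.Ioc 0 t).indicator f s) 2 volume)
      atTop (𝓝 0) ∧
    Tendsto (fun k => eLpNorm (fun ω => (φ k).integral β ω - I ω) 2 P) atTop (𝓝 0)

/-! ### Controls, state equation, cost, equilibrium -/

/-- The product measure `dt ⊗ P` on `[0, T] × Ω`. -/
def timeMeasure (P : Measure Ω) (T : ℝ) : Measure (ℝ × Ω) :=
  (volume.restrict (Set.Icc 0 T)).prod P

variable {n m : ℕ}

/-- `v ∈ L²_𝓕(0, T; ℝᵐ)`: an adapted, (jointly) measurable, square integrable process. -/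
structure IsAdmissible (P : Measure Ω) (T : ℝ) (x0 : Ω → Fin n → ℝ) (W : ℝ≥0 → Ω → Fin n → ℝ)
    (v : ℝ → Ω → Fin m → ℝ) : Prop where
  adapted : ∀ t ∈ Set.Icc 0 T, Measurable[filtr x0 W t] (v t)
  memLp : MemLp (Function.uncurry v) 2 (timeMeasure P T)

/-- `x` is a trajectory on `[0, T]` of
`dx_t = (A_t x_t + B_t v_t + Ā_t z_t) dt + σ_t dW_t`, `x(0) = x₀`,
for the control `v` and the deterministic function `z`: a measurable square integrable process
which satisfies the integrated equation almost surely at each time of `[0, T]`.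
Trajectories are thus processes up to modification. As the noise is additive, any two trajectories
for the same `v` and `z` are modifications of each other, and one of them has continuous paths and
is adapted (to the completed filtration); means and costs do not see the choice. -/
structure IsTrajectory (c : Coeffs n m) (P : Measure Ω) (T : ℝ) (x0 : Ω → Fin n → ℝ)
    (W : ℝ≥0 → Ω → Fin n → ℝ) (z : ℝ → Fin n → ℝ) (v : ℝ → Ω → Fin m → ℝ)
    (x : ℝ → Ω → Fin n → ℝ) : Prop where
  memLp : MemLp (Function.uncurry x) 2 (timeMeasure P T)
  memLp_time : ∀ t ∈ Set.Icc 0 T, MemLp (x t) 2 P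
  equation : ∀ t ∈ Set.Icc 0 T, ∃ I : Fin n → Fin n → Ω → ℝ,
    (∀ i j, IsWienerIntegral P (fun s ω => W s ω j) (fun s => c.sig s i j) t (I i j)) ∧
    ∀ᵐ ω ∂P, x t ω =
      x0 ω + (∫ s in (0 : ℝ)..t, (c.A s *ᵥ x s ω + c.B s *ᵥ v s ω + c.Abar s *ᵥ z s))
        + fun i => ∑ j, I i j ω

/-- The cost of the control `v` with trajectory `x`, given the deterministic function `z`. -/
def cost (c : Coeffs n m) (P : Measure Ω) (T : ℝ) (z : ℝ → Fin n → ℝ)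
    (v : ℝ → Ω → Fin m → ℝ) (x : ℝ → Ω → Fin n → ℝ) : ℝ :=
  (∫ ω, (1 / 2) * (∫ t in (0 : ℝ)..T,
      (x t ω ⬝ᵥ (c.Q t *ᵥ x t ω) + v t ω ⬝ᵥ (c.R t *ᵥ v t ω)
        + (x t ω - c.S t *ᵥ z t) ⬝ᵥ (c.Qbar t *ᵥ (x t ω - c.S t *ᵥ z t)))) ∂P)
  + ∫ ω, ((1 / 2) * (x T ω ⬝ᵥ (c.Q T *ᵥ x T ω))
      + (1 / 2) * ((x T ω - c.S T *ᵥ z T) ⬝ᵥ (c.Qbar T *ᵥ (x T ω - c.S T *ᵥ z T)))) ∂P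

/-- `u` is an equilibrium strategy of the mean field game: if `y` is its own trajectory, driven by
its own mean `𝔼[y]`, then `u` minimizes the cost over all admissible controls when the mean field
term is frozen at `𝔼[y]`. -/
def IsEquilibrium (c : Coeffs n m) (P : Measure Ω) (T : ℝ) (x0 : Ω → Fin n → ℝ)
    (W : ℝ≥0 → Ω → Fin n → ℝ) (u : ℝ → Ω → Fin m → ℝ) : Prop :=
  IsAdmissible P T x0 W u ∧
  ∃ y : ℝ → Ω → Fin n → ℝ,
    IsTrajectory c P T x0 W (fun t => ∫ ω, y t ω ∂P) u y ∧
    ∀ v : ℝ → Ω → Fin m → ℝ, IsAdmissible P T x0 W v →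
      ∀ x : ℝ → Ω → Fin n → ℝ, IsTrajectory c P T x0 W (fun t => ∫ ω, y t ω ∂P) v x →
        cost c P T (fun t => ∫ ω, y t ω ∂P) u y ≤ cost c P T (fun t => ∫ ω, y t ω ∂P) v x

/-- There is an equilibrium strategy. -/
def HasEquilibrium (c : Coeffs n m) (P : Measure Ω) (T : ℝ) (x0 : Ω → Fin n → ℝ)
    (W : ℝ≥0 → Ω → Fin n → ℝ) : Prop :=
  ∃ u, IsEquilibrium c P T x0 W u

/-- There is exactly one equilibrium strategy, as an element of `L²_𝓕(0, T; ℝᵐ)`. -/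
def HasUniqueEquilibrium (c : Coeffs n m) (P : Measure Ω) (T : ℝ) (x0 : Ω → Fin n → ℝ)
    (W : ℝ≥0 → Ω → Fin n → ℝ) : Prop :=
  ∃ u, IsEquilibrium c P T x0 W u ∧
    ∀ u', IsEquilibrium c P T x0 W u' →
      Function.uncurry u' =ᵐ[timeMeasure P T] Function.uncurry u

end Noise

/-! ### The forward-backward linear system -/

variable {n m : ℕ}

/-- `(ξ, η)` solves on `[0, T]`, in the sense of Carathéodory (absolutely continuous functions, the
equations holding almost everywhere, as the coefficients are only bounded and measurable),
`ξ' = (A + Ā) ξ - B R⁻¹ B* η`, `-η' = (Q + Q̄ (I - S)) ξ + A* η`,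
`ξ_0 = x̄`, `η_T = (Q_T + Q̄_T (I - S_T)) ξ_T`. -/
structure SolvesSystem (c : Coeffs n m) (T : ℝ) (xbar : Fin n → ℝ) (ξ η : ℝ → Fin n → ℝ) :
    Prop where
  ac_fwd : AbsolutelyContinuousOnInterval ξ 0 T
  ac_bwd : AbsolutelyContinuousOnInterval η 0 T
  ode_fwd : ∀ᵐ t ∂(volume.restrict (Set.Icc 0 T)),
    HasDerivAt ξ ((c.A t + c.Abar t) *ᵥ ξ t - (c.B t * (c.R t)⁻¹ * (c.B t)ᵀ) *ᵥ η t) t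
  ode_bwd : ∀ᵐ t ∂(volume.restrict (Set.Icc 0 T)),
    HasDerivAt (fun s => -η s)
      ((c.Q t + c.Qbar t * (1 - c.S t)) *ᵥ ξ t + (c.A t)ᵀ *ᵥ η t) t
  initial : ξ 0 = xbar
  terminal : η T = (c.Q T + c.Qbar T * (1 - c.S T)) *ᵥ ξ T

/-- The system has a solution. -/
def SystemSolvable (c : Coeffs n m) (T : ℝ) (xbar : Fin n → ℝ) : Prop :=
  ∃ ξ η, SolvesSystem c T xbar ξ η

/-- The system has exactly one solution on `[0, T]`. -/
def SystemUniquelySolvable (c : Coeffs n m) (T : ℝ) (xbar : Fin n → ℝ) : Prop :=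
  ∃ ξ η, SolvesSystem c T xbar ξ η ∧
    ∀ ξ' η', SolvesSystem c T xbar ξ' η' →
      Set.EqOn ξ' ξ (Set.Icc 0 T) ∧ Set.EqOn η' η (Set.Icc 0 T)

/-- Two sets of coefficients which differ on `[0, T]` at most in `Q̄` and `S`, and have the same
`𝒮 = Q̄ (I - S)` there. -/
structure SameUpToS (c c' : Coeffs n m) (T : ℝ) : Prop where
  A : ∀ t ∈ Set.Icc 0 T, c.A t = c'.A t
  Abar : ∀ t ∈ Set.Icc 0 T, c.Abar t = c'.Abar t
  B : ∀ t ∈ Set.Icc 0 T, c.B t = c'.B t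
  sig : ∀ t ∈ Set.Icc 0 T, c.sig t = c'.sig t
  Q : ∀ t ∈ Set.Icc 0 T, c.Q t = c'.Q t
  R : ∀ t ∈ Set.Icc 0 T, c.R t = c'.R t
  calS : ∀ t ∈ Set.Icc 0 T, c.Qbar t * (1 - c.S t) = c'.Qbar t * (1 - c'.S t)

end LQMFG

end

/-!
An equilibrium is a fixed point: a deterministic function `z` is frozen in the dynamics and in the
cost, the resulting linear-quadratic control problem is solved, and the mean of its optimal
trajectory has to be `z` again.

For frozen `z` the cost is a quadratic function of the control. The noise being additive, two
trajectories differ by the pathwise response `d' = A d + B w`, `d 0 = 0` to the difference `w` of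
their controls (`IsTrajectory.eq_add_response`), so the cost has an exact second order expansion
(`cost_add`), whose second order term is at least `δ ‖w‖²` (`costGrad_self_ge`). Hence a control is
optimal if and only if the derivative of the cost vanishes in all admissible directions
(`optimal_iff_isCritical`), there is at most one such control (`IsCritical.ae_eq`), and by
Lax–Milgram on the Hilbert space of admissible controls there is one (`exists_isCritical`). No
stochastic adjoint equation and no Riccati equation is needed.

The ordinary differential equations come from testing the first order condition with deterministic
directions only. The derivative then involves just the means of control and state, and duality with
the deterministic adjoint equation turns the condition into `R 𝔼[u] + B* p = 0`, where
`-p' = A* p + (Q + Q̄) 𝔼[y] - Q̄ S z` (`IsCritical.exists_mean_adjoint`). With `z = 𝔼[y]` this says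
that `(𝔼[y], p)` solves the forward-backward system (`IsEquilibrium.exists_solvesSystem`).

Conversely, given a solution `(ξ, η)`, let `u` be the optimal control for `z = ξ`, with trajectory
`y`. The differences of `𝔼[y]` and `ξ` and of the adjoint states solve the system of a
linear-quadratic problem with zero data; duality and `R ≥ δ` force them to vanish
(`SolvesSystem.mean_eq`). So `𝔼[y] = ξ` and `u` is an equilibrium.

Equilibria and solutions determine each other: the equilibrium determines `𝔼[u] = -R⁻¹ B* η`, hence
`ξ` and then `η` by uniqueness for linear equations (`SolvesSystem.eqOn`), while `ξ` determines the
equilibrium by uniqueness of the optimal control. As `Q̄` and `S` enter the system only through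
`Q̄ (I - S)`, the last part of the theorem follows from the first two.

The stochastic input is small: existence, uniqueness and mean zero of the Wiener integrals in the
state equation, obtained from the Itô isometry for step functions and their density in `L²`.
-/

namespace LQMFG

/-! ### Absolutely continuous functions with a prescribed derivative -/

section AbsCont

lemma absolutelyContinuousOnInterval_congr {X : Type*} [PseudoMetricSpace X] {x y : ℝ → X} {a b : ℝ}
    (hx : AbsolutelyContinuousOnInterval x a b) (h : Set.EqOn x y (Set.uIcc a b)) :
    AbsolutelyContinuousOnInterval y a b := by
  rw [absolutelyContinuousOnInterval_iff] at hx ⊢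
  intro ε hε
  obtain ⟨δ, hδ, H⟩ := hx ε hε
  refine ⟨δ, hδ, fun E hE hl => ?_⟩
  convert H E hE hl using 3 with i hi
  · exact (h (hE.1 i hi).1).symm
  · exact (h (hE.1 i hi).2).symm

variable {F : Type*} [NormedAddCommGroup F] [NormedSpace ℝ F] {n m : ℕ} {T : ℝ}

/-- `x` is absolutely continuous on `[0, T]` and `x' = g` almost everywhere there. -/
def HasACDeriv (T : ℝ) (x g : ℝ → F) : Prop :=
  AbsolutelyContinuousOnInterval x 0 T ∧
    ∀ᵐ t ∂(volume.restrict (Set.Icc 0 T)), HasDerivAt x (g t) t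

lemma absolutelyContinuousOnInterval_pi_iff {x : ℝ → Fin n → ℝ} {a b : ℝ} :
    AbsolutelyContinuousOnInterval x a b ↔
      ∀ i, AbsolutelyContinuousOnInterval (fun t => x t i) a b := by
  constructor
  · intro h i
    refine squeeze_zero (fun E => Finset.sum_nonneg fun _ _ => dist_nonneg) (fun E => ?_) h
    exact Finset.sum_le_sum fun k _ => dist_le_pi_dist _ _ i
  · intro h
    have h' : Tendsto (fun E : ℕ × (ℕ → ℝ × ℝ) => ∑ i, ∑ k ∈ Finset.range E.1,
        dist (x (E.2 k).1 i) (x (E.2 k).2 i))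
        (AbsolutelyContinuousOnInterval.totalLengthFilter ⊓
          𝓟 (AbsolutelyContinuousOnInterval.disjWithin a b)) (𝓝 0) := by
      simpa using tendsto_finsetSum Finset.univ (fun i _ => h i)
    refine squeeze_zero (fun E => Finset.sum_nonneg fun _ _ => dist_nonneg) (fun E => ?_) h'
    rw [Finset.sum_comm]
    refine Finset.sum_le_sum fun k _ => ?_
    refine (dist_pi_le_iff (Finset.sum_nonneg fun _ _ => dist_nonneg)).2 fun i => ?_
    exact Finset.single_le_sum (f := fun i => dist (x (E.2 k).1 i) (x (E.2 k).2 i))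
      (fun _ _ => dist_nonneg) (Finset.mem_univ i)

lemma ae_mem_Ioo : ∀ᵐ t ∂(volume.restrict (Set.Icc 0 T)), t ∈ Set.Ioo 0 T := by
  rw [← restrict_Ioo_eq_restrict_Icc]
  exact ae_restrict_mem measurableSet_Ioo

lemma hasACDeriv_pi_iff {x g : ℝ → Fin n → ℝ} :
    HasACDeriv T x g ↔ ∀ i, HasACDeriv T (fun t => x t i) (fun t => g t i) := by
  simp only [HasACDeriv, absolutelyContinuousOnInterval_pi_iff, hasDerivAt_pi, ae_all_iff,
    forall_and]

namespace HasACDeriv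

lemma congr {x y g : ℝ → F} (hT : 0 ≤ T) (hx : HasACDeriv T x g)
    (h : Set.EqOn x y (Set.Icc 0 T)) : HasACDeriv T y g := by
  refine ⟨absolutelyContinuousOnInterval_congr hx.1 (by rwa [Set.uIcc_of_le hT]), ?_⟩
  filter_upwards [hx.2, ae_mem_Ioo] with t ht htm
  refine ht.congr_of_eventuallyEq ?_
  filter_upwards [Ioo_mem_nhds htm.1 htm.2] with s hs
  exact (h (Set.Ioo_subset_Icc_self hs)).symm

lemma congr_deriv {x g g' : ℝ → F} (hx : HasACDeriv T x g)
    (h : g =ᵐ[volume.restrict (Set.Icc 0 T)] g') : HasACDeriv T x g' := by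
  refine ⟨hx.1, ?_⟩
  filter_upwards [hx.2, h] with t ht h'
  rwa [← h']

lemma const (a : F) : HasACDeriv T (fun _ => a) (fun _ => 0) := by
  refine ⟨?_, .of_forall fun t => hasDerivAt_const t a⟩
  exact (LipschitzWith.const a).lipschitzOnWith.absolutelyContinuousOnInterval

lemma add {x y g h : ℝ → F} (hx : HasACDeriv T x g) (hy : HasACDeriv T y h) :
    HasACDeriv T (fun t => x t + y t) (fun t => g t + h t) := by
  refine ⟨hx.1.add hy.1, ?_⟩
  filter_upwards [hx.2, hy.2] with t h1 h2 using h1.add h2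

lemma sub {x y g h : ℝ → F} (hx : HasACDeriv T x g) (hy : HasACDeriv T y h) :
    HasACDeriv T (fun t => x t - y t) (fun t => g t - h t) := by
  refine ⟨hx.1.sub hy.1, ?_⟩
  filter_upwards [hx.2, hy.2] with t h1 h2 using h1.sub h2

lemma mul {x y g h : ℝ → ℝ} (hx : HasACDeriv T x g) (hy : HasACDeriv T y h) :
    HasACDeriv T (fun t => x t * y t) (fun t => g t * y t + x t * h t) := by
  refine ⟨hx.1.mul hy.1, ?_⟩
  filter_upwards [hx.2, hy.2] with t h1 h2 using h1.mul h2

lemma sum {ι : Type*} (s : Finset ι) {x g : ι → ℝ → F} (hx : ∀ i ∈ s, HasACDeriv T (x i) (g i)) :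
    HasACDeriv T (fun t => ∑ i ∈ s, x i t) (fun t => ∑ i ∈ s, g i t) := by
  classical
  induction s using Finset.induction_on with
  | empty => simpa using const (0 : F)
  | insert a s ha ih =>
    simp only [Finset.sum_insert ha]
    exact (hx a (by simp)).add (ih fun i hi => hx i (by simp [hi]))

lemma dotProduct {x y g h : ℝ → Fin n → ℝ} (hx : HasACDeriv T x g) (hy : HasACDeriv T y h) :
    HasACDeriv T (fun t => x t ⬝ᵥ y t) (fun t => g t ⬝ᵥ y t + x t ⬝ᵥ h t) := by
  simp only [_root_.dotProduct, ← Finset.sum_add_distrib]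
  exact sum _ fun i _ => (hasACDeriv_pi_iff.1 hx i).mul (hasACDeriv_pi_iff.1 hy i)

lemma mulVec {Φ G : ℝ → Matrix (Fin m) (Fin n) ℝ} {x h : ℝ → Fin n → ℝ}
    (hΦ : ∀ i, HasACDeriv T (fun t => Φ t i) (fun t => G t i)) (hx : HasACDeriv T x h) :
    HasACDeriv T (fun t => Φ t *ᵥ x t) (fun t => G t *ᵥ x t + Φ t *ᵥ h t) :=
  hasACDeriv_pi_iff.2 fun i => (hΦ i).dotProduct hx

lemma continuousOn {x g : ℝ → F} (hT : 0 ≤ T) (hx : HasACDeriv T x g) :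
    ContinuousOn x (Set.Icc 0 T) := by
  simpa [Set.uIcc_of_le hT] using hx.1.continuousOn

lemma eq_of_deriv_zero {x : ℝ → F} (hT : 0 ≤ T) (hx : HasACDeriv T x (fun _ => 0)) {s t : ℝ}
    (hs : s ∈ Set.Icc 0 T) (ht : t ∈ Set.Icc 0 T) : x s = x t := by
  obtain ⟨C, hC⟩ := hx.1.const_of_ae_hasDerivAt_zero (by
    rw [Set.uIcc_of_le hT]; exact (ae_restrict_iff' measurableSet_Icc).1 hx.2)
  rw [Set.uIcc_of_le hT] at hC
  rw [hC s hs, hC t ht]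

lemma integrableOn_and_eq_real {x g : ℝ → ℝ} (hT : 0 ≤ T) (hx : HasACDeriv T x g) :
    IntegrableOn g (Set.Icc 0 T) ∧ ∀ t ∈ Set.Icc 0 T, x t = x 0 + ∫ s in (0 : ℝ)..t, g s := by
  have hd : deriv x =ᵐ[volume.restrict (Set.Icc 0 T)] g := by
    filter_upwards [hx.2] with t ht using ht.deriv
  constructor
  · have := (intervalIntegrable_iff_integrableOn_Icc_of_le hT).1 hx.1.intervalIntegrable_deriv
    exact this.congr hd
  · intro t ht
    have := (hx.1.mono (c := 0) (d := t) (by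
      rw [Set.uIcc_of_le hT, Set.uIcc_of_le ht.1]
      exact Set.Icc_subset_Icc_right ht.2)).integral_deriv_eq_sub
    rw [← intervalIntegral.integral_congr_ae (f := deriv x), this]
    · ring
    · rw [← ae_restrict_iff' measurableSet_uIoc, Set.uIoc_of_le ht.1]
      exact ae_restrict_of_ae_restrict_of_subset
        (Set.Ioc_subset_Icc_self.trans (Set.Icc_subset_Icc_right ht.2)) hd

lemma integrableOn {x g : ℝ → Fin n → ℝ} (hT : 0 ≤ T) (hx : HasACDeriv T x g) :
    IntegrableOn g (Set.Icc 0 T) :=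
  Integrable.of_eval fun i => ((hasACDeriv_pi_iff.1 hx i).integrableOn_and_eq_real hT).1

/-- Fundamental theorem of calculus. -/
lemma eq_add_integral {x g : ℝ → Fin n → ℝ} (hT : 0 ≤ T) (hx : HasACDeriv T x g) {t : ℝ}
    (ht : t ∈ Set.Icc 0 T) : x t = x 0 + ∫ s in (0 : ℝ)..t, g s := by
  ext i
  rw [((hasACDeriv_pi_iff.1 hx i).integrableOn_and_eq_real hT).2 t ht, Pi.add_apply,
    intervalIntegral.integral_of_le ht.1, intervalIntegral.integral_of_le ht.1, eval_integral]
  intro j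
  exact (((hx.integrableOn hT).mono_set
    (Set.Ioc_subset_Icc_self.trans (Set.Icc_subset_Icc_right ht.2))).eval j)

/-- A primitive of an integrable function is absolutely continuous (Lebesgue differentiation). -/
lemma integral {g : ℝ → Fin n → ℝ} (hT : 0 ≤ T) (hg : IntegrableOn g (Set.Icc 0 T))
    (a : Fin n → ℝ) : HasACDeriv T (fun t => a + ∫ s in (0 : ℝ)..t, g s) g := by
  have hi : ∀ i, HasACDeriv T (fun t => a i + ∫ s in (0 : ℝ)..t, g s i) (fun t => g t i) := by
    intro i
    have h1 : IntervalIntegrable (fun s => g s i) volume 0 T :=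
      (intervalIntegrable_iff_integrableOn_Icc_of_le hT).2 (Integrable.eval hg i)
    have h2 : HasACDeriv T (fun t => ∫ s in (0 : ℝ)..t, g s i) (fun t => g t i) := by
      refine ⟨h1.absolutelyContinuousOnInterval_intervalIntegral (by simp), ?_⟩
      have := h1.ae_hasDerivAt_integral
      rw [Set.uIcc_of_le hT] at this
      filter_upwards [(ae_restrict_iff' measurableSet_Icc).2 this] with t ht
      exact ht 0 ⟨le_rfl, hT⟩
    simpa using (const (T := T) (a i)).add h2
  refine (hasACDeriv_pi_iff (x := fun t i => a i + ∫ s in (0 : ℝ)..t, g s i).2 hi).congr hT ?_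
  intro t ht
  ext i
  simp only [Pi.add_apply]
  rw [intervalIntegral.integral_of_le ht.1, intervalIntegral.integral_of_le ht.1, eval_integral]
  intro j
  exact Integrable.eval (IntegrableOn.mono_set hg
    (Set.Ioc_subset_Icc_self.trans (Set.Icc_subset_Icc_right ht.2))) j

end HasACDeriv

end AbsCont

/-! ### Bounded measurable coefficients -/

section BoundedCoeff

variable {a b d n m : ℕ} {T : ℝ}

lemma abs_dotProduct_le (x y : Fin n → ℝ) : |x ⬝ᵥ y| ≤ n * (‖x‖ * ‖y‖) := by
  calc |x ⬝ᵥ y| ≤ ∑ i, |x i * y i| := Finset.abs_sum_le_sum_abs _ _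
    _ ≤ ∑ _i : Fin n, ‖x‖ * ‖y‖ := Finset.sum_le_sum fun i _ => by
        rw [abs_mul]
        exact mul_le_mul (norm_le_pi_norm x i) (norm_le_pi_norm y i) (abs_nonneg _) (norm_nonneg _)
    _ = n * (‖x‖ * ‖y‖) := by simp

lemma le_dotProduct_mulVec_of_coercive {M : Matrix (Fin a) (Fin a) ℝ} {δ : ℝ}
    (h : (M - δ • (1 : Matrix (Fin a) (Fin a) ℝ)).PosSemidef) (x : Fin a → ℝ) :
    δ * (x ⬝ᵥ x) ≤ x ⬝ᵥ (M *ᵥ x) := by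
  have := h.dotProduct_mulVec_nonneg x
  simpa [Matrix.sub_mulVec, Matrix.smul_mulVec, dotProduct_sub] using this

lemma isUnit_det_of_coercive {M : Matrix (Fin a) (Fin a) ℝ} {δ : ℝ} (hδ : 0 < δ)
    (h : (M - δ • (1 : Matrix (Fin a) (Fin a) ℝ)).PosSemidef) : IsUnit M.det := by
  have h1 : (M - δ • (1 : Matrix (Fin a) (Fin a) ℝ) + δ • 1).PosDef :=
    Matrix.PosDef.posSemidef_add h (Matrix.PosDef.one.smul hδ)
  rw [sub_add_cancel] at h1
  exact (Matrix.isUnit_iff_isUnit_det _).1 h1.isUnit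

lemma isSymm_of_coercive {M : Matrix (Fin a) (Fin a) ℝ} {δ : ℝ}
    (h : (M - δ • (1 : Matrix (Fin a) (Fin a) ℝ)).PosSemidef) : M.IsSymm := by
  have h1 := h.isHermitian
  rw [Matrix.IsHermitian, Matrix.conjTranspose_eq_transpose_of_trivial] at h1
  rw [Matrix.IsSymm]
  simpa using h1

namespace IsBoundedCoeff

lemma const (M : Matrix (Fin a) (Fin b) ℝ) : IsBoundedCoeff T (fun _ => M) := by
  refine ⟨fun i j => aemeasurable_const, ∑ i, ∑ j, |M i j|, fun t _ i j => ?_⟩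
  exact (Finset.single_le_sum (f := fun j => |M i j|) (fun _ _ => abs_nonneg _)
    (Finset.mem_univ j)).trans (Finset.single_le_sum (f := fun i => ∑ j, |M i j|)
      (fun _ _ => Finset.sum_nonneg fun _ _ => abs_nonneg _) (Finset.mem_univ i))

lemma add {M N : ℝ → Matrix (Fin a) (Fin b) ℝ} (hM : IsBoundedCoeff T M)
    (hN : IsBoundedCoeff T N) : IsBoundedCoeff T (fun t => M t + N t) := by
  obtain ⟨hM1, C, hC⟩ := hM
  obtain ⟨hN1, D, hD⟩ := hN
  exact ⟨fun i j => (hM1 i j).add (hN1 i j), C + D, fun t ht i j =>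
    (abs_add_le _ _).trans (add_le_add (hC t ht i j) (hD t ht i j))⟩

lemma neg {M : ℝ → Matrix (Fin a) (Fin b) ℝ} (hM : IsBoundedCoeff T M) :
    IsBoundedCoeff T (fun t => -M t) := by
  obtain ⟨hM1, C, hC⟩ := hM
  exact ⟨fun i j => (hM1 i j).neg, C, fun t ht i j => by simpa using hC t ht i j⟩

lemma transpose {M : ℝ → Matrix (Fin a) (Fin b) ℝ} (hM : IsBoundedCoeff T M) :
    IsBoundedCoeff T (fun t => (M t)ᵀ) := by
  obtain ⟨hM1, C, hC⟩ := hM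
  exact ⟨fun i j => hM1 j i, C, fun t ht i j => hC t ht j i⟩

lemma mul {M : ℝ → Matrix (Fin a) (Fin b) ℝ} {N : ℝ → Matrix (Fin b) (Fin d) ℝ}
    (hM : IsBoundedCoeff T M) (hN : IsBoundedCoeff T N) :
    IsBoundedCoeff T (fun t => M t * N t) := by
  obtain ⟨hM1, C, hC⟩ := hM
  obtain ⟨hN1, D, hD⟩ := hN
  refine ⟨fun i j => ?_, b * (C * D), fun t ht i j => ?_⟩
  · simp only [Matrix.mul_apply]
    exact Finset.aemeasurable_fun_sum _ fun k _ => (hM1 i k).mul (hN1 k j)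
  · simp only [Matrix.mul_apply]
    calc |∑ k, M t i k * N t k j| ≤ ∑ k, |M t i k * N t k j| := Finset.abs_sum_le_sum_abs _ _
      _ ≤ ∑ _k : Fin b, C * D := Finset.sum_le_sum fun k _ => by
          rw [abs_mul]
          exact mul_le_mul (hC t ht i k) (hD t ht k j) (abs_nonneg _)
            ((abs_nonneg _).trans (hC t ht i k))
      _ = b * (C * D) := by simp

lemma of_continuousOn {M : ℝ → Matrix (Fin a) (Fin b) ℝ}
    (h : ∀ i, ContinuousOn (fun t => M t i) (Set.Icc 0 T)) : IsBoundedCoeff T M := by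
  have h' : ∀ i j, ContinuousOn (fun t => M t i j) (Set.Icc 0 T) := fun i j =>
    continuousOn_pi.1 (h i) j
  choose C hC using fun i j => isCompact_Icc.exists_bound_of_continuousOn (h' i j)
  refine ⟨fun i j => (h' i j).aemeasurable measurableSet_Icc, ∑ i, ∑ j, |C i j|,
    fun t ht i j => ?_⟩
  refine ((hC i j t ht).trans (le_abs_self _)).trans ?_
  exact (Finset.single_le_sum (f := fun j => |C i j|) (fun _ _ => abs_nonneg _)
    (Finset.mem_univ j)).trans (Finset.single_le_sum (f := fun i => ∑ j, |C i j|)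
      (fun _ _ => Finset.sum_nonneg fun _ _ => abs_nonneg _) (Finset.mem_univ i))

lemma exists_norm_mulVec_le {M : ℝ → Matrix (Fin a) (Fin b) ℝ} (hM : IsBoundedCoeff T M) :
    ∃ C : ℝ, 0 ≤ C ∧ ∀ t ∈ Set.Icc 0 T, ∀ x, ‖M t *ᵥ x‖ ≤ C * ‖x‖ := by
  obtain ⟨-, C, hC⟩ := hM
  refine ⟨b * |C|, by positivity, fun t ht x => ?_⟩
  refine (pi_norm_le_iff_of_nonneg (by positivity)).2 fun i => ?_
  refine (abs_dotProduct_le _ _).trans ?_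
  rw [mul_assoc]
  gcongr
  exact (pi_norm_le_iff_of_nonneg (abs_nonneg C)).2 fun j => (hC t ht i j).trans (le_abs_self _)

/-- The inverse of a uniformly coercive coefficient is again a bounded measurable coefficient. -/
lemma inv {M : ℝ → Matrix (Fin a) (Fin a) ℝ} (hM : IsBoundedCoeff T M) {δ : ℝ} (hδ : 0 < δ)
    (h : ∀ t ∈ Set.Icc 0 T, (M t - δ • (1 : Matrix (Fin a) (Fin a) ℝ)).PosSemidef) :
    IsBoundedCoeff T (fun t => (M t)⁻¹) := by
  refine ⟨fun i j => ?_, 1 / δ, fun t ht i j => ?_⟩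
  · let N : ℝ → Fin a → Fin a → ℝ := fun t i j => M t i j
    have hN : AEMeasurable N (volume.restrict (Set.Icc 0 T)) :=
      aemeasurable_pi_lambda _ fun i => aemeasurable_pi_lambda _ fun j => hM.1 i j
    have hof : Continuous (fun A : Fin a → Fin a → ℝ => Matrix.of A) := continuous_id
    have hdet : Measurable (fun A : Fin a → Fin a → ℝ => (Matrix.of A).det) :=
      hof.matrix_det.measurable
    have hadj : Measurable (fun A : Fin a → Fin a → ℝ => (Matrix.of A).adjugate i j) :=
      (hof.matrix_adjugate.matrix_elem i j).measurable
    have : AEMeasurable (fun t => ((M t).det)⁻¹ * (M t).adjugate i j)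
        (volume.restrict (Set.Icc 0 T)) :=
      ((hdet.comp_aemeasurable hN).inv).mul (hadj.comp_aemeasurable hN)
    simpa [Matrix.inv_def] using this
  · -- test coercivity with the column `x = M⁻¹ eⱼ`: `δ |x|² ≤ x · M x = xⱼ`, so `|x| ≤ 1 / δ`
    have hu := isUnit_det_of_coercive hδ (h t ht)
    set x : Fin a → ℝ := fun k => (M t)⁻¹ k j with hx
    have hMx : M t *ᵥ x = Pi.single j 1 := by
      ext k
      have := congrFun (congrFun (Matrix.mul_nonsing_inv (M t) hu) k) j
      rw [Matrix.mul_apply, Matrix.one_apply] at this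
      simpa [Matrix.mulVec, _root_.dotProduct, hx, Pi.single_apply] using this
    have hc := le_dotProduct_mulVec_of_coercive (h t ht) x
    rw [hMx, dotProduct_single, mul_one] at hc
    have hsq : ∀ k, x k ^ 2 ≤ x ⬝ᵥ x := fun k => by
      rw [sq]
      exact Finset.single_le_sum (f := fun k => x k * x k) (fun _ _ => mul_self_nonneg _)
        (Finset.mem_univ k)
    have hxj : x j ≤ 1 / δ := by
      rw [le_div_iff₀ hδ]
      by_contra! hlt
      nlinarith [hsq j, mul_le_mul_of_nonneg_left (hsq j) hδ.le]
    have hxi : x i ^ 2 ≤ (1 / δ) ^ 2 := by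
      have := mul_le_mul_of_nonneg_left (hsq i) hδ.le
      have h3 : δ * x i ^ 2 ≤ 1 / δ := by linarith
      calc x i ^ 2 = δ * x i ^ 2 * (1 / δ) := by field_simp
        _ ≤ 1 / δ * (1 / δ) := by gcongr
        _ = (1 / δ) ^ 2 := (sq _).symm
    exact abs_le_of_sq_le_sq hxi (by positivity)

variable {α : Type*} [MeasurableSpace α] {ν : Measure α} {π : α → ℝ}

lemma aestronglyMeasurable_comp {M : ℝ → Matrix (Fin a) (Fin b) ℝ} (hM : IsBoundedCoeff T M)
    (hπ : Measure.QuasiMeasurePreserving π ν (volume.restrict (Set.Icc 0 T))) (i : Fin a)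
    (j : Fin b) : AEStronglyMeasurable (fun p => M (π p) i j) ν :=
  ((hM.1 i j).comp_quasiMeasurePreserving hπ).aestronglyMeasurable

lemma aestronglyMeasurable_mulVec {M : ℝ → Matrix (Fin a) (Fin b) ℝ} (hM : IsBoundedCoeff T M)
    (hπ : Measure.QuasiMeasurePreserving π ν (volume.restrict (Set.Icc 0 T)))
    {x : α → Fin b → ℝ} (hx : AEStronglyMeasurable x ν) :
    AEStronglyMeasurable (fun p => M (π p) *ᵥ x p) ν := by
  refine (aemeasurable_pi_lambda _ fun i => ?_).aestronglyMeasurable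
  simp only [Matrix.mulVec, dotProduct]
  refine Finset.aemeasurable_fun_sum _ fun j _ => ?_
  exact (hM.aestronglyMeasurable_comp hπ i j).aemeasurable.mul
    ((measurable_pi_apply j).comp_aemeasurable hx.aemeasurable)

lemma ae_mem (hπ : Measure.QuasiMeasurePreserving π ν (volume.restrict (Set.Icc 0 T))) :
    ∀ᵐ p ∂ν, π p ∈ Set.Icc 0 T :=
  hπ.ae (ae_restrict_mem measurableSet_Icc)

lemma memLp_mulVec {M : ℝ → Matrix (Fin a) (Fin b) ℝ} (hM : IsBoundedCoeff T M)
    (hπ : Measure.QuasiMeasurePreserving π ν (volume.restrict (Set.Icc 0 T))) {q : ℝ≥0∞}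
    {x : α → Fin b → ℝ} (hx : MemLp x q ν) : MemLp (fun p => M (π p) *ᵥ x p) q ν := by
  obtain ⟨C, hC, hM'⟩ := hM.exists_norm_mulVec_le
  refine hx.of_le_mul (c := C) (hM.aestronglyMeasurable_mulVec hπ hx.1) ?_
  filter_upwards [ae_mem hπ] with p hp using hM' _ hp _

end IsBoundedCoeff

lemma integrable_dotProduct {α : Type*} [MeasurableSpace α] {ν : Measure α}
    {x y : α → Fin n → ℝ} (hx : MemLp x 2 ν) (hy : MemLp y 2 ν) :
    Integrable (fun p => x p ⬝ᵥ y p) ν := by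
  simp only [dotProduct]
  exact integrable_finsetSum _ fun i _ => (hx.eval i).integrable_mul (hy.eval i)

lemma IsBoundedCoeff.integrableOn_mulVec {M : ℝ → Matrix (Fin a) (Fin b) ℝ}
    (hM : IsBoundedCoeff T M) {x : ℝ → Fin b → ℝ} (hx : IntegrableOn x (Set.Icc 0 T)) :
    IntegrableOn (fun t => M t *ᵥ x t) (Set.Icc 0 T) := by
  rw [IntegrableOn, ← memLp_one_iff_integrable] at hx ⊢
  exact hM.memLp_mulVec (.id _) hx

end BoundedCoeff

/-! ### Linear differential equations with bounded measurable coefficients -/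

section LinearODE

variable {n : ℕ} {T : ℝ}

/-- Carathéodory existence for a linear equation. The exponential weight turns the Picard map into a
contraction of `C([0, T])`. -/
lemma exists_hasACDeriv_mulVec (hT : 0 ≤ T) {M : ℝ → Matrix (Fin n) (Fin n) ℝ}
    (hM : IsBoundedCoeff T M) (b : Fin n → ℝ) :
    ∃ x : ℝ → Fin n → ℝ, x 0 = b ∧ HasACDeriv T x (fun t => M t *ᵥ x t) := by
  obtain ⟨C, hC, hMC⟩ := hM.exists_norm_mulVec_le
  set l : ℝ := C + 1 with hl
  have hl0 : 0 < l := by positivity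
  let w : C(Set.Icc 0 T, Fin n → ℝ) → ℝ → Fin n → ℝ := fun y s =>
    Real.exp (l * s) • Set.IccExtend hT y s
  have hw : ∀ y, Continuous (w y) := fun y => by
    have := y.continuous.Icc_extend' (h := hT)
    fun_prop
  have hint : ∀ y, IntegrableOn (fun s => M s *ᵥ w y s) (Set.Icc 0 T) := fun y =>
    hM.integrableOn_mulVec (hw y).continuousOn.integrableOn_Icc
  have hprim : ∀ y, HasACDeriv T (fun t => b + ∫ s in (0 : ℝ)..t, M s *ᵥ w y s)
      (fun t => M t *ᵥ w y t) := fun y => HasACDeriv.integral hT (hint y) b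
  let G : C(Set.Icc 0 T, Fin n → ℝ) → C(Set.Icc 0 T, Fin n → ℝ) := fun y =>
    ⟨fun t => Real.exp (-(l * t)) • (b + ∫ s in (0 : ℝ)..t, M s *ᵥ w y s), by
      have := continuousOn_iff_continuous_domRestrict.1 ((hprim y).continuousOn hT)
      exact (Continuous.rexp (by fun_prop)).smul this⟩
  obtain ⟨K, hK⟩ : ∃ K : ℝ≥0, (K : ℝ) = C / l := ⟨Real.toNNReal (C / l), by
    rw [Real.coe_toNNReal _ (by positivity)]⟩
  have hG : ContractingWith K G := by
    refine ⟨?_, ?_⟩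
    · rw [← NNReal.coe_lt_coe, hK, NNReal.coe_one, div_lt_one hl0]
      linarith
    refine LipschitzWith.of_dist_le_mul fun y y' => ?_
    rw [hK]
    refine (ContinuousMap.dist_le (by positivity)).2 fun t => ?_
    obtain ⟨t, ht⟩ := t
    have hsub : Set.Ioc 0 t ⊆ Set.Icc 0 T :=
      Set.Ioc_subset_Icc_self.trans (Set.Icc_subset_Icc_right ht.2)
    have hi : ∀ y, IntervalIntegrable (fun s => M s *ᵥ w y s) volume 0 t := fun y =>
      (intervalIntegrable_iff_integrableOn_Ioc_of_le ht.1).2 ((hint y).mono_set hsub)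
    have hder : ∀ s : ℝ, HasDerivAt (fun s => C / l * dist y y' * Real.exp (l * s))
        (C * dist y y' * Real.exp (l * s)) s := fun s => by
      have h1 : HasDerivAt (fun s : ℝ => l * s) l s := by
        simpa using (hasDerivAt_id s).const_mul l
      convert! h1.exp.const_mul (C / l * dist y y') using 1
      field_simp
    have hcont : Continuous fun s : ℝ => C * dist y y' * Real.exp (l * s) := by fun_prop
    have hbound : ‖∫ s in (0 : ℝ)..t, (M s *ᵥ w y s - M s *ᵥ w y' s)‖ ≤
        C / l * dist y y' * Real.exp (l * t) := by
      calc ‖∫ s in (0 : ℝ)..t, (M s *ᵥ w y s - M s *ᵥ w y' s)‖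
          ≤ ∫ s in (0 : ℝ)..t, C * dist y y' * Real.exp (l * s) := by
            refine intervalIntegral.norm_integral_le_of_norm_le ht.1 (.of_forall fun s hs => ?_)
              (hcont.intervalIntegrable _ _)
            rw [← Matrix.mulVec_sub]
            refine (hMC s (hsub hs) _).trans ?_
            rw [mul_assoc]
            gcongr
            rw [← smul_sub, norm_smul, Real.norm_of_nonneg (Real.exp_pos _).le, mul_comm]
            gcongr
            rw [← dist_eq_norm]
            exact ContinuousMap.dist_apply_le_dist _
        _ = C / l * dist y y' * Real.exp (l * t) - C / l * dist y y' * Real.exp (l * 0) :=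
            intervalIntegral.integral_eq_sub_of_hasDerivAt (fun s _ => hder s)
              (hcont.intervalIntegrable _ _)
        _ ≤ _ := by
            have : 0 ≤ C / l * dist y y' * Real.exp (l * 0) := by positivity
            linarith
    change dist (Real.exp (-(l * t)) • (b + ∫ s in (0 : ℝ)..t, M s *ᵥ w y s))
      (Real.exp (-(l * t)) • (b + ∫ s in (0 : ℝ)..t, M s *ᵥ w y' s)) ≤ C / l * dist y y'
    rw [dist_eq_norm, ← smul_sub, norm_smul, Real.norm_of_nonneg (Real.exp_pos _).le,
      add_sub_add_left_eq_sub, ← intervalIntegral.integral_sub (hi y) (hi y')]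
    calc _ ≤ Real.exp (-(l * t)) * (C / l * dist y y' * Real.exp (l * t)) := by gcongr
      _ = C / l * dist y y' := by rw [Real.exp_neg]; field_simp
  have hfix : G (hG.fixedPoint G) = hG.fixedPoint G := hG.fixedPoint_isFixedPt
  set y := hG.fixedPoint G
  have hx : Set.EqOn (fun t => b + ∫ s in (0 : ℝ)..t, M s *ᵥ w y s) (w y) (Set.Icc 0 T) := by
    intro t ht
    have h1 : Real.exp (-(l * t)) • (b + ∫ s in (0 : ℝ)..t, M s *ᵥ w y s) = y ⟨t, ht⟩ :=
      congrArg (fun f : C(Set.Icc 0 T, Fin n → ℝ) => f ⟨t, ht⟩) hfix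
    simp only [w, Set.IccExtend_of_mem hT _ ht] at h1 ⊢
    rw [← h1, smul_smul, ← Real.exp_add]
    simp
  refine ⟨w y, ?_, (hprim y).congr hT hx⟩
  rw [← hx ⟨le_rfl, hT⟩]
  simp

/-- `Φ` is a fundamental matrix of `x' = A x` on `[0, T]`, and `Ψ` is its inverse. The inverse is
carried along with its own differential equation, so that no matrix inverse has to be
differentiated; the derivatives are taken row by row. -/
structure IsFundamental (T : ℝ) (A Φ Ψ : ℝ → Matrix (Fin n) (Fin n) ℝ) : Prop where
  deriv : ∀ i, HasACDeriv T (fun t => Φ t i) (fun t => (A t * Φ t) i)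
  deriv_inv : ∀ i, HasACDeriv T (fun t => Ψ t i) (fun t => -(Ψ t * A t) i)
  inv_mul : ∀ t ∈ Set.Icc 0 T, Ψ t * Φ t = 1

lemma exists_isFundamental (hT : 0 ≤ T) {A : ℝ → Matrix (Fin n) (Fin n) ℝ}
    (hA : IsBoundedCoeff T A) : ∃ Φ Ψ, IsFundamental T A Φ Ψ := by
  choose x hx0 hx using fun j : Fin n => exists_hasACDeriv_mulVec hT hA (Pi.single j 1)
  choose y hy0 hy using fun j : Fin n =>
    exists_hasACDeriv_mulVec hT hA.transpose.neg (Pi.single j 1)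
  have hd : ∀ i, HasACDeriv T (fun t => (Matrix.of fun k j => x j t k) i)
      (fun t => (A t * Matrix.of fun k j => x j t k) i) := fun i =>
    hasACDeriv_pi_iff.2 fun j => hasACDeriv_pi_iff.1 (hx j) i
  have hd' : ∀ i, HasACDeriv T (fun t => (Matrix.of fun k => y k t) i)
      (fun t => -((Matrix.of fun k => y k t) * A t) i) := fun i => by
    refine (hy i).congr_deriv (.of_forall fun t => ?_)
    ext j
    simp [Matrix.neg_mulVec, Matrix.mulVec_transpose, Matrix.vecMul, Matrix.mul_apply,
      _root_.dotProduct]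
  refine ⟨fun t => Matrix.of fun i j => x j t i, fun t => Matrix.of fun i => y i t, hd, hd',
    fun t ht => ?_⟩
  ext i j
  -- the rows `y i` solve the adjoint equation, hence their products with solutions are constant
  have h1 : HasACDeriv T (fun t => y i t ⬝ᵥ x j t) (fun _ => 0) := by
    refine ((hy i).dotProduct (hx j)).congr_deriv (.of_forall fun t => ?_)
    beta_reduce
    rw [Matrix.neg_mulVec, neg_dotProduct, Matrix.mulVec_transpose, Matrix.dotProduct_mulVec]
    ring
  have h2 := h1.eq_of_deriv_zero hT ht ⟨le_rfl, hT⟩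
  rw [hx0, hy0] at h2
  simpa [Matrix.one_apply, Matrix.mul_apply, _root_.dotProduct, Pi.single_apply, eq_comm] using h2

/-- Variation of constants: the solution of `x' = A x + b`, `x 0 = 0`. -/
noncomputable def duhamel (Φ Ψ : ℝ → Matrix (Fin n) (Fin n) ℝ) (b : ℝ → Fin n → ℝ) (t : ℝ) :
    Fin n → ℝ :=
  Φ t *ᵥ ∫ s in (0 : ℝ)..t, Ψ s *ᵥ b s

@[simp] lemma duhamel_zero (Φ Ψ : ℝ → Matrix (Fin n) (Fin n) ℝ) (b : ℝ → Fin n → ℝ) :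
    duhamel Φ Ψ b 0 = 0 := by
  simp [duhamel]

namespace IsFundamental

variable {A Φ Ψ : ℝ → Matrix (Fin n) (Fin n) ℝ}

lemma mul_inv (h : IsFundamental T A Φ Ψ) {t : ℝ} (ht : t ∈ Set.Icc 0 T) : Φ t * Ψ t = 1 :=
  mul_eq_one_comm.1 (h.inv_mul t ht)

lemma bdd (h : IsFundamental T A Φ Ψ) (hT : 0 ≤ T) : IsBoundedCoeff T Φ :=
  .of_continuousOn fun i => (h.deriv i).continuousOn hT

lemma bdd_inv (h : IsFundamental T A Φ Ψ) (hT : 0 ≤ T) : IsBoundedCoeff T Ψ :=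
  .of_continuousOn fun i => (h.deriv_inv i).continuousOn hT

lemma hasACDeriv_duhamel (h : IsFundamental T A Φ Ψ) (hT : 0 ≤ T) {b : ℝ → Fin n → ℝ}
    (hb : IntegrableOn b (Set.Icc 0 T)) :
    HasACDeriv T (duhamel Φ Ψ b) (fun t => A t *ᵥ duhamel Φ Ψ b t + b t) := by
  have h1 := HasACDeriv.mulVec h.deriv
    (HasACDeriv.integral hT ((h.bdd_inv hT).integrableOn_mulVec hb) 0)
  simp only [zero_add] at h1
  refine h1.congr_deriv ?_
  filter_upwards [ae_restrict_mem measurableSet_Icc] with t ht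
  rw [Matrix.mulVec_mulVec, h.mul_inv ht, Matrix.one_mulVec, duhamel, Matrix.mulVec_mulVec]

lemma eq_zero (h : IsFundamental T A Φ Ψ) (hT : 0 ≤ T) {e : ℝ → Fin n → ℝ} (he0 : e 0 = 0)
    (he : HasACDeriv T e (fun t => A t *ᵥ e t)) : ∀ t ∈ Set.Icc 0 T, e t = 0 := by
  intro t ht
  have h1 : HasACDeriv T (fun t => Ψ t *ᵥ e t) (fun _ => 0) := by
    refine (HasACDeriv.mulVec (G := fun t => -(Ψ t * A t)) h.deriv_inv he).congr_deriv
      (.of_forall fun t => ?_)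
    simp [Matrix.neg_mulVec]
  have h2 := h1.eq_of_deriv_zero hT ht ⟨le_rfl, hT⟩
  simp only [he0, Matrix.mulVec_zero] at h2
  rw [← Matrix.one_mulVec (e t), ← h.mul_inv ht, ← Matrix.mulVec_mulVec, h2, Matrix.mulVec_zero]

lemma eq_duhamel (h : IsFundamental T A Φ Ψ) (hT : 0 ≤ T) {x b : ℝ → Fin n → ℝ} (hx0 : x 0 = 0)
    (hb : IntegrableOn b (Set.Icc 0 T)) (hx : HasACDeriv T x (fun t => A t *ᵥ x t + b t)) :
    ∀ t ∈ Set.Icc 0 T, x t = duhamel Φ Ψ b t := by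
  intro t ht
  refine sub_eq_zero.1 (h.eq_zero hT (e := fun t => x t - duhamel Φ Ψ b t) (by simp [hx0]) ?_ t ht)
  refine (hx.sub (h.hasACDeriv_duhamel hT hb)).congr_deriv (.of_forall fun t => ?_)
  simp [Matrix.mulVec_sub]

lemma deriv_transpose (h : IsFundamental T A Φ Ψ) (i : Fin n) :
    HasACDeriv T (fun t => (Φ t)ᵀ i) (fun t => ((Φ t)ᵀ * (A t)ᵀ) i) := by
  simp only [← Matrix.transpose_mul]
  exact hasACDeriv_pi_iff.2 fun j => hasACDeriv_pi_iff.1 (h.deriv j) i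

lemma deriv_inv_transpose (h : IsFundamental T A Φ Ψ) (i : Fin n) :
    HasACDeriv T (fun t => (Ψ t)ᵀ i) (fun t => (-((A t)ᵀ * (Ψ t)ᵀ)) i) := by
  simp only [← Matrix.transpose_mul]
  exact hasACDeriv_pi_iff.2 fun j => hasACDeriv_pi_iff.1 (h.deriv_inv j) i

lemma eq_zero_of_adjoint (h : IsFundamental T A Φ Ψ) (hT : 0 ≤ T) {e : ℝ → Fin n → ℝ}
    (heT : e T = 0) (he : HasACDeriv T e (fun t => -((A t)ᵀ *ᵥ e t))) :
    ∀ t ∈ Set.Icc 0 T, e t = 0 := by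
  intro t ht
  have h1 : HasACDeriv T (fun t => (Φ t)ᵀ *ᵥ e t) (fun _ => 0) := by
    refine (HasACDeriv.mulVec h.deriv_transpose he).congr_deriv (.of_forall fun t => ?_)
    simp [Matrix.mulVec_neg]
  have h2 := h1.eq_of_deriv_zero hT ht ⟨hT, le_rfl⟩
  simp only [heT, Matrix.mulVec_zero] at h2
  rw [← Matrix.one_mulVec (e t), ← Matrix.transpose_one, ← h.mul_inv ht, Matrix.transpose_mul,
    ← Matrix.mulVec_mulVec, h2, Matrix.mulVec_zero]

/-- The adjoint equation `-p' = Aᵀ p + f` with terminal value `g` has a solution. -/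
lemma exists_adjoint (h : IsFundamental T A Φ Ψ) (hT : 0 ≤ T) {f : ℝ → Fin n → ℝ}
    (hf : IntegrableOn f (Set.Icc 0 T)) (g : Fin n → ℝ) :
    ∃ p : ℝ → Fin n → ℝ, p T = g ∧ HasACDeriv T p (fun t => -((A t)ᵀ *ᵥ p t + f t)) := by
  have hi := (((h.bdd hT).transpose).integrableOn_mulVec hf).neg
  have hd := HasACDeriv.integral hT hi
    ((Φ T)ᵀ *ᵥ g + ∫ s in (0 : ℝ)..T, (Φ s)ᵀ *ᵥ f s)
  refine ⟨_, ?_, (HasACDeriv.mulVec h.deriv_inv_transpose hd).congr_deriv ?_⟩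
  · simp only [Pi.neg_apply, intervalIntegral.integral_neg, add_neg_cancel_right]
    rw [Matrix.mulVec_mulVec, ← Matrix.transpose_mul, h.mul_inv ⟨hT, le_rfl⟩,
      Matrix.transpose_one, Matrix.one_mulVec]
  · filter_upwards [ae_restrict_mem measurableSet_Icc] with t ht
    simp only [Pi.neg_apply, Matrix.mulVec_neg, Matrix.mulVec_mulVec, Matrix.neg_mulVec]
    rw [← Matrix.transpose_mul (Φ t) (Ψ t), h.mul_inv ht, Matrix.transpose_one, Matrix.one_mulVec,
      neg_add]

end IsFundamental

/-- Duality between the state equation `x' = A x + b`, `x 0 = 0` and the adjoint equation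
`-p' = Aᵀ p + f`, by integration of `(p · x)'`. -/
lemma dotProduct_terminal_eq (hT : 0 ≤ T) {A : ℝ → Matrix (Fin n) (Fin n) ℝ}
    {x b p f : ℝ → Fin n → ℝ} (hx0 : x 0 = 0)
    (hx : HasACDeriv T x (fun t => A t *ᵥ x t + b t))
    (hp : HasACDeriv T p (fun t => -((A t)ᵀ *ᵥ p t + f t))) :
    IntegrableOn (fun t => p t ⬝ᵥ b t - f t ⬝ᵥ x t) (Set.Icc 0 T) ∧
    p T ⬝ᵥ x T = ∫ t in Set.Icc 0 T, (p t ⬝ᵥ b t - f t ⬝ᵥ x t) := by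
  have h1 : HasACDeriv T (fun t => p t ⬝ᵥ x t) (fun t => p t ⬝ᵥ b t - f t ⬝ᵥ x t) := by
    refine (hp.dotProduct hx).congr_deriv (.of_forall fun t => ?_)
    beta_reduce
    rw [neg_dotProduct, add_dotProduct, dotProduct_add, Matrix.mulVec_transpose,
      Matrix.dotProduct_mulVec]
    ring
  have h2 := h1.integrableOn_and_eq_real hT
  refine ⟨h2.1, ?_⟩
  rw [h2.2 T ⟨hT, le_rfl⟩, hx0, dotProduct_zero, zero_add, intervalIntegral.integral_of_le hT,
    integral_Icc_eq_integral_Ioc]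

end LinearODE

/-! ### Square integrable processes and their primitives -/

section Processes

/-- Cauchy–Schwarz inequality against the constant `1`. -/
lemma sq_integral_le {α : Type*} [MeasurableSpace α] {ν : Measure α} [IsFiniteMeasure ν]
    {f : α → ℝ} (hf : Integrable f ν) (hf2 : Integrable (fun s => f s ^ 2) ν) :
    (∫ s, f s ∂ν) ^ 2 ≤ ν.real Set.univ * ∫ s, f s ^ 2 ∂ν := by
  set K := ν.real Set.univ with hK
  rcases (measureReal_nonneg (μ := ν) (s := Set.univ)).eq_or_lt with h0 | hK0
  · have : ν = 0 := by simpa [measureReal_def, ENNReal.toReal_eq_zero_iff] using h0.symm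
    simp [this]
  set a := ∫ s, f s ∂ν with ha
  have h5 : 0 ≤ ∫ s, (f s - a / K) ^ 2 ∂ν := integral_nonneg fun s => sq_nonneg _
  have h6 : ∫ s, (f s - a / K) ^ 2 ∂ν =
      (∫ s, f s ^ 2 ∂ν) - 2 * (a / K) * a + (a / K) ^ 2 * K := by
    have : ∀ s, (f s - a / K) ^ 2 = (f s ^ 2 - 2 * (a / K) * f s) + (a / K) ^ 2 :=
      fun s => by ring
    simp_rw [this]
    rw [integral_add (f := fun s => f s ^ 2 - 2 * (a / K) * f s)
      (hf2.sub (hf.const_mul _)) (integrable_const _),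
      integral_sub hf2 (hf.const_mul _), integral_const_mul, integral_const, smul_eq_mul,
      mul_comm (ν.real Set.univ)]
  rw [h6] at h5
  change 0 < K at hK0
  have h7 : 2 * (a / K) * a - (a / K) ^ 2 * K = a ^ 2 / K := by field_simp; ring
  have h8 : a ^ 2 / K ≤ ∫ s, f s ^ 2 ∂ν := by linarith
  rwa [div_le_iff₀' hK0] at h8

lemma quasiMeasurePreserving_time {Ω : Type*} [MeasurableSpace Ω] {P : Measure Ω}
    [SFinite P] {T : ℝ} :
    Measure.QuasiMeasurePreserving Prod.fst (timeMeasure P T) (volume.restrict (Set.Icc 0 T)) :=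
  Measure.quasiMeasurePreserving_fst

lemma integral_mulVec {Ω : Type*} [MeasurableSpace Ω] {P : Measure Ω} {a b : ℕ}
    (M : Matrix (Fin a) (Fin b) ℝ) {x : Ω → Fin b → ℝ}
    (hx : Integrable x P) : ∫ ω, M *ᵥ x ω ∂P = M *ᵥ ∫ ω, x ω ∂P :=
  (Matrix.mulVecLin M).toContinuousLinearMap.integral_comp_comm hx

variable {Ω : Type*} [MeasurableSpace Ω] {P : Measure Ω} [IsProbabilityMeasure P] {n m : ℕ} {T : ℝ}

instance : IsFiniteMeasure (timeMeasure P T) := by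
  unfold timeMeasure; infer_instance

lemma ae_ae_of_ae_timeMeasure {q : ℝ → Ω → Prop} (h : ∀ᵐ p ∂(timeMeasure P T), q p.1 p.2) :
    ∀ᵐ ω ∂P, ∀ᵐ t ∂(volume.restrict (Set.Icc 0 T)), q t ω := by
  have h1 : ∀ᵐ p ∂(P.prod (volume.restrict (Set.Icc 0 T))), q p.2 p.1 :=
    Measure.measurePreserving_swap.quasiMeasurePreserving.ae h
  exact Measure.ae_ae_of_ae_prod h1

lemma ae_timeMeasure_of_ae {q : Ω → Prop} (h : ∀ᵐ ω ∂P, q ω) :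
    ∀ᵐ p ∂(timeMeasure P T), p.1 ∈ Set.Icc 0 T ∧ q p.2 :=
  (IsBoundedCoeff.ae_mem quasiMeasurePreserving_time).and
    (Measure.quasiMeasurePreserving_snd.ae h)

/-- Two measurable processes which are modifications of each other agree `dt ⊗ P`-almost
everywhere. -/
lemma ae_timeMeasure_eq {E : Type*} [NormedAddCommGroup E] {f g : ℝ → Ω → E}
    (hf : AEStronglyMeasurable (Function.uncurry f) (timeMeasure P T))
    (hg : AEStronglyMeasurable (Function.uncurry g) (timeMeasure P T))
    (h : ∀ t ∈ Set.Icc 0 T, f t =ᵐ[P] g t) :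
    Function.uncurry f =ᵐ[timeMeasure P T] Function.uncurry g := by
  have hm : MeasurableSet {p | hf.mk _ p = hg.mk _ p} :=
    hf.stronglyMeasurable_mk.measurableSet_eq_fun hg.stronglyMeasurable_mk
  have h1 : ∀ᵐ p ∂(timeMeasure P T), hf.mk _ p = hg.mk _ p := by
    refine (Measure.ae_prod_iff_ae_ae hm).2 ?_
    filter_upwards [Measure.ae_ae_of_ae_prod hf.ae_eq_mk, Measure.ae_ae_of_ae_prod hg.ae_eq_mk,
      ae_restrict_mem measurableSet_Icc] with t h1 h2 ht
    filter_upwards [h1, h2, h t ht] with ω h3 h4 h5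
    rw [← h3, ← h4]
    exact h5
  filter_upwards [h1, hf.ae_eq_mk, hg.ae_eq_mk] with p h1 h2 h3
  rw [h2, h3, h1]

/-- A process with square integrable paths in the mean has, almost surely, integrable paths, whose
`L¹`-norm is controlled by the `L²`-norm. -/
lemma ae_integrableOn_path {h : ℝ → Ω → Fin n → ℝ} (hT : 0 ≤ T)
    (hh : MemLp (Function.uncurry h) 2 (timeMeasure P T)) :
    ∀ᵐ ω ∂P, IntegrableOn (fun s => h s ω) (Set.Icc 0 T) ∧
      (∫ s in Set.Icc 0 T, ‖h s ω‖) ^ 2 ≤ T * ∫ s in Set.Icc 0 T, ‖h s ω‖ ^ 2 := by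
  have h1 : Integrable (Function.uncurry h) (timeMeasure P T) := hh.integrable one_le_two
  have h2 : Integrable (fun p => ‖Function.uncurry h p‖ ^ 2) (timeMeasure P T) :=
    hh.integrable_norm_pow two_ne_zero
  filter_upwards [Integrable.prod_left_ae h1, Integrable.prod_left_ae h2] with ω h3 h4
  refine ⟨h3, ?_⟩
  have := sq_integral_le (ν := volume.restrict (Set.Icc 0 T)) h3.norm h4
  simpa [hT] using this

/-- Joint measurability of a primitive: with the indicator of `(0, t]` as a factor it
is an integral over the line with parameter `(t, ω)`. -/
lemma aestronglyMeasurable_primitive {h : ℝ → Ω → Fin n → ℝ}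
    (hh : AEStronglyMeasurable (Function.uncurry h) (timeMeasure P T)) :
    AEStronglyMeasurable (fun p : ℝ × Ω => ∫ s in (0 : ℝ)..p.1, h s p.2) (timeMeasure P T) ∧
    ∀ t ∈ Set.Icc 0 T, AEStronglyMeasurable (fun ω => ∫ s in (0 : ℝ)..t, h s ω) P := by
  set h' := hh.mk _
  have hm : StronglyMeasurable h' := hh.stronglyMeasurable_mk
  let F : ℝ × Ω → Fin n → ℝ := fun p =>
    ∫ s, {q : (ℝ × Ω) × ℝ | 0 < q.2 ∧ q.2 ≤ q.1.1}.indicator (fun q => h' (q.2, q.1.2)) (p, s)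
  have hF : StronglyMeasurable F := by
    refine StronglyMeasurable.integral_prod_right ?_
    refine (hm.comp_measurable (by fun_prop)).indicator ?_
    exact (measurableSet_lt measurable_const measurable_snd).inter
      (measurableSet_le measurable_snd (measurable_fst.comp measurable_fst))
  have heq : ∀ᵐ ω ∂P, ∀ t ∈ Set.Icc 0 T, F (t, ω) = ∫ s in (0 : ℝ)..t, h s ω := by
    filter_upwards [ae_ae_of_ae_timeMeasure (q := fun s ω => h s ω = h' (s, ω)) hh.ae_eq_mk]
      with ω hω t ht
    rw [intervalIntegral.integral_of_le ht.1, ← integral_indicator measurableSet_Ioc]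
    refine integral_congr_ae ?_
    filter_upwards [(ae_restrict_iff' measurableSet_Icc).1 hω] with s hs
    by_cases hst : s ∈ Set.Ioc 0 t
    · rw [Set.indicator_of_mem hst, Set.indicator_of_mem (by exact hst),
        hs ⟨hst.1.le, hst.2.trans ht.2⟩]
    · rw [Set.indicator_of_notMem hst, Set.indicator_of_notMem (by exact hst)]
  refine ⟨⟨F, hF, ?_⟩, fun t ht => ⟨fun ω => F (t, ω), hF.comp_measurable (by fun_prop), ?_⟩⟩
  · filter_upwards [ae_timeMeasure_of_ae heq] with p hp using (hp.2 p.1 hp.1).symm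
  · filter_upwards [heq] with ω hω using (hω t ht).symm

/-- A measurable process whose paths are bounded by a square integrable random variable is square
integrable. -/
lemma memLp_of_sq_le {x : ℝ → Ω → Fin n → ℝ} {G : Ω → ℝ} (hT : 0 ≤ T) (hG : Integrable G P)
    (hx : AEStronglyMeasurable (Function.uncurry x) (timeMeasure P T))
    (hxt : ∀ t ∈ Set.Icc 0 T, AEStronglyMeasurable (x t) P)
    (h : ∀ᵐ ω ∂P, ∀ t ∈ Set.Icc 0 T, ‖x t ω‖ ^ 2 ≤ G ω) :
    (MemLp (Function.uncurry x) 2 (timeMeasure P T) ∧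
      ∫ p, ‖Function.uncurry x p‖ ^ 2 ∂(timeMeasure P T) ≤ T * ∫ ω, G ω ∂P) ∧
    ∀ t ∈ Set.Icc 0 T, MemLp (x t) 2 P ∧ ∫ ω, ‖x t ω‖ ^ 2 ∂P ≤ ∫ ω, G ω ∂P := by
  have hG' : Integrable (fun p : ℝ × Ω => G p.2) (timeMeasure P T) := hG.comp_snd _
  have hGi : ∫ p, G p.2 ∂(timeMeasure P T) = T * ∫ ω, G ω ∂P := by
    rw [timeMeasure, integral_fun_snd]
    simp [hT]
  have h1 : ∀ᵐ p ∂(timeMeasure P T), ‖Function.uncurry x p‖ ^ 2 ≤ G p.2 := by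
    filter_upwards [ae_timeMeasure_of_ae h] with p hp using hp.2 p.1 hp.1
  have h2 : Integrable (fun p => ‖Function.uncurry x p‖ ^ 2) (timeMeasure P T) := by
    refine hG'.mono' (hx.norm.pow 2) ?_
    filter_upwards [h1] with p hp
    rwa [Real.norm_of_nonneg (by positivity)]
  refine ⟨⟨(memLp_two_iff_integrable_sq_norm hx).2 h2, ?_⟩, fun t ht => ?_⟩
  · rw [← hGi]
    exact integral_mono_ae h2 hG' h1
  have h3 : Integrable (fun ω => ‖x t ω‖ ^ 2) P := by
    refine hG.mono' ((hxt t ht).norm.pow 2) ?_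
    filter_upwards [h] with ω hω
    rw [Real.norm_of_nonneg (by positivity)]
    exact hω t ht
  refine ⟨(memLp_two_iff_integrable_sq_norm (hxt t ht)).2 h3, integral_mono_ae h3 hG ?_⟩
  filter_upwards [h] with ω hω using hω t ht

lemma norm_intervalIntegral_le {h : ℝ → Fin n → ℝ} (hh : IntegrableOn h (Set.Icc 0 T)) {t : ℝ}
    (ht : t ∈ Set.Icc 0 T) : ‖∫ s in (0 : ℝ)..t, h s‖ ≤ ∫ s in Set.Icc 0 T, ‖h s‖ := by
  rw [intervalIntegral.integral_of_le ht.1]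
  refine (norm_integral_le_integral_norm _).trans ?_
  exact setIntegral_mono_set hh.norm (.of_forall fun _ => norm_nonneg _)
    (Set.Ioc_subset_Icc_self.trans (Set.Icc_subset_Icc_right ht.2)).eventuallyLE

lemma integrable_path_sq {h : ℝ → Ω → Fin n → ℝ}
    (hh : MemLp (Function.uncurry h) 2 (timeMeasure P T)) :
    Integrable (fun ω => ∫ s in Set.Icc 0 T, ‖h s ω‖ ^ 2) P ∧
    ∫ ω, (∫ s in Set.Icc 0 T, ‖h s ω‖ ^ 2) ∂P =
      ∫ p, ‖Function.uncurry h p‖ ^ 2 ∂(timeMeasure P T) := by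
  have h2 : Integrable (fun p => ‖Function.uncurry h p‖ ^ 2) (timeMeasure P T) :=
    hh.integrable_norm_pow two_ne_zero
  exact ⟨h2.integral_prod_right, (integral_prod_symm _ h2).symm⟩

/-- `L²` bounds for `L (∫₀ᵗ h)`, with `L` a bounded coefficient. -/
lemma memLp_mulVec_primitive (hT : 0 ≤ T) {L : ℝ → Matrix (Fin n) (Fin n) ℝ}
    (hL : IsBoundedCoeff T L) : ∃ C : ℝ, 0 ≤ C ∧ ∀ h : ℝ → Ω → Fin n → ℝ,
      MemLp (Function.uncurry h) 2 (timeMeasure P T) →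
      (MemLp (fun p : ℝ × Ω => L p.1 *ᵥ ∫ s in (0 : ℝ)..p.1, h s p.2) 2 (timeMeasure P T) ∧
        ∫ p, ‖L p.1 *ᵥ ∫ s in (0 : ℝ)..p.1, h s p.2‖ ^ 2 ∂(timeMeasure P T) ≤
          C * ∫ p, ‖Function.uncurry h p‖ ^ 2 ∂(timeMeasure P T)) ∧
      ∀ t ∈ Set.Icc 0 T, MemLp (fun ω => L t *ᵥ ∫ s in (0 : ℝ)..t, h s ω) 2 P ∧
        ∫ ω, ‖L t *ᵥ ∫ s in (0 : ℝ)..t, h s ω‖ ^ 2 ∂P ≤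
          C * ∫ p, ‖Function.uncurry h p‖ ^ 2 ∂(timeMeasure P T) := by
  obtain ⟨K, hK, hLK⟩ := hL.exists_norm_mulVec_le
  refine ⟨(T + 1) * (K ^ 2 * T), by positivity, fun h hh => ?_⟩
  obtain ⟨hG, hGi⟩ := integrable_path_sq hh
  obtain ⟨hm, hmt⟩ := aestronglyMeasurable_primitive hh.1
  have key := memLp_of_sq_le (x := fun t ω => L t *ᵥ ∫ s in (0 : ℝ)..t, h s ω) hT
    (hG.const_mul (K ^ 2 * T)) (hL.aestronglyMeasurable_mulVec quasiMeasurePreserving_time hm)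
    (fun t ht => (Continuous.matrix_mulVec continuous_const continuous_id).comp_aestronglyMeasurable
      (hmt t ht)) (by
      filter_upwards [ae_integrableOn_path hT hh] with ω hω t ht
      calc ‖L t *ᵥ ∫ s in (0 : ℝ)..t, h s ω‖ ^ 2
          ≤ (K * ∫ s in Set.Icc 0 T, ‖h s ω‖) ^ 2 := by
            gcongr
            exact (hLK t ht _).trans (by gcongr; exact norm_intervalIntegral_le hω.1 ht)
        _ = K ^ 2 * (∫ s in Set.Icc 0 T, ‖h s ω‖) ^ 2 := by ring
        _ ≤ K ^ 2 * (T * ∫ s in Set.Icc 0 T, ‖h s ω‖ ^ 2) := by gcongr; exact hω.2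
        _ = _ := by ring)
  rw [integral_const_mul, hGi] at key
  have h0 : 0 ≤ ∫ p, ‖Function.uncurry h p‖ ^ 2 ∂(timeMeasure P T) :=
    integral_nonneg fun _ => by positivity
  have h0' : 0 ≤ K ^ 2 * T * ∫ p, ‖Function.uncurry h p‖ ^ 2 ∂(timeMeasure P T) := by positivity
  refine ⟨⟨key.1.1, key.1.2.trans ?_⟩, fun t ht => ⟨(key.2 t ht).1, (key.2 t ht).2.trans ?_⟩⟩
  · nlinarith
  · nlinarith

lemma IsBoundedCoeff.memLp_process {a b : ℕ} {M : ℝ → Matrix (Fin a) (Fin b) ℝ}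
    (hM : IsBoundedCoeff T M) {x : ℝ → Ω → Fin b → ℝ}
    (hx : MemLp (Function.uncurry x) 2 (timeMeasure P T)) :
    MemLp (Function.uncurry fun t ω => M t *ᵥ x t ω) 2 (timeMeasure P T) :=
  hM.memLp_mulVec quasiMeasurePreserving_time hx

lemma IsBoundedCoeff.exists_integral_sq_mulVec_le {a b : ℕ} {M : ℝ → Matrix (Fin a) (Fin b) ℝ}
    (hM : IsBoundedCoeff T M) : ∃ C : ℝ, 0 ≤ C ∧ ∀ x : ℝ → Ω → Fin b → ℝ,
      MemLp (Function.uncurry x) 2 (timeMeasure P T) →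
      ∫ p, ‖M p.1 *ᵥ Function.uncurry x p‖ ^ 2 ∂(timeMeasure P T) ≤
        C * ∫ p, ‖Function.uncurry x p‖ ^ 2 ∂(timeMeasure P T) := by
  obtain ⟨K, hK, hMK⟩ := hM.exists_norm_mulVec_le
  refine ⟨K ^ 2, by positivity, fun x hx => ?_⟩
  rw [← integral_const_mul]
  refine integral_mono_ae ((hM.memLp_process hx).integrable_norm_pow two_ne_zero)
    ((hx.integrable_norm_pow two_ne_zero).const_mul _) ?_
  filter_upwards [IsBoundedCoeff.ae_mem quasiMeasurePreserving_time] with p hp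
  rw [← mul_pow]
  exact pow_le_pow_left₀ (norm_nonneg _) (hMK _ hp _) 2

lemma memLp_const_process {x : ℝ → Fin n → ℝ}
    (hx : MemLp x 2 (volume.restrict (Set.Icc 0 T))) :
    MemLp (Function.uncurry fun t (_ : Ω) => x t) 2 (timeMeasure P T) :=
  hx.comp_fst P

/-- The mean of a square integrable process is square integrable in time. -/
lemma memLp_mean {x : ℝ → Ω → Fin n → ℝ}
    (hx : MemLp (Function.uncurry x) 2 (timeMeasure P T)) :
    MemLp (fun t => ∫ ω, x t ω ∂P) 2 (volume.restrict (Set.Icc 0 T)) := by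
  have h1 : Integrable (Function.uncurry x) (timeMeasure P T) := hx.integrable one_le_two
  have h2 : Integrable (fun p => ‖Function.uncurry x p‖ ^ 2) (timeMeasure P T) :=
    hx.integrable_norm_pow two_ne_zero
  have h3 : AEStronglyMeasurable (fun t => ∫ ω, x t ω ∂P) (volume.restrict (Set.Icc 0 T)) :=
    h1.integral_prod_left.1
  refine (memLp_two_iff_integrable_sq_norm h3).2 (h2.integral_prod_left.mono' (h3.norm.pow 2) ?_)
  filter_upwards [h1.prod_right_ae, h2.prod_right_ae] with t h4 h5
  rw [Real.norm_of_nonneg (by positivity)]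
  refine (pow_le_pow_left₀ (norm_nonneg _) (norm_integral_le_integral_norm _) 2).trans ?_
  simpa using sq_integral_le h4.norm h5

end Processes

/-! ### The Wiener integral of a deterministic function -/

section Wiener

variable {Ω : Type*} [MeasurableSpace Ω] {P : Measure Ω}
  {β : ℝ≥0 → Ω → ℝ} {T : ℝ}

lemma memLp_increment (hβ : IsPreBrownianReal β P) (a b : ℝ≥0) :
    MemLp (fun ω => β b ω - β a ω) 2 P :=
  ((hβ.isGaussianProcess.hasGaussianLaw_eval b).memLp_two).sub
    (hβ.isGaussianProcess.hasGaussianLaw_eval a).memLp_two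

/-- Increments of a Brownian motion have the same Gram matrix as the indicators of the
corresponding intervals: the Itô isometry on intervals. -/
lemma integral_increment_mul_increment [IsProbabilityMeasure P]
    (hβ : IsPreBrownianReal β P) {a b a' b' : ℝ≥0}
    (hab : a ≤ b) (hab' : a' ≤ b') :
    ∫ ω, (β b ω - β a ω) * (β b' ω - β a' ω) ∂P =
      volume.real (Set.Ioc (a : ℝ) b ∩ Set.Ioc (a' : ℝ) b') := by
  have hL : ∀ t, MemLp (β t) 2 P := fun t =>
    (hβ.isGaussianProcess.hasGaussianLaw_eval t).memLp_two
  have hcov : ∀ s t, ∫ ω, β s ω * β t ω ∂P = min (s : ℝ) t := fun s t => by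
    have h1 := hβ.covariance_eval s t
    rw [covariance_eq_sub (hL s) (hL t), hβ.integral_eval s, hβ.integral_eval t] at h1
    simpa using h1
  have hi : ∀ s t, Integrable (fun ω => β s ω * β t ω) P := fun s t =>
    (hL s).integrable_mul (hL t)
  have hexp : ∀ ω, (β b ω - β a ω) * (β b' ω - β a' ω) =
      (β b ω * β b' ω - β b ω * β a' ω) - (β a ω * β b' ω - β a ω * β a' ω) := fun ω => by ring
  simp_rw [hexp]
  rw [integral_sub (f := fun ω => β b ω * β b' ω - β b ω * β a' ω)
    (g := fun ω => β a ω * β b' ω - β a ω * β a' ω) ((hi _ _).sub (hi _ _))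
    ((hi _ _).sub (hi _ _)), integral_sub (hi _ _) (hi _ _), integral_sub (hi _ _) (hi _ _),
    hcov, hcov, hcov, hcov, Set.Ioc_inter_Ioc, Real.volume_real_Ioc]
  have h1 : (a : ℝ) ≤ b := by exact_mod_cast hab
  have h2 : (a' : ℝ) ≤ b' := by exact_mod_cast hab'
  generalize (a : ℝ) = a at *
  generalize (b : ℝ) = b at *
  generalize (a' : ℝ) = a' at *
  generalize (b' : ℝ) = b' at *
  simp only [min_def, max_def]
  split_ifs <;> linarith

/-- The indicator of `(a, b]` in `L²(ℝ)`. -/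
noncomputable def indLp (a b : ℝ≥0) : Lp ℝ 2 (volume : Measure ℝ) :=
  indicatorConstLp 2 (measurableSet_Ioc (a := (a : ℝ)) (b := (b : ℝ)))
    measure_Ioc_lt_top.ne 1

/-- The class of a step function in `L²(ℝ)`. -/
noncomputable def StepFun.evalLp (φ : StepFun) : Lp ℝ 2 (volume : Measure ℝ) :=
  ∑ k, φ.coef k • indLp (φ.left k) (φ.right k)

/-- The class of the elementary integral of a step function in `L²(P)`. -/
noncomputable def StepFun.integralLp (hβ : IsPreBrownianReal β P) (φ : StepFun) : Lp ℝ 2 P :=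
  ∑ k, φ.coef k • (memLp_increment hβ (φ.left k) (φ.right k)).toLp _

lemma coeFn_sum_smul {α ι : Type*} [MeasurableSpace α] {μ : Measure α} (s : Finset ι)
    (c : ι → ℝ) (f : ι → Lp ℝ 2 μ) (g : ι → α → ℝ) (h : ∀ k, f k =ᵐ[μ] g k) :
    ⇑(∑ k ∈ s, c k • f k) =ᵐ[μ] fun x => ∑ k ∈ s, c k * g k x := by
  classical
  induction s using Finset.induction_on with
  | empty =>
    simp only [Finset.sum_empty]
    exact Lp.coeFn_zero ℝ 2 μ
  | insert a s ha ih =>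
    rw [Finset.sum_insert ha]
    filter_upwards [Lp.coeFn_add (c a • f a) (∑ k ∈ s, c k • f k), Lp.coeFn_smul (c a) (f a), ih,
      h a] with x h1 h2 h3 h4
    rw [h1, Finset.sum_insert ha, Pi.add_apply, h2, h3, Pi.smul_apply, h4, smul_eq_mul]

lemma StepFun.coeFn_evalLp (φ : StepFun) : ⇑φ.evalLp =ᵐ[volume] φ.eval := by
  refine (coeFn_sum_smul _ _ _ _ fun k => indicatorConstLp_coeFn).trans (.of_forall fun s => ?_)
  refine Finset.sum_congr rfl fun k _ => ?_
  by_cases hs : s ∈ Set.Ioc (φ.left k : ℝ) (φ.right k)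
  · rw [Set.indicator_of_mem hs, Set.indicator_of_mem hs, mul_one]
  · rw [Set.indicator_of_notMem hs, Set.indicator_of_notMem hs, mul_zero]

lemma StepFun.coeFn_integralLp (hβ : IsPreBrownianReal β P) (φ : StepFun) :
    ⇑(φ.integralLp hβ) =ᵐ[P] φ.integral β :=
  coeFn_sum_smul _ _ _ (fun k ω => β (φ.right k) ω - β (φ.left k) ω) fun k =>
    (memLp_increment hβ (φ.left k) (φ.right k)).coeFn_toLp

lemma StepFun.inner_integralLp [IsProbabilityMeasure P]
    (hβ : IsPreBrownianReal β P) (φ ψ : StepFun) :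
    inner ℝ (φ.integralLp hβ) (ψ.integralLp hβ) = inner ℝ φ.evalLp ψ.evalLp := by
  simp only [integralLp, evalLp, sum_inner, inner_sum, real_inner_smul_left, real_inner_smul_right]
  refine Finset.sum_congr rfl fun k _ => Finset.sum_congr rfl fun l _ => ?_
  congr 2
  rw [indLp, indLp, L2.inner_indicatorConstLp_indicatorConstLp (hμs := measure_Ioc_lt_top.ne)
      (hμt := measure_Ioc_lt_top.ne),
    ← integral_increment_mul_increment hβ (φ.le _) (ψ.le _), L2.inner_def]
  simp only [RCLike.inner_apply, conj_trivial, mul_one, smul_eq_mul]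
  refine integral_congr_ae ?_
  filter_upwards [(memLp_increment hβ (φ.left l) (φ.right l)).coeFn_toLp,
    (memLp_increment hβ (ψ.left k) (ψ.right k)).coeFn_toLp] with ω h1 h2
  rw [h1, h2, mul_comm]

/-- The Itô isometry for step functions. -/
lemma StepFun.dist_integralLp [IsProbabilityMeasure P]
    (hβ : IsPreBrownianReal β P) (φ ψ : StepFun) :
    dist (φ.integralLp hβ) (ψ.integralLp hβ) = dist φ.evalLp ψ.evalLp := by
  rw [dist_eq_norm, dist_eq_norm, ← sq_eq_sq₀ (norm_nonneg _) (norm_nonneg _), norm_sub_sq_real,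
    norm_sub_sq_real]
  simp only [← real_inner_self_eq_norm_sq, inner_integralLp]

lemma StepFun.exists_add (φ ψ : StepFun) : ∃ χ : StepFun, χ.evalLp = φ.evalLp + ψ.evalLp :=
  ⟨⟨φ.card + ψ.card, Fin.append φ.left ψ.left, Fin.append φ.right ψ.right, fun k => by
    refine Fin.addCases (fun i => ?_) (fun i => ?_) k
    · simpa using φ.le i
    · simpa using ψ.le i, Fin.append φ.coef ψ.coef⟩, by
    simp [evalLp, Fin.sum_univ_add]⟩

/-- The step functions as a subspace of `L²(ℝ)`. -/
noncomputable def stepSubmodule : Submodule ℝ (Lp ℝ 2 (volume : Measure ℝ)) where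
  carrier := Set.range StepFun.evalLp
  add_mem' := by
    rintro _ _ ⟨φ, rfl⟩ ⟨ψ, rfl⟩
    exact StepFun.exists_add φ ψ
  zero_mem' := ⟨⟨0, fun _ => 0, fun _ => 0, fun _ => le_rfl, fun _ => 0⟩, by
    simp [StepFun.evalLp]⟩
  smul_mem' := by
    rintro c _ ⟨φ, rfl⟩
    exact ⟨⟨φ.card, φ.left, φ.right, φ.le, fun k => c * φ.coef k⟩, by
      simp [StepFun.evalLp, Finset.smul_sum, smul_smul]⟩

/-- Step functions are dense in the square integrable functions which vanish on `(-∞, 0]`: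
a function orthogonal to all intervals `(0, x]` has a vanishing primitive. -/
lemma mem_closure_range_evalLp (F : Lp ℝ 2 (volume : Measure ℝ))
    (hF : ∀ᵐ s, s ≤ 0 → F s = 0) : F ∈ closure (Set.range StepFun.evalLp) := by
  change F ∈ stepSubmodule.topologicalClosure
  rw [← Submodule.orthogonal_orthogonal_eq_closure, Submodule.mem_orthogonal]
  intro G hG
  rw [Submodule.mem_orthogonal] at hG
  have hloc : LocallyIntegrable G volume := (Lp.memLp G).locallyIntegrable one_le_two
  have hG0 : ∀ x : ℝ, 0 ≤ x → ∫ s in (0 : ℝ)..x, G s = 0 := by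
    intro x hx
    lift x to ℝ≥0 using hx
    have h1 := hG (indLp 0 x) ⟨⟨1, fun _ => 0, fun _ => x, fun _ => zero_le, fun _ => 1⟩, by
      simp [StepFun.evalLp]⟩
    rw [indLp, L2.inner_indicatorConstLp_one] at h1
    rw [intervalIntegral.integral_of_le (by positivity)]
    simpa using h1
  have hG1 : ∀ᵐ s, 0 < s → G s = 0 := by
    filter_upwards [_root_.LocallyIntegrable.ae_hasDerivAt_integral hloc] with s hs hs0
    refine (hs 0).unique ((hasDerivAt_const s (0 : ℝ)).congr_of_eventuallyEq ?_)
    filter_upwards [Ioi_mem_nhds hs0] with x hx using hG0 x (le_of_lt hx)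
  rw [L2.inner_def]
  refine integral_eq_zero_of_ae ?_
  filter_upwards [hF, hG1] with s h1 h2
  rcases le_or_gt s 0 with h | h
  · simp [h1 h]
  · simp [h2 h]

end Wiener

section Wiener

variable {Ω : Type*} [MeasurableSpace Ω] {P : Measure Ω}
  {β : ℝ≥0 → Ω → ℝ} {T : ℝ}

lemma isWienerIntegral_iff (hβ : IsPreBrownianReal β P) {f : ℝ → ℝ} {t : ℝ}
    (hf : MemLp ((Set.Ioc 0 t).indicator f) 2 volume) (I : Ω → ℝ) :
    IsWienerIntegral P β f t I ↔ ∃ hI : MemLp I 2 P, ∃ φ : ℕ → StepFun,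
      Tendsto (fun k => (φ k).evalLp) atTop (𝓝 (hf.toLp _)) ∧
      Tendsto (fun k => (φ k).integralLp hβ) atTop (𝓝 (hI.toLp I)) := by
  have h1 : ∀ φ : ℕ → StepFun, Tendsto (fun k => (φ k).evalLp) atTop (𝓝 (hf.toLp _)) ↔
      Tendsto (fun k => eLpNorm (fun s => (φ k).eval s - (Set.Ioc 0 t).indicator f s) 2 volume)
        atTop (𝓝 0) := fun φ => by
    rw [Lp.tendsto_Lp_iff_tendsto_eLpNorm]
    refine tendsto_congr fun k => eLpNorm_congr_ae ?_
    filter_upwards [(φ k).coeFn_evalLp] with s hs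
    rw [Pi.sub_apply, hs]
  have h2 : ∀ (hI : MemLp I 2 P) (φ : ℕ → StepFun),
      Tendsto (fun k => (φ k).integralLp hβ) atTop (𝓝 (hI.toLp I)) ↔
      Tendsto (fun k => eLpNorm (fun ω => (φ k).integral β ω - I ω) 2 P) atTop (𝓝 0) :=
      fun hI φ => by
    rw [Lp.tendsto_Lp_iff_tendsto_eLpNorm]
    refine tendsto_congr fun k => eLpNorm_congr_ae ?_
    filter_upwards [(φ k).coeFn_integralLp hβ] with s hs
    rw [Pi.sub_apply, hs]
  constructor
  · rintro ⟨hI, φ, h3, h4⟩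
    exact ⟨hI, φ, (h1 φ).2 h3, (h2 hI φ).2 h4⟩
  · rintro ⟨hI, φ, h3, h4⟩
    exact ⟨hI, φ, (h1 φ).1 h3, (h2 hI φ).1 h4⟩

/-- The Itô isometry for limits of step functions. -/
lemma dist_eq_of_tendsto_integralLp [IsProbabilityMeasure P]
    (hβ : IsPreBrownianReal β P) {φ ψ : ℕ → StepFun}
    {F G : Lp ℝ 2 (volume : Measure ℝ)} {I J : Lp ℝ 2 P}
    (hF : Tendsto (fun k => (φ k).evalLp) atTop (𝓝 F))
    (hG : Tendsto (fun k => (ψ k).evalLp) atTop (𝓝 G))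
    (hI : Tendsto (fun k => (φ k).integralLp hβ) atTop (𝓝 I))
    (hJ : Tendsto (fun k => (ψ k).integralLp hβ) atTop (𝓝 J)) : dist I J = dist F G := by
  refine tendsto_nhds_unique (hI.dist hJ) ?_
  simp only [StepFun.dist_integralLp]
  exact hF.dist hG

lemma memLp_indicator_Ioc {f : ℝ → ℝ} (hf : MemLp f 2 (volume.restrict (Set.Icc 0 T))) {t : ℝ}
    (ht : t ∈ Set.Icc 0 T) : MemLp ((Set.Ioc 0 t).indicator f) 2 volume :=
  (memLp_indicator_iff_restrict measurableSet_Ioc).2 (hf.mono_measure (Measure.restrict_mono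
    (Set.Ioc_subset_Icc_self.trans (Set.Icc_subset_Icc_right ht.2)) le_rfl))

lemma IsWienerIntegral.ae_eq [IsProbabilityMeasure P]
    (hβ : IsPreBrownianReal β P) {f : ℝ → ℝ} {t : ℝ}
    (hf : MemLp f 2 (volume.restrict (Set.Icc 0 T))) (ht : t ∈ Set.Icc 0 T) {I J : Ω → ℝ}
    (hI : IsWienerIntegral P β f t I) (hJ : IsWienerIntegral P β f t J) : I =ᵐ[P] J := by
  have hft := memLp_indicator_Ioc hf ht
  obtain ⟨hI2, φ, h1, h2⟩ := (isWienerIntegral_iff hβ hft I).1 hI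
  obtain ⟨hJ2, ψ, h3, h4⟩ := (isWienerIntegral_iff hβ hft J).1 hJ
  have := dist_eq_of_tendsto_integralLp hβ h1 h3 h2 h4
  rw [dist_self, dist_eq_zero] at this
  exact (MemLp.toLp_eq_toLp_iff hI2 hJ2).1 this

lemma IsWienerIntegral.integral_eq_zero [IsProbabilityMeasure P]
    (hβ : IsPreBrownianReal β P) {f : ℝ → ℝ} {t : ℝ}
    (hf : MemLp f 2 (volume.restrict (Set.Icc 0 T))) (ht : t ∈ Set.Icc 0 T) {I : Ω → ℝ}
    (hI : IsWienerIntegral P β f t I) : ∫ ω, I ω ∂P = 0 := by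
  obtain ⟨hI2, φ, h1, h2⟩ := (isWienerIntegral_iff hβ (memLp_indicator_Ioc hf ht) I).1 hI
  have h3 : ∀ J : Lp ℝ 2 P, inner ℝ (indicatorConstLp 2 MeasurableSet.univ
      (measure_ne_top P Set.univ) (1 : ℝ)) J = ∫ ω, J ω ∂P := fun J => by
    rw [L2.inner_indicatorConstLp_one, setIntegral_univ]
  have h4 : ∀ k, ∫ ω, (φ k).integralLp hβ ω ∂P = 0 := fun k => by
    rw [integral_congr_ae ((φ k).coeFn_integralLp hβ)]
    simp only [StepFun.integral]
    rw [integral_finsetSum _ fun j _ =>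
      ((memLp_increment hβ _ _).integrable one_le_two).const_mul _]
    refine Finset.sum_eq_zero fun j _ => ?_
    rw [integral_const_mul, integral_sub (hβ.integrable_eval _) (hβ.integrable_eval _),
      hβ.integral_eval, hβ.integral_eval, sub_zero, mul_zero]
  have h5 := (tendsto_const_nhds (x := indicatorConstLp 2 MeasurableSet.univ
      (measure_ne_top P Set.univ) (1 : ℝ))).inner (𝕜 := ℝ) h2
  simp only [h3, h4] at h5
  rw [← integral_congr_ae hI2.coeFn_toLp]
  exact tendsto_nhds_unique tendsto_const_nhds h5 |>.symm

lemma exists_isWienerIntegral [IsProbabilityMeasure P]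
    (hβ : IsPreBrownianReal β P) {f : ℝ → ℝ} {t : ℝ}
    (hft : MemLp ((Set.Ioc 0 t).indicator f) 2 volume) :
    ∃ (I : Lp ℝ 2 P) (φ : ℕ → StepFun),
      Tendsto (fun k => (φ k).evalLp) atTop (𝓝 (hft.toLp _)) ∧
      Tendsto (fun k => (φ k).integralLp hβ) atTop (𝓝 I) := by
  have hcl : hft.toLp _ ∈ closure (Set.range StepFun.evalLp) := by
    refine mem_closure_range_evalLp _ ?_
    filter_upwards [hft.coeFn_toLp] with s hs hs0
    rw [hs, Set.indicator_of_notMem]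
    exact fun h => absurd h.1 (not_lt.2 hs0)
  obtain ⟨x, hx, hxt⟩ := mem_closure_iff_seq_limit.1 hcl
  choose φ hφ using hx
  have hφ' : Tendsto (fun k => (φ k).evalLp) atTop (𝓝 (hft.toLp _)) := by
    simpa only [hφ] using hxt
  have hc : CauchySeq fun k => (φ k).integralLp hβ := by
    rw [Metric.cauchySeq_iff]
    simp only [StepFun.dist_integralLp]
    exact Metric.cauchySeq_iff.1 hφ'.cauchySeq
  obtain ⟨I, hI⟩ := cauchySeq_tendsto_of_complete hc
  exact ⟨I, φ, hφ', hI⟩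

/-- A continuous curve in `L²(P)` is represented by a jointly measurable process: approximate it by
its values on grids, along a subsequence for which the approximation converges fast enough. -/
lemma exists_measurable_process [IsProbabilityMeasure P]
    {N : ℝ → Lp ℝ 2 P} (hN : ContinuousOn N (Set.Icc 0 T)) :
    ∃ X : ℝ → Ω → ℝ, Measurable (Function.uncurry X) ∧
      ∀ t ∈ Set.Icc 0 T, X t =ᵐ[P] N t := by
  have hu := Metric.uniformContinuousOn_iff.1
    (isCompact_Icc.uniformContinuousOn_of_continuous hN)
  have hk : ∀ k : ℕ, ∃ m : ℕ, 0 < m ∧ ∀ t ∈ Set.Icc 0 T,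
      dist (N (⌊t * m⌋₊ / m)) (N t) < (1 / 2) ^ k := by
    intro k
    obtain ⟨δ, hδ, H⟩ := hu ((1 / 2) ^ k) (by positivity)
    obtain ⟨m, hm⟩ := exists_nat_one_div_lt hδ
    refine ⟨m + 1, by positivity, fun t ht => ?_⟩
    have hm0 : (0 : ℝ) < (m + 1 : ℕ) := by positivity
    have h1 : (⌊t * (m + 1 : ℕ)⌋₊ : ℝ) ≤ t * (m + 1 : ℕ) :=
      Nat.floor_le (mul_nonneg ht.1 hm0.le)
    have h2 : t * (m + 1 : ℕ) < ⌊t * (m + 1 : ℕ)⌋₊ + 1 := Nat.lt_floor_add_one _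
    have h3 : (⌊t * (m + 1 : ℕ)⌋₊ : ℝ) / (m + 1 : ℕ) ≤ t := by rwa [div_le_iff₀ hm0]
    refine H _ ⟨by positivity, h3.trans ht.2⟩ _ ht ?_
    rw [dist_comm, Real.dist_eq, abs_of_nonneg (by linarith)]
    refine lt_trans ?_ hm
    have h4 : t < (⌊t * (m + 1 : ℕ)⌋₊ + 1) / (m + 1 : ℕ) := by rwa [lt_div_iff₀ hm0]
    rw [add_div] at h4
    push_cast at h4 ⊢
    linarith
  choose m hm0 hm using hk
  let G : ℕ → ℕ × Ω → ℝ := fun k q => N ((q.1 : ℝ) / m k) q.2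
  have hG : ∀ k, Measurable (G k) := fun k =>
    measurable_from_prod_countable_right fun j =>
      (Lp.stronglyMeasurable (N ((j : ℝ) / m k))).measurable
  let Y : ℕ → ℝ × Ω → ℝ := fun k p => G k (⌊p.1 * m k⌋₊, p.2)
  have hY : ∀ k, StronglyMeasurable (Y k) := fun k => by
    refine ((hG k).comp (Measurable.prodMk ?_ measurable_snd)).stronglyMeasurable
    exact Nat.measurable_floor.comp (measurable_fst.mul_const _)
  have hlm : Measurable fun p => limUnder atTop fun k => Y k p :=
    (StronglyMeasurable.limUnder hY).measurable
  refine ⟨fun t ω => limUnder atTop fun k => Y k (t, ω), hlm, fun t ht => ?_⟩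
  have hYt : ∀ k, AEStronglyMeasurable (fun ω => Y k (t, ω)) P := fun k =>
    ((hY k).comp_measurable (by fun_prop)).aestronglyMeasurable
  have hd : ∀ k, eLpNorm ((fun ω => Y k (t, ω)) - ⇑(N t)) 2 P < ENNReal.ofReal ((1 / 2) ^ k) := by
    intro k
    have h1 := hm k t ht
    rw [Lp.dist_def] at h1
    have h2 : (fun ω => Y k (t, ω)) = ⇑(N (⌊t * m k⌋₊ / m k)) := rfl
    rw [h2]
    refine (ENNReal.lt_ofReal_iff_toReal_lt ?_).2 h1
    exact ((Lp.memLp _).sub (Lp.memLp _)).2.ne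
  have hlim : Tendsto (fun k => eLpNorm ((fun ω => Y k (t, ω)) - ⇑(N t)) 2 P) atTop (𝓝 0) := by
    refine tendsto_of_tendsto_of_tendsto_of_le_of_le tendsto_const_nhds ?_
      (fun _ => zero_le) (fun k => (hd k).le)
    rw [← ENNReal.ofReal_zero]
    exact ENNReal.tendsto_ofReal (tendsto_pow_atTop_nhds_zero_of_lt_one (by norm_num) (by norm_num))
  have hc : ∀ᵐ ω ∂P, ∃ l : ℝ, Tendsto (fun k => Y k (t, ω)) atTop (𝓝 l) := by
    refine Lp.ae_tendsto_of_cauchy_eLpNorm (p := 2) hYt one_le_two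
      (B := fun k => ENNReal.ofReal (2 * (1 / 2) ^ k)) ?_ ?_
    · have hs : Summable fun k : ℕ => 2 * (1 / 2 : ℝ) ^ k :=
        (summable_geometric_of_lt_one (by norm_num) (by norm_num)).mul_left 2
      exact hs.tsum_ofReal_ne_top
    · intro M a b ha hb
      have h1 : (fun ω => Y a (t, ω)) - (fun ω => Y b (t, ω)) =
          ((fun ω => Y a (t, ω)) - ⇑(N t)) - ((fun ω => Y b (t, ω)) - ⇑(N t)) := by abel
      rw [h1]
      refine (eLpNorm_sub_le ((hYt a).sub (Lp.memLp _).1) ((hYt b).sub (Lp.memLp _).1)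
        one_le_two).trans_lt ?_
      refine (ENNReal.add_lt_add (hd a) (hd b)).trans_le ?_
      rw [← ENNReal.ofReal_add (by positivity) (by positivity), two_mul]
      refine ENNReal.ofReal_le_ofReal (add_le_add ?_ ?_)
      · exact pow_le_pow_of_le_one (by norm_num) (by norm_num) ha
      · exact pow_le_pow_of_le_one (by norm_num) (by norm_num) hb
  have h1 : ∀ᵐ ω ∂P, Tendsto (fun k => Y k (t, ω)) atTop
      (𝓝 (limUnder atTop fun k => Y k (t, ω))) := by
    filter_upwards [hc] with ω hω using tendsto_nhds_limUnder hω
  exact tendstoInMeasure_ae_unique (tendstoInMeasure_of_tendsto_ae hYt h1)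
    (tendstoInMeasure_of_tendsto_eLpNorm two_ne_zero hYt (Lp.memLp _).1 hlim)

/-- The Wiener integrals `∫₀ᵗ f dβ`, `t ∈ [0, T]`, form a square integrable measurable process. -/
lemma exists_wienerIntegral_process [IsProbabilityMeasure P] (hT : 0 ≤ T)
    (hβ : IsPreBrownianReal β P) {f : ℝ → ℝ}
    (hf : MemLp f 2 (volume.restrict (Set.Icc 0 T))) :
    ∃ X : ℝ → Ω → ℝ, MemLp (Function.uncurry X) 2 (timeMeasure P T) ∧
      ∀ t ∈ Set.Icc 0 T, IsWienerIntegral P β f t (X t) := by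
  classical
  have hft : ∀ t : Set.Icc 0 T, MemLp ((Set.Ioc 0 (t : ℝ)).indicator f) 2 volume := fun t =>
    memLp_indicator_Ioc hf t.2
  choose N φ hφ hN using fun t : Set.Icc 0 T => exists_isWienerIntegral hβ (hft t)
  have hdist : ∀ s t, dist (N s) (N t) = dist ((hft s).toLp _) ((hft t).toLp _) := fun s t =>
    dist_eq_of_tendsto_integralLp hβ (hφ s) (hφ t) (hN s) (hN t)
  let q : ℝ → ℝ := fun t => ∫ s in Set.Ioc 0 t, f s ^ 2
  have hq : ContinuousOn q (Set.Icc 0 T) :=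
    intervalIntegral.continuousOn_primitive hf.integrable_sq
  have hin : ∀ s t : Set.Icc 0 T, inner ℝ ((hft s).toLp _) ((hft t).toLp _) = q (min s t) := by
    intro s t
    change _ = ∫ r in Set.Ioc 0 (min (s : ℝ) t), f r ^ 2
    rw [L2.inner_def, ← integral_indicator measurableSet_Ioc]
    refine integral_congr_ae ?_
    filter_upwards [(hft s).coeFn_toLp, (hft t).coeFn_toLp] with r h1 h2
    rw [h1, h2]
    clear h1 h2
    simp only [Set.indicator, Set.mem_Ioc, le_min_iff, RCLike.inner_apply, conj_trivial]
    split_ifs <;> first | (exfalso; tauto) | ring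
  have hdist2 : ∀ s t : Set.Icc 0 T, dist (N s) (N t) ^ 2 = q s - 2 * q (min s t) + q t := by
    intro s t
    rw [hdist, dist_eq_norm, norm_sub_sq_real, ← real_inner_self_eq_norm_sq,
      ← real_inner_self_eq_norm_sq, hin, hin, hin, min_self, min_self]
  have hNc : Continuous N := by
    rw [continuous_iff_continuousAt]
    intro t
    rw [ContinuousAt, tendsto_iff_dist_tendsto_zero]
    have h1 : Tendsto (fun s : Set.Icc 0 T => dist (N s) (N t) ^ 2) (𝓝 t) (𝓝 0) := by
      simp only [hdist2]
      have hq' : Continuous fun s : Set.Icc 0 T => q s :=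
        continuousOn_iff_continuous_domRestrict.1 hq
      have h2 : Continuous fun s : Set.Icc 0 T => q s - 2 * q (min s t) + q t :=
        (hq'.sub ((hq'.comp (continuous_id.min continuous_const)).const_mul 2)).add_const _
      convert h2.tendsto t using 2
      rw [min_self]
      ring
    have h2 := h1.sqrt
    simpa [Real.sqrt_sq dist_nonneg] using h2
  obtain ⟨X, hX, hXN⟩ := exists_measurable_process (T := T) (N := Set.IccExtend hT N)
    hNc.Icc_extend'.continuousOn
  have hXN' : ∀ t (ht : t ∈ Set.Icc 0 T), X t =ᵐ[P] N ⟨t, ht⟩ := fun t ht => by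
    have := hXN t ht
    rwa [Set.IccExtend_of_mem hT N ht] at this
  have hXt : ∀ t ∈ Set.Icc 0 T, MemLp (X t) 2 P := fun t ht =>
    (memLp_congr_ae (hXN' t ht)).2 (Lp.memLp _)
  refine ⟨X, ?_, fun t ht => ?_⟩
  · refine (memLp_two_iff_integrable_sq hX.aestronglyMeasurable).2 ?_
    refine (integrable_prod_iff (hX.pow_const 2).aestronglyMeasurable).2 ⟨?_, ?_⟩
    · filter_upwards [ae_restrict_mem measurableSet_Icc] with t ht
      exact (hXt t ht).integrable_sq
    · have h1 : ContinuousOn (fun t => ‖Set.IccExtend hT N t‖ ^ 2) (Set.Icc 0 T) :=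
        (hNc.Icc_extend'.norm.pow 2).continuousOn
      refine h1.integrableOn_Icc.congr ?_
      filter_upwards [ae_restrict_mem measurableSet_Icc] with t ht
      rw [Set.IccExtend_of_mem hT N ht, ← real_inner_self_eq_norm_sq, L2.inner_def]
      refine integral_congr_ae ?_
      filter_upwards [hXN' t ht] with ω hω
      simp [Function.uncurry, hω, sq]
  · refine (isWienerIntegral_iff hβ (hft ⟨t, ht⟩) _).2 ⟨hXt t ht, φ ⟨t, ht⟩, hφ ⟨t, ht⟩, ?_⟩
    convert hN ⟨t, ht⟩ using 2
    rw [← Lp.toLp_coeFn (N ⟨t, ht⟩) (Lp.memLp _)]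
    exact MemLp.toLp_congr _ _ (hXN' t ht)

end Wiener

/-! ### Trajectories of the state equation -/

lemma intervalIntegrable_of_integrableOn {E : Type*} [NormedAddCommGroup E] {T : ℝ} {f : ℝ → E}
    (hf : IntegrableOn f (Set.Icc 0 T)) {t : ℝ} (ht : t ∈ Set.Icc 0 T) :
    IntervalIntegrable f volume 0 t :=
  (intervalIntegrable_iff_integrableOn_Icc_of_le ht.1).2
    (hf.mono_set (Set.Icc_subset_Icc_right ht.2))

lemma intervalIntegral_congr_of_ae_Icc {E : Type*} [NormedAddCommGroup E] [NormedSpace ℝ E] {T : ℝ}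
    {f g : ℝ → E} (h : f =ᵐ[volume.restrict (Set.Icc 0 T)] g) {t : ℝ} (ht : t ∈ Set.Icc 0 T) :
    ∫ s in (0 : ℝ)..t, f s = ∫ s in (0 : ℝ)..t, g s := by
  rw [intervalIntegral.integral_of_le ht.1, intervalIntegral.integral_of_le ht.1]
  exact integral_congr_ae (ae_restrict_of_ae_restrict_of_subset
    (Set.Ioc_subset_Icc_self.trans (Set.Icc_subset_Icc_right ht.2)) h)

section Trajectories

variable {Ω : Type*} [MeasurableSpace Ω] {P : Measure Ω} {n m : ℕ} {T : ℝ}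
  {c : Coeffs n m} {Φ Ψ : ℝ → Matrix (Fin n) (Fin n) ℝ}
  {x0 : Ω → Fin n → ℝ} {W : ℝ≥0 → Ω → Fin n → ℝ}

/-- The pathwise linear response of the state to a variation `w` of the control: the solution of
`d' = A d + B w`, `d 0 = 0`. -/
noncomputable def response (c : Coeffs n m) (Φ Ψ : ℝ → Matrix (Fin n) (Fin n) ℝ)
    (w : ℝ → Ω → Fin m → ℝ) (t : ℝ) (ω : Ω) : Fin n → ℝ :=
  duhamel Φ Ψ (fun s => c.B s *ᵥ w s ω) t

omit [MeasurableSpace Ω] in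
lemma response_smul (a : ℝ) (w : ℝ → Ω → Fin m → ℝ) (t : ℝ) (ω : Ω) :
    response c Φ Ψ (fun s ω => a • w s ω) t ω = a • response c Φ Ψ w t ω := by
  simp [response, duhamel, Matrix.mulVec_smul]

variable [IsProbabilityMeasure P]

lemma ae_integrableOn_of_memLp (hT : 0 ≤ T) {x : ℝ → Ω → Fin n → ℝ}
    (hx : MemLp (Function.uncurry x) 2 (timeMeasure P T)) :
    ∀ᵐ ω ∂P, IntegrableOn (fun s => x s ω) (Set.Icc 0 T) := by
  filter_upwards [ae_integrableOn_path hT hx] with ω hω using hω.1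

lemma response_congr {w w' : ℝ → Ω → Fin m → ℝ}
    (h : Function.uncurry w =ᵐ[timeMeasure P T] Function.uncurry w') :
    ∀ᵐ ω ∂P, ∀ t ∈ Set.Icc 0 T, response c Φ Ψ w t ω = response c Φ Ψ w' t ω := by
  filter_upwards [ae_ae_of_ae_timeMeasure (q := fun t ω => w t ω = w' t ω) h] with ω hω t ht
  simp only [response, duhamel]
  congr 1
  refine intervalIntegral_congr_of_ae_Icc ?_ ht
  filter_upwards [hω] with s hs
  rw [hs]

variable (hT : 0 ≤ T) (hc : c.Standing T) (hF : IsFundamental T c.A Φ Ψ)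
include hT hc hF

lemma response_add {w w' : ℝ → Ω → Fin m → ℝ}
    (hw : MemLp (Function.uncurry w) 2 (timeMeasure P T))
    (hw' : MemLp (Function.uncurry w') 2 (timeMeasure P T)) :
    ∀ᵐ ω ∂P, ∀ t ∈ Set.Icc 0 T, response c Φ Ψ (fun s ω => w s ω + w' s ω) t ω =
      response c Φ Ψ w t ω + response c Φ Ψ w' t ω := by
  filter_upwards [ae_integrableOn_of_memLp hT hw, ae_integrableOn_of_memLp hT hw']
    with ω h1 h2 t ht
  simp only [response, duhamel, Matrix.mulVec_add]
  rw [intervalIntegral.integral_add, Matrix.mulVec_add]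
  · exact intervalIntegrable_of_integrableOn
      ((hF.bdd_inv hT).integrableOn_mulVec (hc.bdd_B.integrableOn_mulVec h1)) ht
  · exact intervalIntegrable_of_integrableOn
      ((hF.bdd_inv hT).integrableOn_mulVec (hc.bdd_B.integrableOn_mulVec h2)) ht

/-- `L²` bounds for the response. -/
lemma exists_response_bound : ∃ C : ℝ, 0 ≤ C ∧ ∀ w : ℝ → Ω → Fin m → ℝ,
    MemLp (Function.uncurry w) 2 (timeMeasure P T) →
    (MemLp (Function.uncurry (response c Φ Ψ w)) 2 (timeMeasure P T) ∧
      ∫ p, ‖Function.uncurry (response c Φ Ψ w) p‖ ^ 2 ∂(timeMeasure P T) ≤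
        C * ∫ p, ‖Function.uncurry w p‖ ^ 2 ∂(timeMeasure P T)) ∧
    ∀ t ∈ Set.Icc 0 T, MemLp (response c Φ Ψ w t) 2 P ∧
      ∫ ω, ‖response c Φ Ψ w t ω‖ ^ 2 ∂P ≤
        C * ∫ p, ‖Function.uncurry w p‖ ^ 2 ∂(timeMeasure P T) := by
  obtain ⟨C1, hC1, H1⟩ := memLp_mulVec_primitive (P := P) hT (hF.bdd hT)
  have hΨB := (hF.bdd_inv hT).mul hc.bdd_B
  obtain ⟨C2, hC2, H2⟩ := hΨB.exists_integral_sq_mulVec_le (P := P)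
  refine ⟨C1 * C2, by positivity, fun w hw => ?_⟩
  have h1 := H1 (fun s ω => (Ψ s * c.B s) *ᵥ w s ω) (hΨB.memLp_process hw)
  have h2 : C1 * ∫ p, ‖(Ψ p.1 * c.B p.1) *ᵥ Function.uncurry w p‖ ^ 2 ∂(timeMeasure P T) ≤
      C1 * C2 * ∫ p, ‖Function.uncurry w p‖ ^ 2 ∂(timeMeasure P T) := by
    rw [mul_assoc]
    exact mul_le_mul_of_nonneg_left (H2 w hw) hC1
  have hr : response c Φ Ψ w = fun t ω =>
      Φ t *ᵥ ∫ s in (0 : ℝ)..t, (Ψ s * c.B s) *ᵥ w s ω := by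
    ext t ω
    simp [response, duhamel, Matrix.mulVec_mulVec]
  rw [hr]
  exact ⟨⟨h1.1.1, h1.1.2.trans h2⟩, fun t ht => ⟨(h1.2 t ht).1, (h1.2 t ht).2.trans h2⟩⟩

lemma memLp_response {w : ℝ → Ω → Fin m → ℝ}
    (hw : MemLp (Function.uncurry w) 2 (timeMeasure P T)) :
    MemLp (Function.uncurry (response c Φ Ψ w)) 2 (timeMeasure P T) := by
  obtain ⟨C, -, H⟩ := exists_response_bound (P := P) hT hc hF
  exact (H w hw).1.1

lemma memLp_response_time {w : ℝ → Ω → Fin m → ℝ}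
    (hw : MemLp (Function.uncurry w) 2 (timeMeasure P T)) {t : ℝ} (ht : t ∈ Set.Icc 0 T) :
    MemLp (response c Φ Ψ w t) 2 P := by
  obtain ⟨C, -, H⟩ := exists_response_bound (P := P) hT hc hF
  exact ((H w hw).2 t ht).1

omit [IsProbabilityMeasure P] [MeasurableSpace Ω] in
lemma hasACDeriv_response {w : ℝ → Ω → Fin m → ℝ} {ω : Ω}
    (hw : IntegrableOn (fun s => w s ω) (Set.Icc 0 T)) :
    HasACDeriv T (fun t => response c Φ Ψ w t ω)
      (fun t => c.A t *ᵥ response c Φ Ψ w t ω + c.B t *ᵥ w t ω) :=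
  hF.hasACDeriv_duhamel hT (hc.bdd_B.integrableOn_mulVec hw)

end Trajectories

section Trajectories

variable {Ω : Type*} [MeasurableSpace Ω] {P : Measure Ω} {n m : ℕ} {T : ℝ}
  {c : Coeffs n m} {Φ Ψ : ℝ → Matrix (Fin n) (Fin n) ℝ}
  {x0 : Ω → Fin n → ℝ} {W : ℝ≥0 → Ω → Fin n → ℝ} {z : ℝ → Fin n → ℝ}

/-- A trajectory depends on the mean field term only through its values on `[0, T]`. -/
lemma IsTrajectory.congr_mean {z' : ℝ → Fin n → ℝ} {v : ℝ → Ω → Fin m → ℝ} {x : ℝ → Ω → Fin n → ℝ}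
    (h : IsTrajectory c P T x0 W z v x) (hz : ∀ t ∈ Set.Icc 0 T, z t = z' t) :
    IsTrajectory c P T x0 W z' v x := by
  refine ⟨h.memLp, h.memLp_time, fun t ht => ?_⟩
  obtain ⟨I, hI, hx⟩ := h.equation t ht
  refine ⟨I, hI, ?_⟩
  filter_upwards [hx] with ω hω
  rw [hω]
  congr 2
  refine intervalIntegral_congr_of_ae_Icc (T := T) ?_ ht
  filter_upwards [ae_restrict_mem measurableSet_Icc] with s hs
  rw [hz s hs]

variable [IsProbabilityMeasure P]

/-- Adding the response to a control variation to a trajectory gives a trajectory. -/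
lemma IsTrajectory.add_response (hT : 0 ≤ T) (hc : c.Standing T) (hF : IsFundamental T c.A Φ Ψ)
    (hz : IntegrableOn z (Set.Icc 0 T)) {v w : ℝ → Ω → Fin m → ℝ} {x : ℝ → Ω → Fin n → ℝ}
    (hv : MemLp (Function.uncurry v) 2 (timeMeasure P T))
    (hw : MemLp (Function.uncurry w) 2 (timeMeasure P T))
    (h : IsTrajectory c P T x0 W z v x) :
    IsTrajectory c P T x0 W z (fun t ω => v t ω + w t ω)
      (fun t ω => x t ω + response c Φ Ψ w t ω) := by
  have hr := memLp_response hT hc hF hw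
  refine ⟨h.memLp.add hr,
    fun t ht => (h.memLp_time t ht).add (memLp_response_time hT hc hF hw ht), fun t ht => ?_⟩
  obtain ⟨I, hI, hx⟩ := h.equation t ht
  refine ⟨I, hI, ?_⟩
  filter_upwards [hx, ae_integrableOn_of_memLp hT hw, ae_integrableOn_of_memLp hT hv,
    ae_integrableOn_of_memLp hT h.memLp, ae_integrableOn_of_memLp hT hr] with ω h1 h2 h3 h4 h5
  have h6 := (hasACDeriv_response hT hc hF h2).eq_add_integral hT ht
  have h0 : response c Φ Ψ w 0 ω = 0 := duhamel_zero _ _ _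
  rw [h0, zero_add] at h6
  have h7 : ∀ s, c.A s *ᵥ (x s ω + response c Φ Ψ w s ω) + c.B s *ᵥ (v s ω + w s ω) +
      c.Abar s *ᵥ z s = (c.A s *ᵥ x s ω + c.B s *ᵥ v s ω + c.Abar s *ᵥ z s) +
        (c.A s *ᵥ response c Φ Ψ w s ω + c.B s *ᵥ w s ω) := fun s => by
    rw [Matrix.mulVec_add, Matrix.mulVec_add]
    abel
  rw [h1]
  simp_rw [h7]
  rw [intervalIntegral.integral_add
    (f := fun s => c.A s *ᵥ x s ω + c.B s *ᵥ v s ω + c.Abar s *ᵥ z s)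
    (g := fun s => c.A s *ᵥ response c Φ Ψ w s ω + c.B s *ᵥ w s ω), ← h6]
  · abel
  · exact intervalIntegrable_of_integrableOn (((hc.bdd_A.integrableOn_mulVec h4).add
      (hc.bdd_B.integrableOn_mulVec h3)).add (hc.bdd_Abar.integrableOn_mulVec hz)) ht
  · exact intervalIntegrable_of_integrableOn ((hc.bdd_A.integrableOn_mulVec h5).add
      (hc.bdd_B.integrableOn_mulVec h2)) ht

/-- As the noise is additive, the difference of two trajectories for the same mean field term is
the response to the difference of the controls. -/
lemma IsTrajectory.eq_add_response (hT : 0 ≤ T) (hc : c.Standing T)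
    (hF : IsFundamental T c.A Φ Ψ) (hW : IsWiener W P)
    (hz : IntegrableOn z (Set.Icc 0 T)) {v v' : ℝ → Ω → Fin m → ℝ} {x x' : ℝ → Ω → Fin n → ℝ}
    (hv : MemLp (Function.uncurry v) 2 (timeMeasure P T))
    (hv' : MemLp (Function.uncurry v') 2 (timeMeasure P T))
    (h : IsTrajectory c P T x0 W z v x) (h' : IsTrajectory c P T x0 W z v' x') :
    (Function.uncurry x' =ᵐ[timeMeasure P T] Function.uncurry
      fun t ω => x t ω + response c Φ Ψ (fun s ω => v' s ω - v s ω) t ω) ∧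
    ∀ t ∈ Set.Icc 0 T,
      x' t =ᵐ[P] fun ω => x t ω + response c Φ Ψ (fun s ω => v' s ω - v s ω) t ω := by
  set w : ℝ → Ω → Fin m → ℝ := fun s ω => v' s ω - v s ω with hwdef
  have hw : MemLp (Function.uncurry w) 2 (timeMeasure P T) := hv'.sub hv
  have hr := memLp_response hT hc hF hw
  set e : ℝ → Ω → Fin n → ℝ := fun s ω => x' s ω - x s ω with hedef
  have he : MemLp (Function.uncurry e) 2 (timeMeasure P T) := h'.memLp.sub h.memLp
  set b : ℝ → Ω → Fin n → ℝ := fun s ω => c.A s *ᵥ e s ω + c.B s *ᵥ w s ω with hbdef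
  have hb : MemLp (Function.uncurry b) 2 (timeMeasure P T) :=
    (hc.bdd_A.memLp_process he).add (hc.bdd_B.memLp_process hw)
  -- the two noise terms cancel, being versions of the same Wiener integrals
  have h1 : ∀ t ∈ Set.Icc 0 T, e t =ᵐ[P] fun ω => ∫ s in (0 : ℝ)..t, b s ω := by
    intro t ht
    obtain ⟨I, hI, hx⟩ := h.equation t ht
    obtain ⟨I', hI', hx'⟩ := h'.equation t ht
    have hII : ∀ᵐ ω ∂P, ∀ i j, I' i j ω = I i j ω := by
      refine ae_all_iff.2 fun i => ae_all_iff.2 fun j => ?_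
      exact (hI' i j).ae_eq (hW.brownian j).toIsPreBrownianReal (hc.sq_int_sig i j) ht (hI i j)
    filter_upwards [hx, hx', hII, ae_integrableOn_of_memLp hT hv, ae_integrableOn_of_memLp hT hv',
      ae_integrableOn_of_memLp hT h.memLp, ae_integrableOn_of_memLp hT h'.memLp]
      with ω h1 h2 h3 h4 h5 h6 h7
    have hb' : ∀ s, b s ω = (c.A s *ᵥ x' s ω + c.B s *ᵥ v' s ω + c.Abar s *ᵥ z s) -
        (c.A s *ᵥ x s ω + c.B s *ᵥ v s ω + c.Abar s *ᵥ z s) := fun s => by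
      simp only [hbdef, hedef, hwdef, Matrix.mulVec_sub]
      abel
    simp_rw [hb']
    rw [intervalIntegral.integral_sub]
    · simp only [hedef]
      rw [h1, h2]
      simp only [h3]
      abel
    · exact intervalIntegrable_of_integrableOn (((hc.bdd_A.integrableOn_mulVec h7).add
        (hc.bdd_B.integrableOn_mulVec h5)).add (hc.bdd_Abar.integrableOn_mulVec hz)) ht
    · exact intervalIntegrable_of_integrableOn (((hc.bdd_A.integrableOn_mulVec h6).add
        (hc.bdd_B.integrableOn_mulVec h4)).add (hc.bdd_Abar.integrableOn_mulVec hz)) ht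
  have h2 := ae_timeMeasure_eq (g := fun t ω => ∫ s in (0 : ℝ)..t, b s ω) he.1
    (aestronglyMeasurable_primitive hb.1).1 h1
  -- hence `∫₀ᵗ (A e + B w)` solves, path by path, the equation of the response
  have h3 : ∀ᵐ ω ∂P, ∀ t ∈ Set.Icc 0 T, ∫ s in (0 : ℝ)..t, b s ω = response c Φ Ψ w t ω := by
    filter_upwards [ae_ae_of_ae_timeMeasure
      (q := fun t ω => e t ω = ∫ s in (0 : ℝ)..t, b s ω) h2, ae_integrableOn_of_memLp hT hw,
      ae_integrableOn_of_memLp hT hb] with ω h3 h4 h5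
    refine hF.eq_duhamel hT (by simp) (hc.bdd_B.integrableOn_mulVec h4) ?_
    have h6 := HasACDeriv.integral hT h5 0
    simp only [zero_add] at h6
    refine h6.congr_deriv ?_
    filter_upwards [h3] with s hs
    rw [← hs]
  have h4 : ∀ t ∈ Set.Icc 0 T, x' t =ᵐ[P] fun ω => x t ω + response c Φ Ψ w t ω := by
    intro t ht
    filter_upwards [h1 t ht, h3] with ω h5 h6
    rw [← h6 t ht, ← h5]
    simp [hedef]
  exact ⟨ae_timeMeasure_eq h'.memLp.1 (h.memLp.1.add hr.1) h4, h4⟩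

/-- Existence of the trajectory of the zero control: the sum of `x₀ + ∫ Ā z + ∫ σ dW` and the
pathwise solution of a linear equation with zero initial value. -/
lemma exists_isTrajectory (hT : 0 ≤ T) (hc : c.Standing T) (hF : IsFundamental T c.A Φ Ψ)
    (hW : IsWiener W P) (hx0 : MemLp x0 2 P) (hz : IntegrableOn z (Set.Icc 0 T)) :
    ∃ x : ℝ → Ω → Fin n → ℝ, IsTrajectory c P T x0 W z (fun _ _ => (0 : Fin m → ℝ)) x := by
  choose X hX hXI using fun i j => exists_wienerIntegral_process hT
    (hW.brownian j).toIsPreBrownianReal (hc.sq_int_sig i j)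
  have hz' := hc.bdd_Abar.integrableOn_mulVec hz
  have hζ : ContinuousOn (fun t => ∫ s in (0 : ℝ)..t, c.Abar s *ᵥ z s) (Set.Icc 0 T) := by
    simpa using (HasACDeriv.integral hT hz' 0).continuousOn hT
  have hζ2 : MemLp (fun t => ∫ s in (0 : ℝ)..t, c.Abar s *ᵥ z s) 2
      (volume.restrict (Set.Icc 0 T)) := by
    obtain ⟨K, hK⟩ := isCompact_Icc.exists_bound_of_continuousOn hζ
    refine MemLp.of_bound (hζ.aestronglyMeasurable measurableSet_Icc) K ?_
    filter_upwards [ae_restrict_mem measurableSet_Icc] with t ht using hK t ht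
  let g : ℝ → Ω → Fin n → ℝ := fun t ω =>
    x0 ω + (∫ s in (0 : ℝ)..t, c.Abar s *ᵥ z s) + fun i => ∑ j, X i j t ω
  have hg : MemLp (Function.uncurry g) 2 (timeMeasure P T) :=
    ((hx0.comp_snd _).add (hζ2.comp_fst P)).add
      (MemLp.of_eval fun i => memLp_finsetSum _ fun j _ => hX i j)
  have hgt : ∀ t ∈ Set.Icc 0 T, MemLp (g t) 2 P := fun t ht =>
    (hx0.add (memLp_const _)).add
      (MemLp.of_eval fun i => memLp_finsetSum _ fun j _ => (hXI i j t ht).1)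
  have hΨA := (hF.bdd_inv hT).mul hc.bdd_A
  obtain ⟨C1, -, H1⟩ := memLp_mulVec_primitive (P := P) hT (hF.bdd hT)
  have h1 := H1 (fun s ω => (Ψ s * c.A s) *ᵥ g s ω) (hΨA.memLp_process hg)
  let d : ℝ → Ω → Fin n → ℝ := fun t ω => duhamel Φ Ψ (fun s => c.A s *ᵥ g s ω) t
  have hd : d = fun t ω => Φ t *ᵥ ∫ s in (0 : ℝ)..t, (Ψ s * c.A s) *ᵥ g s ω := by
    ext t ω
    simp [d, duhamel, Matrix.mulVec_mulVec]
  refine ⟨fun t ω => g t ω + d t ω, ?_, ?_, fun t ht =>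
    ⟨fun i j => X i j t, fun i j => hXI i j t ht, ?_⟩⟩
  · rw [hd]
    exact hg.add h1.1.1
  · intro t ht
    rw [hd]
    exact (hgt t ht).add (h1.2 t ht).1
  · filter_upwards [ae_integrableOn_of_memLp hT hg] with ω hω
    have hAg := hc.bdd_A.integrableOn_mulVec hω
    have h2 := hF.hasACDeriv_duhamel hT hAg
    have h3 := h2.eq_add_integral hT ht
    have h4 : ∀ s, c.A s *ᵥ (g s ω + d s ω) + c.B s *ᵥ (0 : Fin m → ℝ) + c.Abar s *ᵥ z s =
        (c.A s *ᵥ duhamel Φ Ψ (fun s => c.A s *ᵥ g s ω) s + c.A s *ᵥ g s ω) + c.Abar s *ᵥ z s :=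
      fun s => by
        simp only [d, Matrix.mulVec_add, Matrix.mulVec_zero]
        abel
    simp_rw [h4]
    rw [intervalIntegral.integral_add (intervalIntegrable_of_integrableOn (h2.integrableOn hT) ht)
      (intervalIntegrable_of_integrableOn hz' ht)]
    rw [duhamel_zero, zero_add] at h3
    rw [← h3]
    simp only [g, d]
    abel

/-- The mean of a trajectory solves the averaged equation. -/
lemma IsTrajectory.mean_eq (hT : 0 ≤ T) (hc : c.Standing T) (hW : IsWiener W P)
    (hx0 : MemLp x0 2 P) (hz : MemLp z 2 (volume.restrict (Set.Icc 0 T)))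
    {v : ℝ → Ω → Fin m → ℝ} {x : ℝ → Ω → Fin n → ℝ}
    (hv : MemLp (Function.uncurry v) 2 (timeMeasure P T)) (h : IsTrajectory c P T x0 W z v x) :
    HasACDeriv T (fun t => ∫ ω, x0 ω ∂P + ∫ s in (0 : ℝ)..t, (c.A s *ᵥ (∫ ω, x s ω ∂P) +
        c.B s *ᵥ (∫ ω, v s ω ∂P) + c.Abar s *ᵥ z s))
      (fun t => c.A t *ᵥ (∫ ω, x t ω ∂P) + c.B t *ᵥ (∫ ω, v t ω ∂P) + c.Abar t *ᵥ z t) ∧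
    ∀ t ∈ Set.Icc 0 T, ∫ ω, x t ω ∂P = ∫ ω, x0 ω ∂P + ∫ s in (0 : ℝ)..t,
      (c.A s *ᵥ (∫ ω, x s ω ∂P) + c.B s *ᵥ (∫ ω, v s ω ∂P) + c.Abar s *ᵥ z s) := by
  have hb : MemLp (Function.uncurry fun t ω => c.A t *ᵥ x t ω + c.B t *ᵥ v t ω + c.Abar t *ᵥ z t) 2
      (timeMeasure P T) := ((hc.bdd_A.memLp_process h.memLp).add (hc.bdd_B.memLp_process hv)).add
        (hc.bdd_Abar.memLp_process (memLp_const_process hz))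
  have hmean : (fun t => ∫ ω, (c.A t *ᵥ x t ω + c.B t *ᵥ v t ω + c.Abar t *ᵥ z t) ∂P)
      =ᵐ[volume.restrict (Set.Icc 0 T)]
      fun t => c.A t *ᵥ (∫ ω, x t ω ∂P) + c.B t *ᵥ (∫ ω, v t ω ∂P) + c.Abar t *ᵥ z t := by
    have hxi : Integrable (Function.uncurry x) (timeMeasure P T) := h.memLp.integrable one_le_two
    have hvi : Integrable (Function.uncurry v) (timeMeasure P T) := hv.integrable one_le_two
    filter_upwards [hxi.prod_right_ae, hvi.prod_right_ae] with t h1 h2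
    simp only [Function.uncurry_apply_pair] at h1 h2
    have h1' : Integrable (fun ω => c.A t *ᵥ x t ω) P :=
      (Matrix.mulVecLin (c.A t)).toContinuousLinearMap.integrable_comp h1
    have h2' : Integrable (fun ω => c.B t *ᵥ v t ω) P :=
      (Matrix.mulVecLin (c.B t)).toContinuousLinearMap.integrable_comp h2
    rw [integral_add (f := fun ω => c.A t *ᵥ x t ω + c.B t *ᵥ v t ω) (h1'.add h2')
      (integrable_const _), integral_add h1' h2',
      integral_mulVec _ h1, integral_mulVec _ h2, integral_const]
    simp
  have hbi : Integrable _ (timeMeasure P T) := hb.integrable one_le_two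
  constructor
  · exact HasACDeriv.integral hT (hbi.integral_prod_left.congr hmean) _
  intro t ht
  obtain ⟨I, hI, hx⟩ := h.equation t ht
  have hint : Integrable (fun ω => ∫ s in (0 : ℝ)..t,
      (c.A s *ᵥ x s ω + c.B s *ᵥ v s ω + c.Abar s *ᵥ z s)) P := by
    obtain ⟨C, -, H⟩ := memLp_mulVec_primitive (P := P) hT (IsBoundedCoeff.const (T := T) 1)
    have := ((H _ hb).2 t ht).1.integrable one_le_two
    simpa using this
  have hI0 : ∀ i j, Integrable (I i j) P := fun i j => (hI i j).1.integrable one_le_two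
  have hII : Integrable (fun ω i => ∑ j, I i j ω) P :=
    Integrable.of_eval fun i => integrable_finsetSum _ fun j _ => hI0 i j
  have hsum : ∫ ω, (fun i => ∑ j, I i j ω) ∂P = 0 := by
    ext i
    rw [eval_integral fun i => hII.eval i, integral_finsetSum _ fun j _ => hI0 i j]
    exact Finset.sum_eq_zero fun j _ => (hI i j).integral_eq_zero
      (hW.brownian j).toIsPreBrownianReal (hc.sq_int_sig i j) ht
  rw [integral_congr_ae hx, integral_add (f := fun ω => x0 ω + ∫ s in (0 : ℝ)..t,
      (c.A s *ᵥ x s ω + c.B s *ᵥ v s ω + c.Abar s *ᵥ z s))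
      ((hx0.integrable one_le_two).add hint) hII,
    integral_add (hx0.integrable one_le_two) hint, hsum, add_zero,
    ← intervalIntegral_integral_swap, intervalIntegral_congr_of_ae_Icc hmean ht]
  rw [Set.uIoc_of_le ht.1]
  refine hbi.mono_measure (Measure.prod_mono (Measure.restrict_mono
    (Set.Ioc_subset_Icc_self.trans (Set.Icc_subset_Icc_right ht.2)) le_rfl) le_rfl)

end Trajectories

/-! ### The first and second variation of the cost -/

section Cost

variable {Ω : Type*} [MeasurableSpace Ω] {P : Measure Ω} {n m : ℕ} {T : ℝ}
  {c : Coeffs n m} {z : ℝ → Fin n → ℝ}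

/-- A pair (control, state) for which the cost is finite. -/
structure IsL2Pair (P : Measure Ω) (T : ℝ) (v : ℝ → Ω → Fin m → ℝ) (x : ℝ → Ω → Fin n → ℝ) :
    Prop where
  control : MemLp (Function.uncurry v) 2 (timeMeasure P T)
  state : MemLp (Function.uncurry x) 2 (timeMeasure P T)
  terminal : MemLp (x T) 2 P

/-- The state-gradient of the running (at time `T`: terminal) cost. -/
def stateGrad (c : Coeffs n m) (z : ℝ → Fin n → ℝ) (t : ℝ) (y : Fin n → ℝ) : Fin n → ℝ :=
  c.Q t *ᵥ y + c.Qbar t *ᵥ (y - c.S t *ᵥ z t)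

/-- The derivative of the cost at the pair `(u, y)` in the direction `(w, d)`. For `z = 0` it is
bilinear in the two pairs, and equal to the second derivative of the cost. -/
noncomputable def costGrad (c : Coeffs n m) (P : Measure Ω) (T : ℝ) (z : ℝ → Fin n → ℝ)
    (u : ℝ → Ω → Fin m → ℝ) (y : ℝ → Ω → Fin n → ℝ) (w : ℝ → Ω → Fin m → ℝ)
    (d : ℝ → Ω → Fin n → ℝ) : ℝ :=
  (∫ p, d p.1 p.2 ⬝ᵥ stateGrad c z p.1 (y p.1 p.2) ∂(timeMeasure P T))
    + (∫ p, w p.1 p.2 ⬝ᵥ (c.R p.1 *ᵥ u p.1 p.2) ∂(timeMeasure P T))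
    + ∫ ω, d T ω ⬝ᵥ stateGrad c z T (y T ω) ∂P

/-- The part of the running (at time `T`: terminal) cost which depends on the state. -/
def stateCost (c : Coeffs n m) (z : ℝ → Fin n → ℝ) (t : ℝ) (y : Fin n → ℝ) : ℝ :=
  y ⬝ᵥ (c.Q t *ᵥ y) + (y - c.S t *ᵥ z t) ⬝ᵥ (c.Qbar t *ᵥ (y - c.S t *ᵥ z t))

lemma stateGrad_add (t : ℝ) (y d : Fin n → ℝ) :
    stateGrad c z t (y + d) = stateGrad c z t y + stateGrad c 0 t d := by
  simp only [stateGrad, Matrix.mulVec_add, Matrix.mulVec_sub, Pi.zero_apply, Matrix.mulVec_zero]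
  abel

lemma stateGrad_smul (t : ℝ) (a : ℝ) (d : Fin n → ℝ) :
    stateGrad c 0 t (a • d) = a • stateGrad c 0 t d := by
  simp [stateGrad, Matrix.mulVec_smul]

lemma stateGrad_eq (t : ℝ) (y : Fin n → ℝ) :
    stateGrad c z t y = (c.Q t + c.Qbar t) *ᵥ y - (c.Qbar t * c.S t) *ᵥ z t := by
  simp only [stateGrad, Matrix.mulVec_sub, Matrix.add_mulVec, Matrix.mulVec_mulVec]
  abel

namespace IsL2Pair

variable {v w : ℝ → Ω → Fin m → ℝ} {x d : ℝ → Ω → Fin n → ℝ}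

lemma add (h : IsL2Pair P T v x) (h' : IsL2Pair P T w d) :
    IsL2Pair P T (fun t ω => v t ω + w t ω) (fun t ω => x t ω + d t ω) :=
  ⟨h.control.add h'.control, h.state.add h'.state, h.terminal.add h'.terminal⟩

lemma smul (h : IsL2Pair P T v x) (a : ℝ) :
    IsL2Pair P T (fun t ω => a • v t ω) (fun t ω => a • x t ω) :=
  ⟨h.control.const_smul a, h.state.const_smul a, h.terminal.const_smul a⟩

end IsL2Pair

lemma dotProduct_mulVec_comm_of_isSymm {a : ℕ} {M : Matrix (Fin a) (Fin a) ℝ} (hM : M.IsSymm)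
    (x y : Fin a → ℝ) : x ⬝ᵥ (M *ᵥ y) = y ⬝ᵥ (M *ᵥ x) := by
  rw [Matrix.dotProduct_mulVec, ← Matrix.mulVec_transpose, hM.eq, dotProduct_comm]

lemma stateCost_add (hc : c.Standing T) {t : ℝ} (ht : t ∈ Set.Icc 0 T) (a b : Fin n → ℝ) :
    stateCost c z t (a + b) =
      stateCost c z t a + 2 * (b ⬝ᵥ stateGrad c z t a) + b ⬝ᵥ stateGrad c 0 t b := by
  have hsQ : (c.Q t).IsSymm := (hc.psd_Q t ht).isHermitian
  have hsQbar : (c.Qbar t).IsSymm := (hc.psd_Qbar t ht).isHermitian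
  have e1 : a + b - c.S t *ᵥ z t = (a - c.S t *ᵥ z t) + b := by abel
  have e2 := dotProduct_mulVec_comm_of_isSymm hsQ a b
  have e3 := dotProduct_mulVec_comm_of_isSymm hsQbar (a - c.S t *ᵥ z t) b
  simp only [stateCost, stateGrad, e1]
  generalize a - c.S t *ᵥ z t = k at *
  simp only [Matrix.mulVec_add, add_dotProduct, dotProduct_add, Pi.zero_apply,
    Matrix.mulVec_zero, sub_zero]
  rw [e2, e3]
  ring

lemma costGrad_smul_right (a : ℝ) {u w : ℝ → Ω → Fin m → ℝ} {y d : ℝ → Ω → Fin n → ℝ} :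
    costGrad c P T z u y (fun t ω => a • w t ω) (fun t ω => a • d t ω) =
      a * costGrad c P T z u y w d := by
  simp only [costGrad, smul_dotProduct, smul_eq_mul, mul_add, integral_const_mul]

lemma costGrad_smul_left (a : ℝ) {u w : ℝ → Ω → Fin m → ℝ} {y d : ℝ → Ω → Fin n → ℝ} :
    costGrad c P T 0 (fun t ω => a • u t ω) (fun t ω => a • y t ω) w d =
      a * costGrad c P T 0 u y w d := by
  simp only [costGrad, stateGrad_smul, Matrix.mulVec_smul, dotProduct_smul, smul_eq_mul, mul_add,
    integral_const_mul]

lemma costGrad_congr_right {u w w' : ℝ → Ω → Fin m → ℝ} {y d d' : ℝ → Ω → Fin n → ℝ}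
    (hw : Function.uncurry w =ᵐ[timeMeasure P T] Function.uncurry w')
    (hd : Function.uncurry d =ᵐ[timeMeasure P T] Function.uncurry d') (hdT : d T =ᵐ[P] d' T) :
    costGrad c P T z u y w d = costGrad c P T z u y w' d' := by
  simp only [costGrad]
  refine congrArg₂ _ (congrArg₂ _ ?_ ?_) ?_
  · refine integral_congr_ae ?_
    filter_upwards [hd] with p h1
    simp only [Function.uncurry] at h1
    rw [h1]
  · refine integral_congr_ae ?_
    filter_upwards [hw] with p h1
    simp only [Function.uncurry] at h1
    rw [h1]
  · refine integral_congr_ae ?_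
    filter_upwards [hdT] with p h1
    rw [h1]

lemma costGrad_congr_left {u u' w : ℝ → Ω → Fin m → ℝ} {y y' d : ℝ → Ω → Fin n → ℝ}
    (hu : Function.uncurry u =ᵐ[timeMeasure P T] Function.uncurry u')
    (hy : Function.uncurry y =ᵐ[timeMeasure P T] Function.uncurry y') (hyT : y T =ᵐ[P] y' T) :
    costGrad c P T z u y w d = costGrad c P T z u' y' w d := by
  simp only [costGrad]
  refine congrArg₂ _ (congrArg₂ _ ?_ ?_) ?_
  · refine integral_congr_ae ?_
    filter_upwards [hy] with p h1
    simp only [Function.uncurry] at h1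
    rw [h1]
  · refine integral_congr_ae ?_
    filter_upwards [hu] with p h1
    simp only [Function.uncurry] at h1
    rw [h1]
  · refine integral_congr_ae ?_
    filter_upwards [hyT] with p h1
    rw [h1]

variable [IsProbabilityMeasure P]

lemma memLp_mulVec_const {Ω : Type*} [MeasurableSpace Ω] {P : Measure Ω} {a b : ℕ}
    (M : Matrix (Fin a) (Fin b) ℝ) {x : Ω → Fin b → ℝ}
    (hx : MemLp x 2 P) : MemLp (fun ω => M *ᵥ x ω) 2 P :=
  (Matrix.mulVecLin M).toContinuousLinearMap.comp_memLp' hx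

lemma memLp_deviation (hc : c.Standing T) (hz : MemLp z 2 (volume.restrict (Set.Icc 0 T)))
    {y : ℝ → Ω → Fin n → ℝ} (hy : MemLp (Function.uncurry y) 2 (timeMeasure P T)) :
    MemLp (Function.uncurry fun t ω => y t ω - c.S t *ᵥ z t) 2 (timeMeasure P T) :=
  hy.sub (hc.bdd_S.memLp_process (memLp_const_process hz))

lemma memLp_stateGrad (hc : c.Standing T) (hz : MemLp z 2 (volume.restrict (Set.Icc 0 T)))
    {y : ℝ → Ω → Fin n → ℝ} (hy : MemLp (Function.uncurry y) 2 (timeMeasure P T)) :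
    MemLp (Function.uncurry fun t ω => stateGrad c z t (y t ω)) 2 (timeMeasure P T) := by
  have h1 := hc.bdd_Q.memLp_process hy
  have h2 := hc.bdd_Qbar.memLp_process (memLp_deviation hc hz hy)
  exact h1.add h2

lemma memLp_stateGrad_terminal {y : Ω → Fin n → ℝ} (hy : MemLp y 2 P) :
    MemLp (fun ω => stateGrad c z T (y ω)) 2 P := by
  have h1 := memLp_mulVec_const (c.Q T) hy
  have h2 := memLp_mulVec_const (c.Qbar T) (hy.sub (memLp_const (c.S T *ᵥ z T)))
  exact h1.add h2

lemma integrable_costGrad (hc : c.Standing T) (hz : MemLp z 2 (volume.restrict (Set.Icc 0 T)))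
    {u w : ℝ → Ω → Fin m → ℝ} {y d : ℝ → Ω → Fin n → ℝ} (h : IsL2Pair P T u y)
    (h' : IsL2Pair P T w d) :
    Integrable (fun p : ℝ × Ω => d p.1 p.2 ⬝ᵥ stateGrad c z p.1 (y p.1 p.2)) (timeMeasure P T) ∧
    Integrable (fun p : ℝ × Ω => w p.1 p.2 ⬝ᵥ (c.R p.1 *ᵥ u p.1 p.2)) (timeMeasure P T) ∧
    Integrable (fun ω => d T ω ⬝ᵥ stateGrad c z T (y T ω)) P :=
  ⟨integrable_dotProduct h'.state (memLp_stateGrad hc hz h.state),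
    integrable_dotProduct h'.control (hc.bdd_R.memLp_process h.control),
    integrable_dotProduct h'.terminal (memLp_stateGrad_terminal h.terminal)⟩

lemma costGrad_add_right (hc : c.Standing T) (hz : MemLp z 2 (volume.restrict (Set.Icc 0 T)))
    {u w w' : ℝ → Ω → Fin m → ℝ} {y d d' : ℝ → Ω → Fin n → ℝ} (h : IsL2Pair P T u y)
    (h1 : IsL2Pair P T w d) (h2 : IsL2Pair P T w' d') :
    costGrad c P T z u y (fun t ω => w t ω + w' t ω) (fun t ω => d t ω + d' t ω) =
      costGrad c P T z u y w d + costGrad c P T z u y w' d' := by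
  obtain ⟨a1, a2, a3⟩ := integrable_costGrad hc hz h h1
  obtain ⟨b1, b2, b3⟩ := integrable_costGrad hc hz h h2
  simp only [costGrad, add_dotProduct]
  rw [integral_add a3 b3, integral_add a1 b1, integral_add a2 b2]
  ring

/-- The derivative of the cost is affine in the base point. -/
lemma costGrad_add_left (hc : c.Standing T) (hz : MemLp z 2 (volume.restrict (Set.Icc 0 T)))
    {u w w' : ℝ → Ω → Fin m → ℝ} {y d d' : ℝ → Ω → Fin n → ℝ} (h : IsL2Pair P T u y)
    (h1 : IsL2Pair P T w d) (h2 : IsL2Pair P T w' d') :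
    costGrad c P T z (fun t ω => u t ω + w t ω) (fun t ω => y t ω + d t ω) w' d' =
      costGrad c P T z u y w' d' + costGrad c P T 0 w d w' d' := by
  obtain ⟨a1, a2, a3⟩ := integrable_costGrad hc hz h h2
  obtain ⟨b1, b2, b3⟩ := integrable_costGrad hc MemLp.zero h1 h2
  simp only [costGrad, stateGrad_add, Matrix.mulVec_add, dotProduct_add]
  rw [integral_add a3 b3, integral_add a1 b1, integral_add a2 b2]
  ring

lemma costGrad_congr_mean (hT : 0 ≤ T) {z' : ℝ → Fin n → ℝ} (hz : ∀ t ∈ Set.Icc 0 T, z t = z' t)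
    {u w : ℝ → Ω → Fin m → ℝ} {y d : ℝ → Ω → Fin n → ℝ} :
    costGrad c P T z u y w d = costGrad c P T z' u y w d := by
  simp only [costGrad, stateGrad, hz T ⟨hT, le_rfl⟩]
  congr 2
  refine integral_congr_ae ?_
  filter_upwards [IsBoundedCoeff.ae_mem quasiMeasurePreserving_time] with p hp
  rw [hz _ hp]

omit [IsProbabilityMeasure P] in
lemma dotProduct_stateGrad_nonneg (hc : c.Standing T) {t : ℝ} (ht : t ∈ Set.Icc 0 T)
    (x : Fin n → ℝ) : 0 ≤ x ⬝ᵥ stateGrad c 0 t x := by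
  have h1 := ((hc.psd_Q t ht).add (hc.psd_Qbar t ht)).dotProduct_mulVec_nonneg x
  simpa [stateGrad_eq] using h1

/-- The second derivative of the cost is coercive in the control. -/
lemma costGrad_self_ge (hT : 0 ≤ T) (hc : c.Standing T) {δ : ℝ}
    (hδ : ∀ t ∈ Set.Icc 0 T, (c.R t - δ • (1 : Matrix (Fin m) (Fin m) ℝ)).PosSemidef)
    {w : ℝ → Ω → Fin m → ℝ} {d : ℝ → Ω → Fin n → ℝ} (h : IsL2Pair P T w d) :
    δ * ∫ p, w p.1 p.2 ⬝ᵥ w p.1 p.2 ∂(timeMeasure P T) ≤ costGrad c P T 0 w d w d := by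
  obtain ⟨-, b2, -⟩ := integrable_costGrad hc MemLp.zero h h
  rw [costGrad, ← integral_const_mul]
  have h1 : 0 ≤ ∫ ω, d T ω ⬝ᵥ stateGrad c 0 T (d T ω) ∂P :=
    integral_nonneg fun ω => dotProduct_stateGrad_nonneg hc ⟨hT, le_rfl⟩ _
  have h0 : 0 ≤ ∫ p, d p.1 p.2 ⬝ᵥ stateGrad c 0 p.1 (d p.1 p.2) ∂(timeMeasure P T) := by
    refine integral_nonneg_of_ae ?_
    filter_upwards [IsBoundedCoeff.ae_mem quasiMeasurePreserving_time] with p hp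
    exact dotProduct_stateGrad_nonneg hc hp (d p.1 p.2)
  have h2 : ∫ p, δ * (w p.1 p.2 ⬝ᵥ w p.1 p.2) ∂(timeMeasure P T) ≤
      ∫ p, w p.1 p.2 ⬝ᵥ (c.R p.1 *ᵥ w p.1 p.2) ∂(timeMeasure P T) := by
    refine integral_mono_ae ((integrable_dotProduct h.control h.control).const_mul δ) b2 ?_
    filter_upwards [IsBoundedCoeff.ae_mem quasiMeasurePreserving_time] with p hp
    exact le_dotProduct_mulVec_of_coercive (hδ _ hp) (w p.1 p.2)
  linarith

lemma integrable_stateCost (hc : c.Standing T) (hz : MemLp z 2 (volume.restrict (Set.Icc 0 T)))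
    {u : ℝ → Ω → Fin m → ℝ} {y : ℝ → Ω → Fin n → ℝ} (h : IsL2Pair P T u y) :
    Integrable (fun p : ℝ × Ω => stateCost c z p.1 (y p.1 p.2)) (timeMeasure P T) ∧
    Integrable (fun ω => stateCost c z T (y T ω)) P := by
  have h1 := memLp_deviation hc hz h.state
  have h2 : MemLp (fun ω => y T ω - c.S T *ᵥ z T) 2 P := h.terminal.sub (memLp_const _)
  have h3 := integrable_dotProduct h.state (hc.bdd_Q.memLp_process h.state)
  have h4 := integrable_dotProduct h1 (hc.bdd_Qbar.memLp_process h1)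
  have h5 := integrable_dotProduct h.terminal (memLp_mulVec_const (c.Q T) h.terminal)
  have h6 := integrable_dotProduct h2 (memLp_mulVec_const (c.Qbar T) h2)
  exact ⟨h3.add h4, h5.add h6⟩

lemma cost_eq (hT : 0 ≤ T) (hc : c.Standing T) (hz : MemLp z 2 (volume.restrict (Set.Icc 0 T)))
    {u : ℝ → Ω → Fin m → ℝ} {y : ℝ → Ω → Fin n → ℝ} (h : IsL2Pair P T u y) :
    cost c P T z u y = 1 / 2 * ((∫ p, stateCost c z p.1 (y p.1 p.2) ∂(timeMeasure P T)) +
      (∫ p, u p.1 p.2 ⬝ᵥ (c.R p.1 *ᵥ u p.1 p.2) ∂(timeMeasure P T)) +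
      ∫ ω, stateCost c z T (y T ω) ∂P) := by
  obtain ⟨-, h2, -⟩ := integrable_costGrad hc hz h h
  obtain ⟨h1, -⟩ := integrable_stateCost hc hz h
  have h3 : Integrable (fun p : ℝ × Ω => stateCost c z p.1 (y p.1 p.2) +
    u p.1 p.2 ⬝ᵥ (c.R p.1 *ᵥ u p.1 p.2)) (timeMeasure P T) := h1.add h2
  have h4 : ∀ t ω, y t ω ⬝ᵥ (c.Q t *ᵥ y t ω) + u t ω ⬝ᵥ (c.R t *ᵥ u t ω) +
      (y t ω - c.S t *ᵥ z t) ⬝ᵥ (c.Qbar t *ᵥ (y t ω - c.S t *ᵥ z t)) =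
      stateCost c z t (y t ω) + u t ω ⬝ᵥ (c.R t *ᵥ u t ω) := fun t ω => by
    rw [stateCost]
    ring
  rw [cost, ← integral_add h1 h2]
  simp only [h4, ← mul_add, integral_const_mul]
  congr 2
  simp only [intervalIntegral.integral_of_le hT, ← integral_Icc_eq_integral_Ioc]
  exact (integral_prod_symm _ h3).symm

/-- The cost is quadratic: exact second order expansion. -/
lemma cost_add (hT : 0 ≤ T) (hc : c.Standing T) (hz : MemLp z 2 (volume.restrict (Set.Icc 0 T)))
    {u w : ℝ → Ω → Fin m → ℝ} {y d : ℝ → Ω → Fin n → ℝ} (h : IsL2Pair P T u y)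
    (h' : IsL2Pair P T w d) :
    cost c P T z (fun t ω => u t ω + w t ω) (fun t ω => y t ω + d t ω) =
      cost c P T z u y + costGrad c P T z u y w d + 1 / 2 * costGrad c P T 0 w d w d := by
  obtain ⟨δ, -, hδ⟩ := hc.coercive_R
  obtain ⟨a1, a2, a3⟩ := integrable_costGrad hc hz h h'
  obtain ⟨b1, b2, b3⟩ := integrable_costGrad hc MemLp.zero h' h'
  obtain ⟨-, d2, -⟩ := integrable_costGrad hc hz h h
  obtain ⟨e1, e3⟩ := integrable_stateCost hc hz h
  rw [cost_eq hT hc hz (h.add h'), cost_eq hT hc hz h, costGrad, costGrad]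
  have g1 : ∫ p, stateCost c z p.1 (y p.1 p.2 + d p.1 p.2) ∂(timeMeasure P T) =
      (∫ p, stateCost c z p.1 (y p.1 p.2) ∂(timeMeasure P T)) +
      2 * (∫ p, d p.1 p.2 ⬝ᵥ stateGrad c z p.1 (y p.1 p.2) ∂(timeMeasure P T)) +
      ∫ p, d p.1 p.2 ⬝ᵥ stateGrad c 0 p.1 (d p.1 p.2) ∂(timeMeasure P T) := by
    rw [← integral_const_mul, ← integral_add e1 (a1.const_mul 2), ← integral_add _ b1]
    · refine integral_congr_ae ?_
      filter_upwards [IsBoundedCoeff.ae_mem quasiMeasurePreserving_time] with p hp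
      exact stateCost_add hc hp _ _
    · exact e1.add (a1.const_mul 2)
  have g2 : ∫ ω, stateCost c z T (y T ω + d T ω) ∂P =
      (∫ ω, stateCost c z T (y T ω) ∂P) + 2 * (∫ ω, d T ω ⬝ᵥ stateGrad c z T (y T ω) ∂P) +
      ∫ ω, d T ω ⬝ᵥ stateGrad c 0 T (d T ω) ∂P := by
    rw [← integral_const_mul, ← integral_add e3 (a3.const_mul 2), ← integral_add _ b3]
    · exact integral_congr_ae (.of_forall fun ω => stateCost_add hc ⟨hT, le_rfl⟩ _ _)
    · exact e3.add (a3.const_mul 2)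
  have g3 : ∫ p, (u p.1 p.2 + w p.1 p.2) ⬝ᵥ (c.R p.1 *ᵥ (u p.1 p.2 + w p.1 p.2))
        ∂(timeMeasure P T) =
      (∫ p, u p.1 p.2 ⬝ᵥ (c.R p.1 *ᵥ u p.1 p.2) ∂(timeMeasure P T)) +
      2 * (∫ p, w p.1 p.2 ⬝ᵥ (c.R p.1 *ᵥ u p.1 p.2) ∂(timeMeasure P T)) +
      ∫ p, w p.1 p.2 ⬝ᵥ (c.R p.1 *ᵥ w p.1 p.2) ∂(timeMeasure P T) := by
    rw [← integral_const_mul, ← integral_add d2 (a2.const_mul 2), ← integral_add _ b2]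
    · refine integral_congr_ae ?_
      filter_upwards [IsBoundedCoeff.ae_mem quasiMeasurePreserving_time] with p hp
      simp only [Matrix.mulVec_add, add_dotProduct, dotProduct_add]
      rw [dotProduct_mulVec_comm_of_isSymm (isSymm_of_coercive (hδ _ hp)) (u p.1 p.2) (w p.1 p.2)]
      ring
    · exact d2.add (a2.const_mul 2)
  rw [g1, g2, g3]
  ring

end Cost

/-! ### First order conditions -/

section FirstOrder

variable {Ω : Type*} [MeasurableSpace Ω] {P : Measure Ω} {n m : ℕ} {T : ℝ}
  {c : Coeffs n m} {Φ Ψ : ℝ → Matrix (Fin n) (Fin n) ℝ}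
  {x0 : Ω → Fin n → ℝ} {W : ℝ≥0 → Ω → Fin n → ℝ} {z : ℝ → Fin n → ℝ}

namespace IsAdmissible

variable {v w : ℝ → Ω → Fin m → ℝ}

lemma add (hv : IsAdmissible P T x0 W v) (hw : IsAdmissible P T x0 W w) :
    IsAdmissible P T x0 W (fun t ω => v t ω + w t ω) :=
  ⟨fun t ht => (hv.adapted t ht).add (hw.adapted t ht), hv.memLp.add hw.memLp⟩

lemma smul (hv : IsAdmissible P T x0 W v) (a : ℝ) :
    IsAdmissible P T x0 W (fun t ω => a • v t ω) :=
  ⟨fun t ht => (hv.adapted t ht).const_smul a, hv.memLp.const_smul a⟩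

lemma sub (hv : IsAdmissible P T x0 W v) (hw : IsAdmissible P T x0 W w) :
    IsAdmissible P T x0 W (fun t ω => v t ω - w t ω) :=
  ⟨fun t ht => (hv.adapted t ht).sub (hw.adapted t ht), hv.memLp.sub hw.memLp⟩

end IsAdmissible

/-- The derivative of the cost at `(u, y)` vanishes in the direction of every admissible variation
of the control. -/
def IsCritical (c : Coeffs n m) (P : Measure Ω) (T : ℝ) (x0 : Ω → Fin n → ℝ)
    (W : ℝ≥0 → Ω → Fin n → ℝ) (Φ Ψ : ℝ → Matrix (Fin n) (Fin n) ℝ) (z : ℝ → Fin n → ℝ)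
    (u : ℝ → Ω → Fin m → ℝ) (y : ℝ → Ω → Fin n → ℝ) : Prop :=
  ∀ w, IsAdmissible P T x0 W w → costGrad c P T z u y w (response c Φ Ψ w) = 0

variable [IsProbabilityMeasure P] {u : ℝ → Ω → Fin m → ℝ} {y : ℝ → Ω → Fin n → ℝ}

lemma isAdmissible_const {w : ℝ → Fin m → ℝ} (hw : MemLp w 2 (volume.restrict (Set.Icc 0 T))) :
    IsAdmissible P T x0 W (fun t _ => w t) :=
  ⟨fun _ _ => measurable_const, memLp_const_process hw⟩

omit [IsProbabilityMeasure P] in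
lemma IsTrajectory.isL2Pair (hT : 0 ≤ T) (hu : MemLp (Function.uncurry u) 2 (timeMeasure P T))
    (h : IsTrajectory c P T x0 W z u y) : IsL2Pair P T u y :=
  ⟨hu, h.memLp, h.memLp_time T ⟨hT, le_rfl⟩⟩

lemma isL2Pair_response (hT : 0 ≤ T) (hc : c.Standing T) (hF : IsFundamental T c.A Φ Ψ)
    {w : ℝ → Ω → Fin m → ℝ} (hw : MemLp (Function.uncurry w) 2 (timeMeasure P T)) :
    IsL2Pair P T w (response c Φ Ψ w) :=
  ⟨hw, memLp_response hT hc hF hw, memLp_response_time hT hc hF hw ⟨hT, le_rfl⟩⟩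

lemma memLp_two_integrableOn {x : ℝ → Fin n → ℝ}
    (hx : MemLp x 2 (volume.restrict (Set.Icc 0 T))) : IntegrableOn x (Set.Icc 0 T) :=
  hx.integrable one_le_two

/-- The first order condition is necessary and, the cost being convex, sufficient for
optimality. -/
lemma optimal_iff_isCritical (hT : 0 ≤ T) (hc : c.Standing T) (hF : IsFundamental T c.A Φ Ψ)
    (hW : IsWiener W P) (hz : MemLp z 2 (volume.restrict (Set.Icc 0 T)))
    (hu : IsAdmissible P T x0 W u) (hy : IsTrajectory c P T x0 W z u y) :
    (∀ v, IsAdmissible P T x0 W v → ∀ x, IsTrajectory c P T x0 W z v x →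
      cost c P T z u y ≤ cost c P T z v x) ↔ IsCritical c P T x0 W Φ Ψ z u y := by
  have hz1 := memLp_two_integrableOn hz
  have huy := hy.isL2Pair hT hu.memLp
  constructor
  · intro hopt w hw
    have hr := isL2Pair_response hT hc hF hw.memLp
    have h1 : ∀ ε : ℝ, 0 ≤ 1 / 2 * costGrad c P T 0 w (response c Φ Ψ w) w (response c Φ Ψ w) *
        (ε * ε) + costGrad c P T z u y w (response c Φ Ψ w) * ε + 0 := by
      intro ε
      have h2 := hopt _ (hu.add (hw.smul ε)) _
        (hy.add_response hT hc hF hz1 hu.memLp (hw.smul ε).memLp)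
      simp only [response_smul] at h2
      rw [cost_add hT hc hz huy (hr.smul ε), costGrad_smul_right, costGrad_smul_right,
        costGrad_smul_left] at h2
      linarith
    -- a quadratic polynomial in `ε` which is minimal at `0` has no linear term
    have h3 := discrim_le_zero h1
    simp only [discrim, mul_zero, sub_zero] at h3
    exact pow_eq_zero_iff two_ne_zero |>.1 (le_antisymm h3 (sq_nonneg _))
  · intro hcrit v hv x hx
    obtain ⟨δ, hδ, hR⟩ := hc.coercive_R
    have hw := hv.sub hu
    have hr := isL2Pair_response hT hc hF hw.memLp
    obtain ⟨h1, h2⟩ := hy.eq_add_response hT hc hF hW hz1 hu.memLp hv.memLp hx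
    have h3 := costGrad_self_ge hT hc hR hr
    have h4 : 0 ≤ ∫ p, (v p.1 p.2 - u p.1 p.2) ⬝ᵥ (v p.1 p.2 - u p.1 p.2) ∂(timeMeasure P T) :=
      integral_nonneg fun p => Finset.sum_nonneg fun _ _ => mul_self_nonneg _
    have h5 := cost_add hT hc hz huy hr
    rw [hcrit _ hw] at h5
    have h6 : cost c P T z v x = cost c P T z (fun t ω => u t ω + (v t ω - u t ω))
        (fun t ω => y t ω + response c Φ Ψ (fun t ω => v t ω - u t ω) t ω) := by
      have hvx := hx.isL2Pair hT hv.memLp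
      rw [cost_eq hT hc hz hvx, cost_eq hT hc hz (huy.add hr)]
      refine congrArg _ (congrArg₂ _ (congrArg₂ _ ?_ ?_) ?_)
      · refine integral_congr_ae ?_
        filter_upwards [h1] with p hp
        simp only [Function.uncurry] at hp
        rw [hp]
      · simp
      · refine integral_congr_ae ?_
        filter_upwards [h2 T ⟨hT, le_rfl⟩] with ω hω
        rw [hω]
    rw [h6, h5]
    nlinarith [mul_nonneg hδ.le h4]

/-- Two critical pairs for the same mean field term have the same control. -/
lemma IsCritical.ae_eq (hT : 0 ≤ T) (hc : c.Standing T) (hF : IsFundamental T c.A Φ Ψ)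
    (hW : IsWiener W P) (hz : MemLp z 2 (volume.restrict (Set.Icc 0 T)))
    {u' : ℝ → Ω → Fin m → ℝ} {y' : ℝ → Ω → Fin n → ℝ}
    (hu : IsAdmissible P T x0 W u) (hy : IsTrajectory c P T x0 W z u y)
    (h : IsCritical c P T x0 W Φ Ψ z u y)
    (hu' : IsAdmissible P T x0 W u') (hy' : IsTrajectory c P T x0 W z u' y')
    (h' : IsCritical c P T x0 W Φ Ψ z u' y') :
    Function.uncurry u' =ᵐ[timeMeasure P T] Function.uncurry u := by
  obtain ⟨δ, hδ, hR⟩ := hc.coercive_R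
  have hw := hu'.sub hu
  have hr := isL2Pair_response hT hc hF hw.memLp
  obtain ⟨h1, h2⟩ := hy.eq_add_response hT hc hF hW (memLp_two_integrableOn hz) hu.memLp
    hu'.memLp hy'
  have h3 := costGrad_self_ge hT hc hR hr
  have h4 := h' _ hw
  rw [costGrad_congr_left (u' := fun t ω => u t ω + (u' t ω - u t ω)) (by simp) h1
    (h2 T ⟨hT, le_rfl⟩), costGrad_add_left hc hz (hy.isL2Pair hT hu.memLp) hr hr, h _ hw,
    zero_add] at h4
  rw [h4] at h3
  have h5 : ∀ p : ℝ × Ω, 0 ≤ (u' p.1 p.2 - u p.1 p.2) ⬝ᵥ (u' p.1 p.2 - u p.1 p.2) := fun p =>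
    Finset.sum_nonneg fun _ _ => mul_self_nonneg _
  have h6 : ∫ p, (u' p.1 p.2 - u p.1 p.2) ⬝ᵥ (u' p.1 p.2 - u p.1 p.2) ∂(timeMeasure P T) = 0 :=
    le_antisymm (nonpos_of_mul_nonpos_right h3 hδ) (integral_nonneg h5)
  rw [integral_eq_zero_iff_of_nonneg h5 (integrable_dotProduct hw.memLp hw.memLp)] at h6
  filter_upwards [h6] with p hp
  exact sub_eq_zero.1 (dotProduct_self_eq_zero.1 hp)

end FirstOrder

/-! ### The mean of a critical pair -/

section Mean

variable {Ω : Type*} [MeasurableSpace Ω] {P : Measure Ω} [IsProbabilityMeasure P] {n m : ℕ} {T : ℝ}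
  {c : Coeffs n m} {Φ Ψ : ℝ → Matrix (Fin n) (Fin n) ℝ}
  {x0 : Ω → Fin n → ℝ} {W : ℝ≥0 → Ω → Fin n → ℝ} {z : ℝ → Fin n → ℝ}
  {u : ℝ → Ω → Fin m → ℝ} {y : ℝ → Ω → Fin n → ℝ}

lemma integral_dotProduct_const {Ω : Type*} [MeasurableSpace Ω] {P : Measure Ω} {a : ℕ}
    (d : Fin a → ℝ) {x : Ω → Fin a → ℝ} (hx : Integrable x P) :
    ∫ ω, d ⬝ᵥ x ω ∂P = d ⬝ᵥ ∫ ω, x ω ∂P := by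
  simp only [dotProduct]
  rw [integral_finsetSum _ fun i _ => (hx.eval i).const_mul _]
  simp only [integral_const_mul, eval_integral hx.eval]

lemma integrable_mulVec {Ω : Type*} [MeasurableSpace Ω] {P : Measure Ω} {a b : ℕ}
    (M : Matrix (Fin a) (Fin b) ℝ) {x : Ω → Fin b → ℝ}
    (hx : Integrable x P) : Integrable (fun ω => M *ᵥ x ω) P :=
  (Matrix.mulVecLin M).toContinuousLinearMap.integrable_comp hx

lemma integral_stateGrad (t : ℝ) {x : Ω → Fin n → ℝ} (hx : Integrable x P) :
    ∫ ω, stateGrad c z t (x ω) ∂P = stateGrad c z t (∫ ω, x ω ∂P) := by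
  simp only [stateGrad_eq]
  have h1 := integrable_mulVec (c.Q t + c.Qbar t) hx
  rw [integral_sub h1 (integrable_const _), integral_mulVec _ hx]
  simp

lemma integrable_stateGrad (t : ℝ) {x : Ω → Fin n → ℝ} (hx : Integrable x P) :
    Integrable (fun ω => stateGrad c z t (x ω)) P := by
  simp only [stateGrad_eq]
  have h1 := integrable_mulVec (c.Q t + c.Qbar t) hx
  exact h1.sub (integrable_const _)

/-- In deterministic directions, the derivative of the cost only involves the means. -/
lemma costGrad_const (hc : c.Standing T) (hz : MemLp z 2 (volume.restrict (Set.Icc 0 T)))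
    (h : IsL2Pair P T u y) {w : ℝ → Fin m → ℝ} {d : ℝ → Fin n → ℝ}
    (hw : MemLp w 2 (volume.restrict (Set.Icc 0 T)))
    (hd : MemLp d 2 (volume.restrict (Set.Icc 0 T))) :
    costGrad c P T z u y (fun t _ => w t) (fun t _ => d t) =
      (∫ t in Set.Icc 0 T, d t ⬝ᵥ stateGrad c z t (∫ ω, y t ω ∂P)) +
      (∫ t in Set.Icc 0 T, w t ⬝ᵥ (c.R t *ᵥ ∫ ω, u t ω ∂P)) +
      d T ⬝ᵥ stateGrad c z T (∫ ω, y T ω ∂P) := by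
  have hyi : Integrable (Function.uncurry y) (timeMeasure P T) := h.state.integrable one_le_two
  have hui : Integrable (Function.uncurry u) (timeMeasure P T) := h.control.integrable one_le_two
  have hyT : Integrable (y T) P := h.terminal.integrable one_le_two
  rw [costGrad, integral_dotProduct_const _ (integrable_stateGrad T hyT), integral_stateGrad _ hyT]
  congr 2
  · refine (integral_prod _ (integrable_dotProduct (memLp_const_process hd)
      (memLp_stateGrad hc hz h.state))).trans (integral_congr_ae ?_)
    filter_upwards [hyi.prod_right_ae] with t ht
    simp only [Function.uncurry_apply_pair] at ht ⊢
    rw [integral_dotProduct_const _ (integrable_stateGrad t ht), integral_stateGrad t ht]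
  · refine (integral_prod _ (integrable_dotProduct (memLp_const_process hw)
      (hc.bdd_R.memLp_process h.control))).trans (integral_congr_ae ?_)
    filter_upwards [hui.prod_right_ae] with t ht
    simp only [Function.uncurry_apply_pair] at ht ⊢
    rw [integral_dotProduct_const _ (integrable_mulVec _ ht), integral_mulVec _ ht]

lemma HasACDeriv.memLp (hT : 0 ≤ T) {x g : ℝ → Fin n → ℝ} (hx : HasACDeriv T x g) :
    MemLp x 2 (volume.restrict (Set.Icc 0 T)) := by
  obtain ⟨K, hK⟩ := isCompact_Icc.exists_bound_of_continuousOn (hx.continuousOn hT)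
  refine MemLp.of_bound ((hx.continuousOn hT).aestronglyMeasurable measurableSet_Icc) K ?_
  filter_upwards [ae_restrict_mem measurableSet_Icc] with t ht using hK t ht

/-- Along a critical pair, the mean of the control is given by the adjoint state of the mean
trajectory: it suffices to test with deterministic variations of the control. -/
lemma IsCritical.exists_mean_adjoint (hT : 0 ≤ T) (hc : c.Standing T)
    (hF : IsFundamental T c.A Φ Ψ) (hz : MemLp z 2 (volume.restrict (Set.Icc 0 T)))
    (h : IsL2Pair P T u y) (hcrit : IsCritical c P T x0 W Φ Ψ z u y) :
    ∃ p : ℝ → Fin n → ℝ, p T = stateGrad c z T (∫ ω, y T ω ∂P) ∧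
      HasACDeriv T p (fun t => -((c.A t)ᵀ *ᵥ p t + stateGrad c z t (∫ ω, y t ω ∂P))) ∧
      ∀ᵐ t ∂(volume.restrict (Set.Icc 0 T)),
        c.R t *ᵥ (∫ ω, u t ω ∂P) + (c.B t)ᵀ *ᵥ p t = 0 := by
  have hy2 := memLp_mean h.state
  have hu2 := memLp_mean h.control
  have hf : MemLp (fun t => stateGrad c z t (∫ ω, y t ω ∂P)) 2 (volume.restrict (Set.Icc 0 T)) := by
    have h1 := (hc.bdd_Q.add hc.bdd_Qbar).memLp_mulVec (.id _) hy2
    have h2 := (hc.bdd_Qbar.mul hc.bdd_S).memLp_mulVec (.id _) hz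
    simp only [stateGrad_eq]
    exact h1.sub h2
  obtain ⟨p, hpT, hp⟩ := hF.exists_adjoint hT (memLp_two_integrableOn hf)
    (stateGrad c z T (∫ ω, y T ω ∂P))
  refine ⟨p, hpT, hp, ?_⟩
  have hRu : MemLp (fun t => c.R t *ᵥ ∫ ω, u t ω ∂P) 2 (volume.restrict (Set.Icc 0 T)) :=
    hc.bdd_R.memLp_mulVec (.id _) hu2
  -- by duality the derivative in direction `w` is `∫ w · (R 𝔼[u] + Bᵀ p)`: take the factor for `w`
  set w : ℝ → Fin m → ℝ := fun t => c.R t *ᵥ (∫ ω, u t ω ∂P) + (c.B t)ᵀ *ᵥ p t with hwdef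
  have hw : MemLp w 2 (volume.restrict (Set.Icc 0 T)) := by
    have h1 := hc.bdd_B.transpose.memLp_mulVec (.id _) (hp.memLp hT)
    exact hRu.add h1
  have hBw := hc.bdd_B.integrableOn_mulVec (memLp_two_integrableOn hw)
  have hd := hF.hasACDeriv_duhamel hT hBw
  obtain ⟨h1, h2⟩ := dotProduct_terminal_eq hT (duhamel_zero _ _ _) hd hp
  have h3 := hcrit _ (isAdmissible_const hw)
  have h4 := costGrad_const hc hz h hw (hd.memLp hT)
  have h5 : response c Φ Ψ (fun t (_ : Ω) => w t) =
      fun t _ => duhamel Φ Ψ (fun s => c.B s *ᵥ w s) t := rfl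
  have hi1 := integrable_dotProduct (hd.memLp hT) hf
  have hi2 := integrable_dotProduct hw hRu
  have hi3 : Integrable (fun t => duhamel Φ Ψ (fun s => c.B s *ᵥ w s) t ⬝ᵥ
      stateGrad c z t (∫ ω, y t ω ∂P) + w t ⬝ᵥ (c.R t *ᵥ ∫ ω, u t ω ∂P))
      (volume.restrict (Set.Icc 0 T)) := hi1.add hi2
  rw [h5, h4, ← hpT, dotProduct_comm _ (p T), h2, ← integral_add hi1 hi2,
    ← integral_add hi3 h1] at h3
  have h6 : ∫ t in Set.Icc 0 T, w t ⬝ᵥ w t = 0 := by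
    refine Eq.trans (integral_congr_ae (.of_forall fun t => ?_)) h3
    beta_reduce
    have e1 : p t ⬝ᵥ (c.B t *ᵥ w t) = w t ⬝ᵥ ((c.B t)ᵀ *ᵥ p t) := by
      rw [Matrix.dotProduct_mulVec, ← Matrix.mulVec_transpose, dotProduct_comm]
    have e2 : w t ⬝ᵥ w t = w t ⬝ᵥ (c.R t *ᵥ (∫ ω, u t ω ∂P)) + w t ⬝ᵥ ((c.B t)ᵀ *ᵥ p t) := by
      conv_lhs => rw [hwdef]
      rw [← dotProduct_add]
    rw [e1, e2, dotProduct_comm _ (duhamel _ _ _ _)]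
    ring
  have h7 : ∀ t, 0 ≤ w t ⬝ᵥ w t := fun t => Finset.sum_nonneg fun _ _ => mul_self_nonneg _
  rw [integral_eq_zero_iff_of_nonneg h7 (integrable_dotProduct hw hw)] at h6
  filter_upwards [h6] with t ht
  exact dotProduct_self_eq_zero.1 ht

end Mean

/-! ### Existence of a critical pair for a frozen mean field term -/

section LaxMilgram

variable {V : Type*} [NormedAddCommGroup V] [InnerProductSpace ℝ V]

/-- A bilinear form which is bounded by the sum of the squared norms is bounded: scale both
arguments to the unit sphere. -/
lemma abs_bilin_le_of_le_add_sq (B : V →ₗ[ℝ] V →ₗ[ℝ] ℝ) {K : ℝ}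
    (hB : ∀ x y, |B x y| ≤ K * (‖x‖ ^ 2 + ‖y‖ ^ 2)) (x y : V) :
    |B x y| ≤ 2 * K * ‖x‖ * ‖y‖ := by
  rcases eq_or_ne x 0 with rfl | hx
  · simp
  rcases eq_or_ne y 0 with rfl | hy
  · simp
  have hx' : 0 < ‖x‖ := norm_pos_iff.2 hx
  have hy' : 0 < ‖y‖ := norm_pos_iff.2 hy
  have h := hB (‖x‖⁻¹ • x) (‖y‖⁻¹ • y)
  simp only [map_smul, LinearMap.smul_apply, smul_eq_mul, norm_smul, norm_inv, norm_norm, abs_mul,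
    abs_inv, abs_norm, inv_mul_cancel₀ hx'.ne', inv_mul_cancel₀ hy'.ne'] at h
  rw [← mul_assoc, ← mul_inv, inv_mul_le_iff₀ (by positivity)] at h
  linarith

lemma abs_linear_le_of_le_add_sq (l : V →ₗ[ℝ] ℝ) {K : ℝ}
    (hl : ∀ x, |l x| ≤ K * (1 + ‖x‖ ^ 2)) (x : V) : |l x| ≤ 2 * K * ‖x‖ := by
  rcases eq_or_ne x 0 with rfl | hx
  · simp
  have hx' : 0 < ‖x‖ := norm_pos_iff.2 hx
  have h := hl (‖x‖⁻¹ • x)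
  simp only [map_smul, smul_eq_mul, norm_smul, norm_inv, norm_norm, abs_mul,
    abs_inv, abs_norm, inv_mul_cancel₀ hx'.ne'] at h
  rw [inv_mul_le_iff₀ (by positivity)] at h
  linarith

/-- The Lax–Milgram theorem, as a statement on the solvability of a variational equation. -/
lemma exists_forall_bilin_eq [CompleteSpace V] (B : V →ₗ[ℝ] V →ₗ[ℝ] ℝ) (l : V →ₗ[ℝ] ℝ) {K δ : ℝ}
    (hδ : 0 < δ) (hB : ∀ x y, |B x y| ≤ K * (‖x‖ ^ 2 + ‖y‖ ^ 2))
    (hl : ∀ x, |l x| ≤ K * (1 + ‖x‖ ^ 2)) (hBδ : ∀ x, δ * ‖x‖ ^ 2 ≤ B x x) :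
    ∃ x, ∀ y, B x y = l y := by
  let B' : V →L[ℝ] V →L[ℝ] ℝ := B.mkContinuous₂ (2 * K) (abs_bilin_le_of_le_add_sq B hB)
  let l' : V →L[ℝ] ℝ := l.mkContinuous (2 * K) (abs_linear_le_of_le_add_sq l hl)
  have hco : IsCoercive B' := ⟨δ, hδ, fun x => by
    have := hBδ x
    rwa [pow_two, ← mul_assoc] at this⟩
  refine ⟨hco.continuousLinearEquivOfBilin.symm ((InnerProductSpace.toDual ℝ V).symm l'),
    fun y => ?_⟩
  have h1 := hco.continuousLinearEquivOfBilin_apply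
    (hco.continuousLinearEquivOfBilin.symm ((InnerProductSpace.toDual ℝ V).symm l')) y
  rw [ContinuousLinearEquiv.apply_symm_apply, InnerProductSpace.toDual_symm_apply] at h1
  exact h1.symm

end LaxMilgram

section Existence

variable {Ω : Type*} [MeasurableSpace Ω] {P : Measure Ω} [IsProbabilityMeasure P] {n m : ℕ} {T : ℝ}
  {c : Coeffs n m} {Φ Ψ : ℝ → Matrix (Fin n) (Fin n) ℝ}
  {x0 : Ω → Fin n → ℝ} {W : ℝ≥0 → Ω → Fin n → ℝ} {z : ℝ → Fin n → ℝ}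

lemma abs_integral_dotProduct_le {α : Type*} [MeasurableSpace α] {ν : Measure α} {a : ℕ}
    {f g : α → Fin a → ℝ} (hf : MemLp f 2 ν) (hg : MemLp g 2 ν) :
    |∫ p, f p ⬝ᵥ g p ∂ν| ≤ a * ((∫ p, ‖f p‖ ^ 2 ∂ν) + ∫ p, ‖g p‖ ^ 2 ∂ν) := by
  have h1 := hf.integrable_norm_pow two_ne_zero
  have h2 := hg.integrable_norm_pow two_ne_zero
  rw [← integral_add h1 h2, ← integral_const_mul]
  refine abs_integral_le_integral_abs.trans (integral_mono (integrable_dotProduct hf hg).abs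
    ((h1.add h2).const_mul _) fun p => (abs_dotProduct_le _ _).trans ?_)
  refine mul_le_mul_of_nonneg_left ?_ (Nat.cast_nonneg a)
  nlinarith [sq_nonneg (‖f p‖ - ‖g p‖), sq_nonneg (‖f p‖ + ‖g p‖)]

/-- Almost sure equality of the paths on `[0, T]` gives the two equalities that `costGrad` sees:
`dt ⊗ P`-almost everywhere, and almost surely at the horizon. -/
lemma ae_eq_of_ae_forall_mem {E : Type*} (hT : 0 ≤ T) {f g : ℝ → Ω → E}
    (h : ∀ᵐ ω ∂P, ∀ t ∈ Set.Icc 0 T, f t ω = g t ω) :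
    Function.uncurry f =ᵐ[timeMeasure P T] Function.uncurry g ∧ f T =ᵐ[P] g T := by
  refine ⟨?_, ?_⟩
  · filter_upwards [ae_timeMeasure_of_ae h] with p hp using hp.2 p.1 hp.1
  · filter_upwards [h] with ω hω using hω T ⟨hT, le_rfl⟩

/-- The derivative of the cost in the direction of the control variation `w`. -/
noncomputable def dirGrad (c : Coeffs n m) (P : Measure Ω) (T : ℝ)
    (Φ Ψ : ℝ → Matrix (Fin n) (Fin n) ℝ) (z : ℝ → Fin n → ℝ) (u : ℝ → Ω → Fin m → ℝ)
    (y : ℝ → Ω → Fin n → ℝ) (w : ℝ → Ω → Fin m → ℝ) : ℝ :=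
  costGrad c P T z u y w (response c Φ Ψ w)

lemma dirGrad_congr_right (hT : 0 ≤ T) {u w w' : ℝ → Ω → Fin m → ℝ} {y : ℝ → Ω → Fin n → ℝ}
    (hw : Function.uncurry w =ᵐ[timeMeasure P T] Function.uncurry w') :
    dirGrad c P T Φ Ψ z u y w = dirGrad c P T Φ Ψ z u y w' := by
  obtain ⟨h1, h2⟩ := ae_eq_of_ae_forall_mem hT (response_congr (c := c) (Φ := Φ) (Ψ := Ψ) hw)
  exact costGrad_congr_right hw h1 h2

lemma dirGrad_congr_left (hT : 0 ≤ T) {u u' w : ℝ → Ω → Fin m → ℝ}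
    (hu : Function.uncurry u =ᵐ[timeMeasure P T] Function.uncurry u') :
    dirGrad c P T Φ Ψ z u (response c Φ Ψ u) w = dirGrad c P T Φ Ψ z u' (response c Φ Ψ u') w := by
  obtain ⟨h1, h2⟩ := ae_eq_of_ae_forall_mem hT (response_congr (c := c) (Φ := Φ) (Ψ := Ψ) hu)
  exact costGrad_congr_left hu h1 h2

omit [IsProbabilityMeasure P] in
lemma dirGrad_smul_right (a : ℝ) {u w : ℝ → Ω → Fin m → ℝ} {y : ℝ → Ω → Fin n → ℝ} :
    dirGrad c P T Φ Ψ z u y (fun t ω => a • w t ω) = a * dirGrad c P T Φ Ψ z u y w := by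
  have h : response c Φ Ψ (fun t ω => a • w t ω) = fun t ω => a • response c Φ Ψ w t ω := by
    ext1 t
    ext1 ω
    exact response_smul a w t ω
  rw [dirGrad, h, costGrad_smul_right, dirGrad]

omit [IsProbabilityMeasure P] in
lemma dirGrad_smul_left (a : ℝ) {u w : ℝ → Ω → Fin m → ℝ} :
    dirGrad c P T Φ Ψ 0 (fun t ω => a • u t ω) (response c Φ Ψ fun t ω => a • u t ω) w =
      a * dirGrad c P T Φ Ψ 0 u (response c Φ Ψ u) w := by
  have h : response c Φ Ψ (fun t ω => a • u t ω) = fun t ω => a • response c Φ Ψ u t ω := by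
    ext1 t
    ext1 ω
    exact response_smul a u t ω
  rw [dirGrad, h, costGrad_smul_left, dirGrad]

variable (hT : 0 ≤ T) (hc : c.Standing T) (hF : IsFundamental T c.A Φ Ψ)
include hT hc hF

lemma dirGrad_add_right (hz : MemLp z 2 (volume.restrict (Set.Icc 0 T)))
    {u w w' : ℝ → Ω → Fin m → ℝ} {y : ℝ → Ω → Fin n → ℝ} (h : IsL2Pair P T u y)
    (hw : MemLp (Function.uncurry w) 2 (timeMeasure P T))
    (hw' : MemLp (Function.uncurry w') 2 (timeMeasure P T)) :
    dirGrad c P T Φ Ψ z u y (fun t ω => w t ω + w' t ω) =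
      dirGrad c P T Φ Ψ z u y w + dirGrad c P T Φ Ψ z u y w' := by
  obtain ⟨h1, h2⟩ := ae_eq_of_ae_forall_mem hT (response_add hT hc hF hw hw')
  exact (costGrad_congr_right (by rfl) h1 h2).trans (costGrad_add_right hc hz h
    (isL2Pair_response hT hc hF hw) (isL2Pair_response hT hc hF hw'))

lemma dirGrad_add_left {u u' w : ℝ → Ω → Fin m → ℝ}
    (hu : MemLp (Function.uncurry u) 2 (timeMeasure P T))
    (hu' : MemLp (Function.uncurry u') 2 (timeMeasure P T))
    (hw : MemLp (Function.uncurry w) 2 (timeMeasure P T)) :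
    dirGrad c P T Φ Ψ 0 (fun t ω => u t ω + u' t ω) (response c Φ Ψ fun t ω => u t ω + u' t ω) w =
      dirGrad c P T Φ Ψ 0 u (response c Φ Ψ u) w +
        dirGrad c P T Φ Ψ 0 u' (response c Φ Ψ u') w := by
  obtain ⟨h1, h2⟩ := ae_eq_of_ae_forall_mem hT (response_add hT hc hF hu hu')
  exact (costGrad_congr_left (by rfl) h1 h2).trans (costGrad_add_left hc MemLp.zero
    (isL2Pair_response hT hc hF hu) (isL2Pair_response hT hc hF hu')
    (isL2Pair_response hT hc hF hw))

/-- The derivative of the cost is bounded in the direction. -/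
lemma exists_abs_dirGrad_le : ∃ K : ℝ, 0 ≤ K ∧ ∀ z : ℝ → Fin n → ℝ,
    MemLp z 2 (volume.restrict (Set.Icc 0 T)) →
    ∀ (u w : ℝ → Ω → Fin m → ℝ) (y : ℝ → Ω → Fin n → ℝ),
    IsL2Pair P T u y → MemLp (Function.uncurry w) 2 (timeMeasure P T) →
    |dirGrad c P T Φ Ψ z u y w| ≤ K * ((∫ p, ‖Function.uncurry w p‖ ^ 2 ∂(timeMeasure P T)) +
      ((∫ p, ‖stateGrad c z p.1 (y p.1 p.2)‖ ^ 2 ∂(timeMeasure P T)) +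
      (∫ p, ‖c.R p.1 *ᵥ u p.1 p.2‖ ^ 2 ∂(timeMeasure P T)) +
      ∫ ω, ‖stateGrad c z T (y T ω)‖ ^ 2 ∂P)) := by
  obtain ⟨C, hC, H⟩ := exists_response_bound (P := P) hT hc hF
  refine ⟨n + m + 2 * n * C, by positivity, fun z hz u w y h hw => ?_⟩
  obtain ⟨⟨h1, h2⟩, h3⟩ := H w hw
  obtain ⟨h4, h5⟩ := h3 T ⟨hT, le_rfl⟩
  have e1 := abs_integral_dotProduct_le h1 (memLp_stateGrad hc hz h.state)
  have e2 := abs_integral_dotProduct_le hw (hc.bdd_R.memLp_process h.control)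
  have e3 := abs_integral_dotProduct_le h4 (memLp_stateGrad_terminal (T := T) (c := c) (z := z)
    h.terminal)
  simp only [Function.uncurry_def] at e1 e2 e3 h2 h5 ⊢
  have f1 : 0 ≤ ∫ p, ‖w p.1 p.2‖ ^ 2 ∂(timeMeasure P T) := integral_nonneg fun p => sq_nonneg _
  have f2 : 0 ≤ ∫ p, ‖stateGrad c z p.1 (y p.1 p.2)‖ ^ 2 ∂(timeMeasure P T) :=
    integral_nonneg fun p => sq_nonneg _
  have f3 : 0 ≤ ∫ p, ‖c.R p.1 *ᵥ u p.1 p.2‖ ^ 2 ∂(timeMeasure P T) :=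
    integral_nonneg fun p => sq_nonneg _
  have f4 : 0 ≤ ∫ ω, ‖stateGrad c z T (y T ω)‖ ^ 2 ∂P := integral_nonneg fun p => sq_nonneg _
  have hn : (0 : ℝ) ≤ n := Nat.cast_nonneg n
  have hm : (0 : ℝ) ≤ m := Nat.cast_nonneg m
  refine (abs_add_three _ _ _).trans ((add_le_add (add_le_add e1 e2) e3).trans ?_)
  generalize (∫ p, ‖w p.1 p.2‖ ^ 2 ∂(timeMeasure P T)) = a1 at *
  generalize (∫ p, ‖stateGrad c z p.1 (y p.1 p.2)‖ ^ 2 ∂(timeMeasure P T)) = a2 at *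
  generalize (∫ p, ‖c.R p.1 *ᵥ u p.1 p.2‖ ^ 2 ∂(timeMeasure P T)) = a3 at *
  generalize (∫ ω, ‖stateGrad c z T (y T ω)‖ ^ 2 ∂P) = a4 at *
  have g1 := mul_le_mul_of_nonneg_left h2 hn
  have g2 := mul_le_mul_of_nonneg_left h5 hn
  nlinarith [mul_nonneg hn f1, mul_nonneg hn f2, mul_nonneg hn f3, mul_nonneg hn f4,
    mul_nonneg hm f2, mul_nonneg hm f4, mul_nonneg (mul_nonneg hn hC) f2,
    mul_nonneg (mul_nonneg hn hC) f3, mul_nonneg (mul_nonneg hn hC) f4]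

/-- The second derivative of the cost is bounded. -/
lemma exists_abs_dirGrad_response_le : ∃ K : ℝ, 0 ≤ K ∧ ∀ u w : ℝ → Ω → Fin m → ℝ,
    MemLp (Function.uncurry u) 2 (timeMeasure P T) →
    MemLp (Function.uncurry w) 2 (timeMeasure P T) →
    |dirGrad c P T Φ Ψ 0 u (response c Φ Ψ u) w| ≤
      K * ((∫ p, ‖Function.uncurry u p‖ ^ 2 ∂(timeMeasure P T)) +
        ∫ p, ‖Function.uncurry w p‖ ^ 2 ∂(timeMeasure P T)) := by
  obtain ⟨C, hC, H⟩ := exists_response_bound (P := P) hT hc hF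
  obtain ⟨K, hK, HK⟩ := exists_abs_dirGrad_le (P := P) hT hc hF
  have hQ := hc.bdd_Q.add hc.bdd_Qbar
  obtain ⟨C1, hC1, H1⟩ := hQ.exists_integral_sq_mulVec_le (P := P)
  obtain ⟨C2, hC2, H2⟩ := hc.bdd_R.exists_integral_sq_mulVec_le (P := P)
  obtain ⟨C3, hC3, H3⟩ := hQ.exists_norm_mulVec_le
  refine ⟨K * (1 + (C1 * C + C2 + C3 ^ 2 * C)), by positivity, fun u w hu hw => ?_⟩
  obtain ⟨⟨h1, h2⟩, h3⟩ := H u hu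
  obtain ⟨h4, h5⟩ := h3 T ⟨hT, le_rfl⟩
  have e0 := HK 0 MemLp.zero u w _ (isL2Pair_response hT hc hF hu) hw
  have e1 := (H1 _ h1).trans (mul_le_mul_of_nonneg_left h2 hC1)
  have e2 := H2 _ hu
  have e3 : ∫ ω, ‖(c.Q T + c.Qbar T) *ᵥ response c Φ Ψ u T ω‖ ^ 2 ∂P ≤
      C3 ^ 2 * ∫ ω, ‖response c Φ Ψ u T ω‖ ^ 2 ∂P := by
    rw [← integral_const_mul]
    refine integral_mono ((memLp_mulVec_const _ h4).integrable_norm_pow two_ne_zero)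
      ((h4.integrable_norm_pow two_ne_zero).const_mul _) fun ω => ?_
    beta_reduce
    rw [← mul_pow]
    exact pow_le_pow_left₀ (norm_nonneg _) (H3 T ⟨hT, le_rfl⟩ _) 2
  have e3' := e3.trans (mul_le_mul_of_nonneg_left h5 (sq_nonneg C3))
  have f1 : 0 ≤ ∫ p, ‖Function.uncurry w p‖ ^ 2 ∂(timeMeasure P T) :=
    integral_nonneg fun p => sq_nonneg _
  simp only [stateGrad_eq, Pi.zero_apply, Matrix.mulVec_zero, sub_zero] at e0
  simp only [Function.uncurry_def] at e0 e1 e2 e3' f1 ⊢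
  refine e0.trans ?_
  rw [mul_assoc]
  refine mul_le_mul_of_nonneg_left ?_ hK
  have hM : 0 ≤ C1 * C + C2 + C3 ^ 2 * C := by positivity
  have f2 : 0 ≤ ∫ p, ‖u p.1 p.2‖ ^ 2 ∂(timeMeasure P T) := integral_nonneg fun p => sq_nonneg _
  nlinarith [mul_nonneg hM f1]

end Existence

section Existence

variable {Ω : Type*} [MeasurableSpace Ω] {P : Measure Ω} {n m : ℕ} {T : ℝ}
  {c : Coeffs n m} {Φ Ψ : ℝ → Matrix (Fin n) (Fin n) ℝ}
  {x0 : Ω → Fin n → ℝ} {W : ℝ≥0 → Ω → Fin n → ℝ} {z : ℝ → Fin n → ℝ}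

/-- The Hilbert space of square integrable `ℝᵐ`-valued processes, modulo equality `dt ⊗ P`-almost
everywhere. -/
abbrev ControlSpace (P : Measure Ω) (T : ℝ) (m : ℕ) : Type _ :=
  Lp (EuclideanSpace ℝ (Fin m)) 2 (timeMeasure P T)

/-- A representative of a class of processes. -/
noncomputable def procOf (h : ControlSpace P T m) : ℝ → Ω → Fin m → ℝ :=
  fun t ω => WithLp.ofLp (h (t, ω))

lemma memLp_procOf (h : ControlSpace P T m) :
    MemLp (Function.uncurry (procOf h)) 2 (timeMeasure P T) :=
  (PiLp.continuousLinearEquiv 2 ℝ fun _ : Fin m => ℝ).toContinuousLinearMap.comp_memLp' (Lp.memLp h)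

lemma procOf_add (h h' : ControlSpace P T m) :
    Function.uncurry (procOf (h + h')) =ᵐ[timeMeasure P T]
      Function.uncurry fun t ω => procOf h t ω + procOf h' t ω := by
  filter_upwards [Lp.coeFn_add h h'] with p hp
  simp only [Function.uncurry_def, procOf, Prod.mk.eta, hp, Pi.add_apply, WithLp.ofLp_add]

lemma procOf_smul (a : ℝ) (h : ControlSpace P T m) :
    Function.uncurry (procOf (a • h)) =ᵐ[timeMeasure P T]
      Function.uncurry fun t ω => a • procOf h t ω := by
  filter_upwards [Lp.coeFn_smul a h] with p hp
  simp only [Function.uncurry_def, procOf, Prod.mk.eta, hp, Pi.smul_apply, WithLp.ofLp_smul]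

lemma integral_procOf_dotProduct_self (h : ControlSpace P T m) :
    ∫ p, procOf h p.1 p.2 ⬝ᵥ procOf h p.1 p.2 ∂(timeMeasure P T) = ‖h‖ ^ 2 := by
  rw [← real_inner_self_eq_norm_sq, L2.inner_def]
  refine integral_congr_ae (.of_forall fun p => ?_)
  beta_reduce
  rw [real_inner_self_eq_norm_sq, EuclideanSpace.real_norm_sq_eq]
  simp only [procOf, dotProduct, pow_two]

lemma integral_norm_sq_procOf_le (h : ControlSpace P T m) :
    ∫ p, ‖Function.uncurry (procOf h) p‖ ^ 2 ∂(timeMeasure P T) ≤ ‖h‖ ^ 2 := by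
  rw [← integral_procOf_dotProduct_self]
  have h1 := memLp_procOf h
  refine integral_mono (h1.integrable_norm_pow two_ne_zero) (integrable_dotProduct h1 h1)
    fun p => ?_
  have h2 : ‖Function.uncurry (procOf h) p‖ ≤ √(procOf h p.1 p.2 ⬝ᵥ procOf h p.1 p.2) := by
    refine (pi_norm_le_iff_of_nonneg (Real.sqrt_nonneg _)).2 fun i => Real.le_sqrt_of_sq_le ?_
    rw [Real.norm_eq_abs, sq_abs, pow_two]
    exact Finset.single_le_sum (f := fun i => procOf h p.1 p.2 i * procOf h p.1 p.2 i)
      (fun i _ => mul_self_nonneg _) (Finset.mem_univ i)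
  have h3 : 0 ≤ procOf h p.1 p.2 ⬝ᵥ procOf h p.1 p.2 :=
    Finset.sum_nonneg fun _ _ => mul_self_nonneg _
  calc _ ≤ √(procOf h p.1 p.2 ⬝ᵥ procOf h p.1 p.2) ^ 2 :=
        pow_le_pow_left₀ (norm_nonneg _) h2 2
    _ = _ := Real.sq_sqrt h3

/-- The admissible controls, as a subspace of the Hilbert space of square integrable processes. -/
noncomputable def admissibleSubmodule (P : Measure Ω) (T : ℝ) (x0 : Ω → Fin n → ℝ)
    (W : ℝ≥0 → Ω → Fin n → ℝ) (m : ℕ) : Submodule ℝ (ControlSpace P T m) where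
  carrier := {h | ∃ v, IsAdmissible P T x0 W v ∧
    Function.uncurry v =ᵐ[timeMeasure P T] Function.uncurry (procOf h)}
  zero_mem' := by
    refine ⟨fun _ _ => 0, ⟨fun _ _ => measurable_const, MemLp.zero⟩, ?_⟩
    filter_upwards [Lp.coeFn_zero (EuclideanSpace ℝ (Fin m)) 2 (timeMeasure P T)] with p hp
    exact (congrArg WithLp.ofLp hp).symm
  add_mem' := by
    rintro h h' ⟨v, hv, hvh⟩ ⟨v', hv', hvh'⟩
    refine ⟨_, hv.add hv', ?_⟩
    filter_upwards [hvh, hvh', procOf_add h h'] with p h1 h2 h3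
    rw [h3]
    exact congrArg₂ (· + ·) h1 h2
  smul_mem' := by
    rintro a h ⟨v, hv, hvh⟩
    refine ⟨_, hv.smul a, ?_⟩
    filter_upwards [hvh, procOf_smul a h] with p h1 h3
    rw [h3]
    exact congrArg (a • ·) h1

lemma exists_mem_admissibleSubmodule {v : ℝ → Ω → Fin m → ℝ} (hv : IsAdmissible P T x0 W v) :
    ∃ h ∈ admissibleSubmodule P T x0 W m,
      Function.uncurry v =ᵐ[timeMeasure P T] Function.uncurry (procOf h) := by
  have h1 : MemLp (fun p => WithLp.toLp 2 (Function.uncurry v p)) 2 (timeMeasure P T) :=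
    (PiLp.continuousLinearEquiv 2 ℝ fun _ : Fin m => ℝ).symm.toContinuousLinearMap.comp_memLp'
      hv.memLp
  have h2 : Function.uncurry v =ᵐ[timeMeasure P T] Function.uncurry (procOf (h1.toLp _)) := by
    filter_upwards [h1.coeFn_toLp] with p hp
    exact (congrArg WithLp.ofLp hp).symm
  exact ⟨h1.toLp _, ⟨v, hv, h2⟩, h2⟩

/-- Adaptedness survives `L²`-limits: a subsequence converges almost everywhere, and the pointwise
limit, where it exists, is adapted. -/
lemma isClosed_admissibleSubmodule :
    IsClosed (admissibleSubmodule P T x0 W m : Set (ControlSpace P T m)) := by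
  refine IsSeqClosed.isClosed fun h h' hh hlim => ?_
  choose v hv hvh using hh
  obtain ⟨ns, -, hns⟩ := (tendstoInMeasure_of_tendsto_Lp hlim).exists_seq_tendsto_ae
  have h1 : Function.uncurry (fun t ω => limUnder atTop fun k => v (ns k) t ω)
      =ᵐ[timeMeasure P T] Function.uncurry (procOf h') := by
    filter_upwards [hns, ae_all_iff.2 hvh] with p h1 h2
    refine Tendsto.limUnder_eq ?_
    have h3 := ((PiLp.continuousLinearEquiv 2 ℝ fun _ : Fin m => ℝ).continuous.tendsto _).comp h1
    refine h3.congr fun k => ?_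
    exact (h2 (ns k)).symm
  refine ⟨_, ⟨fun t ht => ?_, (memLp_congr_ae h1).2 (memLp_procOf h')⟩, h1⟩
  have h2 : ∀ k, StronglyMeasurable[filtr x0 W t] (v (ns k) t) := fun k =>
    ((hv (ns k)).adapted t ht).stronglyMeasurable
  exact (@StronglyMeasurable.limUnder _ _ _ (filtr x0 W t) _ _ _ _ _ _ _ h2).measurable

variable [IsProbabilityMeasure P]

/-- For every frozen mean field term there is a control, with its trajectory, at which the
derivative of the cost vanishes: the equation for it is uniquely solvable by Lax–Milgram, as the
second derivative of the cost is coercive. -/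
lemma exists_isCritical (hT : 0 ≤ T) (hc : c.Standing T) (hF : IsFundamental T c.A Φ Ψ)
    (hW : IsWiener W P) (hx0 : MemLp x0 2 P) (hz : MemLp z 2 (volume.restrict (Set.Icc 0 T))) :
    ∃ (u : ℝ → Ω → Fin m → ℝ) (y : ℝ → Ω → Fin n → ℝ), IsAdmissible P T x0 W u ∧
      IsTrajectory c P T x0 W z u y ∧ IsCritical c P T x0 W Φ Ψ z u y := by
  obtain ⟨δ, hδ, hR⟩ := hc.coercive_R
  have hz1 := memLp_two_integrableOn hz
  obtain ⟨y0, hy0⟩ := exists_isTrajectory hT hc hF hW hx0 hz1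
  have h0 : IsL2Pair P T (fun _ _ => (0 : Fin m → ℝ)) y0 := hy0.isL2Pair hT MemLp.zero
  have : CompleteSpace (admissibleSubmodule P T x0 W m) :=
    (isClosed_admissibleSubmodule (P := P)).completeSpace_coe
  let B : admissibleSubmodule P T x0 W m →ₗ[ℝ] admissibleSubmodule P T x0 W m →ₗ[ℝ] ℝ :=
    LinearMap.mk₂ ℝ (fun h h' => dirGrad c P T Φ Ψ 0 (procOf h.1) (response c Φ Ψ (procOf h.1))
        (procOf h'.1))
      (fun h h' k => (dirGrad_congr_left hT (procOf_add h.1 h'.1)).trans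
        (dirGrad_add_left hT hc hF (memLp_procOf _) (memLp_procOf _) (memLp_procOf _)))
      (fun a h k => (dirGrad_congr_left hT (procOf_smul a h.1)).trans (dirGrad_smul_left a))
      (fun h k k' => (dirGrad_congr_right hT (procOf_add k.1 k'.1)).trans
        (dirGrad_add_right hT hc hF MemLp.zero (isL2Pair_response hT hc hF (memLp_procOf _))
          (memLp_procOf _) (memLp_procOf _)))
      (fun a h k => (dirGrad_congr_right hT (procOf_smul a k.1)).trans (dirGrad_smul_right a))
  let l : admissibleSubmodule P T x0 W m →ₗ[ℝ] ℝ :=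
    { toFun := fun k => dirGrad c P T Φ Ψ z (fun _ _ => 0) y0 (procOf k.1)
      map_add' := fun k k' => (dirGrad_congr_right hT (procOf_add k.1 k'.1)).trans
        (dirGrad_add_right hT hc hF hz h0 (memLp_procOf _) (memLp_procOf _))
      map_smul' := fun a k =>
        (dirGrad_congr_right hT (procOf_smul a k.1)).trans (dirGrad_smul_right a) }
  obtain ⟨K1, hK1, H1⟩ := exists_abs_dirGrad_response_le (P := P) hT hc hF
  obtain ⟨K2, hK2, H2⟩ := exists_abs_dirGrad_le (P := P) hT hc hF
  set M := (∫ p, ‖stateGrad c z p.1 (y0 p.1 p.2)‖ ^ 2 ∂(timeMeasure P T)) +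
      (∫ p : ℝ × Ω, ‖c.R p.1 *ᵥ (0 : Fin m → ℝ)‖ ^ 2 ∂(timeMeasure P T)) +
      ∫ ω, ‖stateGrad c z T (y0 T ω)‖ ^ 2 ∂P with hM
  have hM0 : 0 ≤ M := by positivity
  obtain ⟨h, hh⟩ := exists_forall_bilin_eq B (-l) (K := K1 + K2 * (1 + M)) hδ
    (fun h k => by
      refine (H1 _ _ (memLp_procOf h.1) (memLp_procOf k.1)).trans ?_
      have e1 := integral_norm_sq_procOf_le h.1
      have e2 := integral_norm_sq_procOf_le k.1
      have e3 : 0 ≤ K2 * (1 + M) := by positivity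
      refine mul_le_mul (by linarith) (add_le_add e1 e2) (by positivity) (by positivity))
    (fun k => by
      rw [LinearMap.neg_apply, abs_neg]
      refine (H2 z hz _ _ _ h0 (memLp_procOf k.1)).trans ?_
      have e2 := integral_norm_sq_procOf_le k.1
      have e3 : ‖k‖ = ‖k.1‖ := rfl
      rw [e3]
      have e4 : 0 ≤ ‖k.1‖ ^ 2 := sq_nonneg _
      calc _ ≤ K2 * (‖k.1‖ ^ 2 + M) := mul_le_mul_of_nonneg_left (add_le_add e2 le_rfl) hK2
        _ ≤ (K2 * (1 + M)) * (1 + ‖k.1‖ ^ 2) := by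
          rw [mul_assoc]
          refine mul_le_mul_of_nonneg_left ?_ hK2
          nlinarith [mul_nonneg hM0 e4]
        _ ≤ _ := by
          refine mul_le_mul_of_nonneg_right (by linarith) (by positivity))
    (fun h => by
      have e1 := costGrad_self_ge hT hc hR (isL2Pair_response hT hc hF (memLp_procOf h.1))
      rw [integral_procOf_dotProduct_self] at e1
      exact e1)
  obtain ⟨u, hu, huh⟩ := h.2
  have htraj := hy0.add_response hT hc hF hz1 MemLp.zero hu.memLp
  simp only [zero_add] at htraj
  refine ⟨u, _, hu, htraj, fun w hw => ?_⟩
  obtain ⟨k, hk, hwk⟩ := exists_mem_admissibleSubmodule hw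
  have h2 : dirGrad c P T Φ Ψ 0 (procOf h.1) (response c Φ Ψ (procOf h.1)) (procOf k) =
      -dirGrad c P T Φ Ψ z (fun _ _ => 0) y0 (procOf k) := hh ⟨k, hk⟩
  rw [← dirGrad_congr_right hT hwk, ← dirGrad_congr_right hT hwk,
    ← dirGrad_congr_left hT huh, dirGrad, dirGrad] at h2
  have h3 := costGrad_add_left hc hz h0 (isL2Pair_response hT hc hF hu.memLp)
    (isL2Pair_response hT hc hF hw.memLp)
  simp only [zero_add] at h3
  rw [h3, h2]
  ring

end Existence

/-! ### The forward-backward system -/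

section System

variable {n m : ℕ} {T : ℝ} {c : Coeffs n m} {xbar : Fin n → ℝ} {ξ η ξ' η' : ℝ → Fin n → ℝ}

lemma stateGrad_self (z : ℝ → Fin n → ℝ) (t : ℝ) :
    stateGrad c z t (z t) = (c.Q t + c.Qbar t * (1 - c.S t)) *ᵥ z t := by
  simp only [stateGrad_eq, Matrix.mul_sub, Matrix.mul_one, Matrix.add_mulVec, Matrix.sub_mulVec]
  abel

lemma SolvesSystem.hasACDeriv_fwd (h : SolvesSystem c T xbar ξ η) :
    HasACDeriv T ξ
      (fun t => c.A t *ᵥ ξ t + c.B t *ᵥ (-((c.R t)⁻¹ *ᵥ ((c.B t)ᵀ *ᵥ η t))) + c.Abar t *ᵥ ξ t) := by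
  refine HasACDeriv.congr_deriv ⟨h.ac_fwd, h.ode_fwd⟩ (.of_forall fun t => ?_)
  simp only [Matrix.add_mulVec, Matrix.mulVec_neg, Matrix.mulVec_mulVec, Matrix.mul_assoc]
  abel

lemma SolvesSystem.hasACDeriv_bwd (h : SolvesSystem c T xbar ξ η) :
    HasACDeriv T η (fun t => -((c.A t)ᵀ *ᵥ η t + stateGrad c ξ t (ξ t))) := by
  refine ⟨h.ac_bwd, ?_⟩
  filter_upwards [h.ode_bwd] with t ht
  rw [stateGrad_self, add_comm]
  simpa using ht.fun_neg

lemma solvesSystem_of_hasACDeriv (h0 : ξ 0 = xbar)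
    (hξ : HasACDeriv T ξ
      (fun t => c.A t *ᵥ ξ t + c.B t *ᵥ (-((c.R t)⁻¹ *ᵥ ((c.B t)ᵀ *ᵥ η t))) + c.Abar t *ᵥ ξ t))
    (hη : HasACDeriv T η (fun t => -((c.A t)ᵀ *ᵥ η t + stateGrad c ξ t (ξ t))))
    (hT : η T = stateGrad c ξ T (ξ T)) : SolvesSystem c T xbar ξ η := by
  refine ⟨hξ.1, hη.1, ?_, ?_, h0, by rw [hT, stateGrad_self]⟩
  · filter_upwards [hξ.2] with t ht
    convert! ht using 1
    simp only [Matrix.add_mulVec, Matrix.mulVec_neg, Matrix.mulVec_mulVec, Matrix.mul_assoc]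
    abel
  · filter_upwards [hη.2] with t ht
    rw [stateGrad_self, add_comm] at ht
    simpa using ht.fun_neg

/-- Two solutions which yield the same feedback control `-R⁻¹ B* η` coincide. -/
lemma SolvesSystem.eqOn (hT : 0 ≤ T) (hc : c.Standing T) (h : SolvesSystem c T xbar ξ η)
    (h' : SolvesSystem c T xbar ξ' η')
    (hu : ∀ᵐ t ∂(volume.restrict (Set.Icc 0 T)),
      (c.R t)⁻¹ *ᵥ ((c.B t)ᵀ *ᵥ η' t) = (c.R t)⁻¹ *ᵥ ((c.B t)ᵀ *ᵥ η t)) :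
    Set.EqOn ξ' ξ (Set.Icc 0 T) ∧ Set.EqOn η' η (Set.Icc 0 T) := by
  have h1 : Set.EqOn ξ' ξ (Set.Icc 0 T) := by
    obtain ⟨Φ, Ψ, hF⟩ := exists_isFundamental hT (hc.bdd_A.add hc.bdd_Abar)
    intro t ht
    refine sub_eq_zero.1 (hF.eq_zero hT (e := fun t => ξ' t - ξ t) ?_ ?_ t ht)
    · rw [h.initial, h'.initial, sub_self]
    · refine (h'.hasACDeriv_fwd.sub h.hasACDeriv_fwd).congr_deriv ?_
      filter_upwards [hu] with t ht
      rw [ht, Matrix.add_mulVec, Matrix.mulVec_sub, Matrix.mulVec_sub]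
      abel
  refine ⟨h1, ?_⟩
  obtain ⟨Φ, Ψ, hF⟩ := exists_isFundamental hT hc.bdd_A
  intro t ht
  refine sub_eq_zero.1 (hF.eq_zero_of_adjoint hT (e := fun t => η' t - η t) ?_ ?_ t ht)
  · rw [h.terminal, h'.terminal, h1 ⟨hT, le_rfl⟩, sub_self]
  · refine (h'.hasACDeriv_bwd.sub h.hasACDeriv_bwd).congr_deriv ?_
    filter_upwards [ae_restrict_mem measurableSet_Icc] with t ht
    rw [stateGrad_self, stateGrad_self, h1 ht, Matrix.mulVec_sub]
    abel

lemma SameUpToS.symm {c' : Coeffs n m} (h : SameUpToS c c' T) : SameUpToS c' c T :=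
  ⟨fun t ht => (h.A t ht).symm, fun t ht => (h.Abar t ht).symm, fun t ht => (h.B t ht).symm,
    fun t ht => (h.sig t ht).symm, fun t ht => (h.Q t ht).symm, fun t ht => (h.R t ht).symm,
    fun t ht => (h.calS t ht).symm⟩

lemma SolvesSystem.of_sameUpToS (hT : 0 ≤ T) {c' : Coeffs n m} (hcc : SameUpToS c c' T)
    (h : SolvesSystem c T xbar ξ η) : SolvesSystem c' T xbar ξ η := by
  refine ⟨h.ac_fwd, h.ac_bwd, ?_, ?_, h.initial, ?_⟩
  · filter_upwards [h.ode_fwd, ae_restrict_mem measurableSet_Icc] with t h1 ht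
    rwa [← hcc.A t ht, ← hcc.Abar t ht, ← hcc.B t ht, ← hcc.R t ht]
  · filter_upwards [h.ode_bwd, ae_restrict_mem measurableSet_Icc] with t h1 ht
    rwa [← hcc.A t ht, ← hcc.Q t ht, ← hcc.calS t ht]
  · have hTm : T ∈ Set.Icc 0 T := ⟨hT, le_rfl⟩
    rw [h.terminal, hcc.Q T hTm, hcc.calS T hTm]

end System

/-! ### Equilibria and solutions of the system -/

section Equilibrium

variable {Ω : Type*} [MeasurableSpace Ω] {P : Measure Ω} [IsProbabilityMeasure P] {n m : ℕ} {T : ℝ}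
  {c : Coeffs n m} {Φ Ψ : ℝ → Matrix (Fin n) (Fin n) ℝ}
  {x0 : Ω → Fin n → ℝ} {W : ℝ≥0 → Ω → Fin n → ℝ} {z : ℝ → Fin n → ℝ}
  {u : ℝ → Ω → Fin m → ℝ} {y : ℝ → Ω → Fin n → ℝ} {ξ η : ℝ → Fin n → ℝ}

omit [IsProbabilityMeasure P] in
lemma eq_neg_inv_mulVec (hc : c.Standing T) {t : ℝ} (ht : t ∈ Set.Icc 0 T) {v : Fin m → ℝ}
    {p : Fin n → ℝ} (h : c.R t *ᵥ v + (c.B t)ᵀ *ᵥ p = 0) :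
    v = -((c.R t)⁻¹ *ᵥ ((c.B t)ᵀ *ᵥ p)) := by
  obtain ⟨δ, hδ, hR⟩ := hc.coercive_R
  rw [← Matrix.mulVec_neg, ← eq_neg_of_add_eq_zero_left h, Matrix.mulVec_mulVec,
    Matrix.nonsing_inv_mul _ (isUnit_det_of_coercive hδ (hR t ht)), Matrix.one_mulVec]

lemma IsCritical.congr_mean (hT : 0 ≤ T) {z' : ℝ → Fin n → ℝ}
    (h : IsCritical c P T x0 W Φ Ψ z u y) (hz : ∀ t ∈ Set.Icc 0 T, z t = z' t) :
    IsCritical c P T x0 W Φ Ψ z' u y := fun w hw => by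
  rw [← costGrad_congr_mean hT hz, h w hw]

variable (hT : 0 ≤ T) (hc : c.Standing T) (hF : IsFundamental T c.A Φ Ψ) (hW : IsWiener W P)
  (hx0 : MemLp x0 2 P)

include hT hc hF hW in
/-- A critical pair for a frozen mean field term which is its own mean is an equilibrium. -/
lemma IsCritical.isEquilibrium
    (hu : IsAdmissible P T x0 W u) (hy : IsTrajectory c P T x0 W z u y)
    (h : IsCritical c P T x0 W Φ Ψ z u y) (hmean : ∀ t ∈ Set.Icc 0 T, z t = ∫ ω, y t ω ∂P) :
    IsEquilibrium c P T x0 W u := by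
  have hy' := hy.congr_mean hmean
  exact ⟨hu, y, hy', (optimal_iff_isCritical hT hc hF hW (memLp_mean hy.memLp) hu hy').2
    (h.congr_mean hT hmean)⟩

include hT hc hF hW hx0 in
/-- The mean of an equilibrium trajectory, together with its adjoint state, solves the system. -/
lemma IsEquilibrium.exists_solvesSystem (h : IsEquilibrium c P T x0 W u) :
    ∃ (y : ℝ → Ω → Fin n → ℝ) (η : ℝ → Fin n → ℝ),
      IsTrajectory c P T x0 W (fun t => ∫ ω, y t ω ∂P) u y ∧
      IsCritical c P T x0 W Φ Ψ (fun t => ∫ ω, y t ω ∂P) u y ∧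
      SolvesSystem c T (∫ ω, x0 ω ∂P) (fun t => ∫ ω, y t ω ∂P) η := by
  obtain ⟨hu, y, hy, hopt⟩ := h
  have hz := memLp_mean hy.memLp
  have hcrit := (optimal_iff_isCritical hT hc hF hW hz hu hy).1 hopt
  obtain ⟨p, hpT, hp, hpu⟩ := hcrit.exists_mean_adjoint hT hc hF hz (hy.isL2Pair hT hu.memLp)
  obtain ⟨h1, h2⟩ := hy.mean_eq hT hc hW hx0 hz hu.memLp
  refine ⟨y, p, hy, hcrit, solvesSystem_of_hasACDeriv ?_ ?_ hp hpT⟩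
  · rw [h2 0 ⟨le_rfl, hT⟩]
    simp
  · refine (h1.congr hT fun t ht => (h2 t ht).symm).congr_deriv ?_
    filter_upwards [hpu, ae_restrict_mem measurableSet_Icc] with t h3 ht
    rw [eq_neg_inv_mulVec hc ht h3]

include hT hc hF hW hx0 in
/-- If the mean field term `ξ` is part of a solution of the system, it is the mean of the optimal
trajectory: the difference of the two means, with the difference of the adjoint states, solves the
homogeneous forward-backward system without mean field term, whose only solution is zero. -/
lemma SolvesSystem.mean_eq (h : SolvesSystem c T (∫ ω, x0 ω ∂P) ξ η)
    (hu : IsAdmissible P T x0 W u) (hy : IsTrajectory c P T x0 W ξ u y)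
    (hcrit : IsCritical c P T x0 W Φ Ψ ξ u y) :
    (∀ t ∈ Set.Icc 0 T, ξ t = ∫ ω, y t ω ∂P) ∧
    ∀ᵐ t ∂(volume.restrict (Set.Icc 0 T)),
      ∫ ω, u t ω ∂P = -((c.R t)⁻¹ *ᵥ ((c.B t)ᵀ *ᵥ η t)) := by
  obtain ⟨δ, hδ, hR⟩ := hc.coercive_R
  have hξ := h.hasACDeriv_fwd
  have hη := h.hasACDeriv_bwd
  have hz := hξ.memLp hT
  have hTm : T ∈ Set.Icc 0 T := ⟨hT, le_rfl⟩
  obtain ⟨p, hpT, hp, hpu⟩ := hcrit.exists_mean_adjoint hT hc hF hz (hy.isL2Pair hT hu.memLp)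
  obtain ⟨h1, h2⟩ := hy.mean_eq hT hc hW hx0 hz hu.memLp
  have hy' := h1.congr hT fun t ht => (h2 t ht).symm
  set w : ℝ → Fin m → ℝ := fun t => ∫ ω, u t ω ∂P - -((c.R t)⁻¹ *ᵥ ((c.B t)ᵀ *ᵥ η t)) with hw
  set d : ℝ → Fin n → ℝ := fun t => ∫ ω, y t ω ∂P - ξ t with hd
  set π : ℝ → Fin n → ℝ := fun t => p t - η t with hπ
  have hw2 : MemLp w 2 (volume.restrict (Set.Icc 0 T)) := by
    have e1 : MemLp (fun t => (c.R t)⁻¹ *ᵥ ((c.B t)ᵀ *ᵥ η t)) 2 (volume.restrict (Set.Icc 0 T)) :=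
      (hc.bdd_R.inv hδ hR).memLp_mulVec (.id _)
        (hc.bdd_B.transpose.memLp_mulVec (.id _) (hη.memLp hT))
    exact (memLp_mean hu.memLp).sub e1.neg
  have hd0 : d 0 = 0 := by
    simp only [hd]
    rw [h2 0 ⟨le_rfl, hT⟩, h.initial]
    simp
  have hdd : HasACDeriv T d (fun t => c.A t *ᵥ d t + c.B t *ᵥ w t) := by
    refine (hy'.sub hξ).congr_deriv (.of_forall fun t => ?_)
    simp only [hd, hw, Matrix.mulVec_sub]
    abel
  have hgrad : ∀ t, stateGrad c ξ t (∫ ω, y t ω ∂P) - stateGrad c ξ t (ξ t) =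
      stateGrad c 0 t (d t) := fun t => by
    rw [sub_eq_iff_eq_add', ← stateGrad_add]
    simp [hd]
  have hπd : HasACDeriv T π (fun t => -((c.A t)ᵀ *ᵥ π t + stateGrad c 0 t (d t))) := by
    refine (hp.sub hη).congr_deriv (.of_forall fun t => ?_)
    beta_reduce
    rw [← hgrad, hπ, Matrix.mulVec_sub]
    abel
  have hπT : π T = stateGrad c 0 T (d T) := by
    rw [← hgrad, ← hpT, stateGrad_self, ← h.terminal]
  obtain ⟨h3, h4⟩ := dotProduct_terminal_eq hT hd0 hdd hπd
  have hpos : ∀ t ∈ Set.Icc 0 T, 0 ≤ stateGrad c 0 t (d t) ⬝ᵥ d t := fun t ht => by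
    rw [dotProduct_comm]
    exact dotProduct_stateGrad_nonneg hc ht _
  -- the integrand of the duality identity is `-(w · R w) - d · (Q + Q̄) d`
  have h5 : ∀ᵐ t ∂(volume.restrict (Set.Icc 0 T)),
      π t ⬝ᵥ (c.B t *ᵥ w t) - stateGrad c 0 t (d t) ⬝ᵥ d t ≤ -(δ * (w t ⬝ᵥ w t)) := by
    filter_upwards [hpu, ae_restrict_mem measurableSet_Icc] with t h6 ht
    have h7 : (c.B t)ᵀ *ᵥ π t = -(c.R t *ᵥ w t) := by
      have h8 : c.R t *ᵥ ((c.R t)⁻¹ *ᵥ ((c.B t)ᵀ *ᵥ η t)) = (c.B t)ᵀ *ᵥ η t := by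
        rw [Matrix.mulVec_mulVec, Matrix.mul_nonsing_inv _ (isUnit_det_of_coercive hδ (hR t ht)),
          Matrix.one_mulVec]
      simp only [hπ, hw, Matrix.mulVec_sub, Matrix.mulVec_neg, h8]
      rw [eq_neg_of_add_eq_zero_right h6]
      abel
    rw [Matrix.dotProduct_mulVec, ← Matrix.mulVec_transpose, h7, neg_dotProduct,
      dotProduct_comm _ (w t)]
    have h8 := le_dotProduct_mulVec_of_coercive (hR t ht) (w t)
    have h9 := hpos t ht
    linarith
  have hww := integrable_dotProduct hw2 hw2
  have h6 := integral_mono_ae h3 (hww.const_mul δ).neg h5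
  rw [← h4, hπT] at h6
  have h7 : ∀ t, 0 ≤ w t ⬝ᵥ w t := fun t => Finset.sum_nonneg fun _ _ => mul_self_nonneg _
  have h8 : ∫ t in Set.Icc 0 T, w t ⬝ᵥ w t = 0 := by
    have h9 := (hpos T hTm).trans h6
    simp only [Pi.neg_apply] at h9
    rw [integral_neg, integral_const_mul] at h9
    exact le_antisymm (nonpos_of_mul_nonpos_right (by linarith) hδ) (integral_nonneg h7)
  rw [integral_eq_zero_iff_of_nonneg h7 hww] at h8
  have h9 : ∀ᵐ t ∂(volume.restrict (Set.Icc 0 T)), w t = 0 := by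
    filter_upwards [h8] with t ht using dotProduct_self_eq_zero.1 ht
  constructor
  · intro t ht
    refine (sub_eq_zero.1 (hF.eq_zero hT hd0 (hdd.congr_deriv ?_) t ht)).symm
    filter_upwards [h9] with s hs
    rw [hs, Matrix.mulVec_zero, add_zero]
  · filter_upwards [h9] with t ht using sub_eq_zero.1 ht

include hT hc hF hW hx0 in
/-- Every solution of the system comes from an equilibrium. -/
lemma SolvesSystem.exists_isEquilibrium (h : SolvesSystem c T (∫ ω, x0 ω ∂P) ξ η) :
    ∃ u : ℝ → Ω → Fin m → ℝ, IsEquilibrium c P T x0 W u ∧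
      ∀ᵐ t ∂(volume.restrict (Set.Icc 0 T)),
        ∫ ω, u t ω ∂P = -((c.R t)⁻¹ *ᵥ ((c.B t)ᵀ *ᵥ η t)) := by
  have hz := h.hasACDeriv_fwd.memLp hT
  obtain ⟨u, y, hu, hy, hcrit⟩ := exists_isCritical hT hc hF hW hx0 hz
  obtain ⟨h1, h2⟩ := h.mean_eq hT hc hF hW hx0 hu hy hcrit
  exact ⟨u, hcrit.isEquilibrium hT hc hF hW hu hy h1, h2⟩

include hT hc hW hx0

lemma hasEquilibrium_iff :
    HasEquilibrium c P T x0 W ↔ SystemSolvable c T (∫ ω, x0 ω ∂P) := by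
  obtain ⟨Φ, Ψ, hF⟩ := exists_isFundamental hT hc.bdd_A
  constructor
  · rintro ⟨u, hu⟩
    obtain ⟨y, η, -, -, h⟩ := hu.exists_solvesSystem hT hc hF hW hx0
    exact ⟨_, η, h⟩
  · rintro ⟨ξ, η, h⟩
    obtain ⟨u, hu, -⟩ := h.exists_isEquilibrium hT hc hF hW hx0
    exact ⟨u, hu⟩

lemma hasUniqueEquilibrium_iff :
    HasUniqueEquilibrium c P T x0 W ↔ SystemUniquelySolvable c T (∫ ω, x0 ω ∂P) := by
  obtain ⟨Φ, Ψ, hF⟩ := exists_isFundamental hT hc.bdd_A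
  constructor
  · rintro ⟨u, hu, huniq⟩
    obtain ⟨y, η, -, -, h⟩ := hu.exists_solvesSystem hT hc hF hW hx0
    refine ⟨_, η, h, fun ξ' η' h' => h.eqOn hT hc h' ?_⟩
    obtain ⟨u1, hu1, hη1⟩ := h.exists_isEquilibrium hT hc hF hW hx0
    obtain ⟨u2, hu2, hη2⟩ := h'.exists_isEquilibrium hT hc hF hW hx0
    have h12 : Function.uncurry u2 =ᵐ[timeMeasure P T] Function.uncurry u1 :=
      (huniq u2 hu2).trans (huniq u1 hu1).symm
    filter_upwards [Measure.ae_ae_of_ae_prod h12, hη1, hη2] with t h3 h4 h5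
    rw [← neg_inj, ← h4, ← h5]
    exact integral_congr_ae h3
  · rintro ⟨ξ, η, h, huniq⟩
    obtain ⟨u, hu, -⟩ := h.exists_isEquilibrium hT hc hF hW hx0
    refine ⟨u, hu, fun u' hu' => ?_⟩
    -- both trajectories have mean `ξ`, so both controls are critical for the same mean field term
    obtain ⟨y, η1, hy, hcrit, h1⟩ := hu.exists_solvesSystem hT hc hF hW hx0
    obtain ⟨y', η2, hy', hcrit', h2⟩ := hu'.exists_solvesSystem hT hc hF hW hx0
    have e : ∀ t ∈ Set.Icc 0 T, ∫ ω, y' t ω ∂P = ∫ ω, y t ω ∂P := fun t ht =>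
      ((huniq _ _ h2).1 ht).trans ((huniq _ _ h1).1 ht).symm
    exact hcrit.ae_eq hT hc hF hW (memLp_mean hy.memLp) hu.1 hy hu'.1 (hy'.congr_mean e)
      (hcrit'.congr_mean hT e)

end Equilibrium

end LQMFG

theorem theorem3p4 {Ω : Type*} [MeasurableSpace Ω] (P : Measure Ω) [IsProbabilityMeasure P]
    [P.IsComplete] {n m : ℕ} (T : ℝ) (hT : 0 < T)
    (c : LQMFG.Coeffs n m) (hc : c.Standing T)
    (x0 : Ω → Fin n → ℝ) (hx0 : Measurable x0) (hx0_sq : MemLp x0 2 P)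
    (W : ℝ≥0 → Ω → Fin n → ℝ) (hW : LQMFG.IsWiener W P)
    (hindep : IndepFun x0 (fun ω t => W t ω) P) :
    (LQMFG.HasEquilibrium c P T x0 W ↔ LQMFG.SystemSolvable c T (∫ ω, x0 ω ∂P)) ∧
    (LQMFG.HasUniqueEquilibrium c P T x0 W ↔
      LQMFG.SystemUniquelySolvable c T (∫ ω, x0 ω ∂P)) ∧
    (∀ c' : LQMFG.Coeffs n m, c'.Standing T → LQMFG.SameUpToS c c' T →
      (∀ ξ η : ℝ → Fin n → ℝ, LQMFG.SolvesSystem c T (∫ ω, x0 ω ∂P) ξ η ↔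
        LQMFG.SolvesSystem c' T (∫ ω, x0 ω ∂P) ξ η) ∧
      (LQMFG.HasEquilibrium c P T x0 W ↔ LQMFG.HasEquilibrium c' P T x0 W) ∧
      (LQMFG.HasUniqueEquilibrium c P T x0 W ↔ LQMFG.HasUniqueEquilibrium c' P T x0 W)) := by
  refine ⟨LQMFG.hasEquilibrium_iff hT.le hc hW hx0_sq,
    LQMFG.hasUniqueEquilibrium_iff hT.le hc hW hx0_sq, fun c' hc' hcc => ?_⟩
  have h : ∀ ξ η : ℝ → Fin n → ℝ, LQMFG.SolvesSystem c T (∫ ω, x0 ω ∂P) ξ η ↔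
      LQMFG.SolvesSystem c' T (∫ ω, x0 ω ∂P) ξ η := fun ξ η =>
    ⟨fun h => h.of_sameUpToS hT.le hcc, fun h => h.of_sameUpToS hT.le hcc.symm⟩
  refine ⟨h, ?_, ?_⟩
  · rw [LQMFG.hasEquilibrium_iff hT.le hc hW hx0_sq, LQMFG.hasEquilibrium_iff hT.le hc' hW hx0_sq]
    simp only [LQMFG.SystemSolvable, h]
  · rw [LQMFG.hasUniqueEquilibrium_iff hT.le hc hW hx0_sq,
      LQMFG.hasUniqueEquilibrium_iff hT.le hc' hW hx0_sq]
    simp only [LQMFG.SystemUniquelySolvable, h]
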